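/- Let $(M,\boldsymbol c)$ be a smooth conformal manifold of dimension $d\ge 3$ (Riemannian signature), and let $\Sigma\subset M$ be a smooth hypersurface. For $g\in\boldsymbol c$ let $\nabla$, $\Delta$, $\mathrm{Ric}$, $\mathrm{Sc}$ be its Levi-Civita connection, Laplacian, Ricci and scalar curvature, put $J=\frac{\mathrm{Sc}}{2(d-1)}$, and let the Schouten tensor $P$ be given by $\mathrm{Ric}=(d-2)P+Jg$. A conformal density of weight $w$ is a family of smooth functions $(f_g)_{g\in\boldsymbol c}$ on $M$ with $f_{\Omega^2g}=\Omega^wf_g$ for positive $\Omega$; a defining density for $\Sigma$ is a density $\sigma$ of weight $1$ whose zero locus is $\Sigma$ and with $d\sigma\neq0$ along $\Sigma$. For a density $\sigma$ of weight $1$ let $$S(\sigma)=|\nabla\sigma|^2-\tfrac2d\,\sigma\Big(\Delta+\tfrac{\mathrm{Sc}}{2(d-1)}\Big)\sigma .$$ Let $\bar\sigma$ be a defining density for $\Sigma$ such that $S(\bar\sigma)=1+\bar\sigma^{d}B$ with $B$ a smooth density of weight $-d$. The ASC obstruction density of $\Sigma$ is $\mathcal B=B|_\Sigma$. Along $\Sigma$,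 for $g\in\boldsymbol c$, let $\hat n=d\bar\sigma/|d\bar\sigma|_g$ be the unit conormal, $\mathrm{II}_{ab}=\nabla^\top_a\hat n_b$ the second fundamental form, $H=\frac1{d-1}\mathrm{II}^a{}_a$ the mean curvature, $\bar g$ the induced metric, $\mathring{\mathrm{II}}_{ab}=\mathrm{II}_{ab}-H\bar g_{ab}$, $P^\top$ the tangential part of $P$, $\bar\nabla$ and $\bar\Delta$ the Levi-Civita connection and Laplacian of $\bar g$, and $\bar J=\overline{\mathrm{Sc}}/(2(d-2))$, where $\overline{\mathrm{Sc}}$ is the scalar curvature of $\bar g$. (i) If $d=3$, then, for every $g\in\boldsymbol c$, $$\mathcal B=-\frac13\Big(\bar\nabla_a\bar\nabla_b+H\mathring{\mathrm{II}}_{ab}+P^\top_{ab}\Big)\mathring{\mathrm{II}}^{ab}.$$ This recovers the Willmore invariant: wherever $g\in\boldsymbol c$ is flat, $\mathcal B=-\frac13\big(\bar\Delta H+2H(H^2-K)\big)$, where $K$ is the Gauss curvature of $\bar g$. (ii) If $d=4$ and $g\in\boldsymbol c$ is flat on an open set $U\subseteq M$ (a flat scale on $U$; such local scales exist about every point when $(M,\boldsymbol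 c)$ is conformally flat), then on $\Sigma\cap U$ $$\mathcal B=\frac16\Big((\bar\nabla_c\mathring{\mathrm{II}}_{ab})^2+2\,\mathring{\mathrm{II}}^{ab}\bar\Delta\mathring{\mathrm{II}}_{ab}+\frac32(\bar\nabla^b\mathring{\mathrm{II}}_{ab})\bar\nabla^c\mathring{\mathrm{II}}^a{}_c-2\bar J\,\mathring{\mathrm{II}}_{ab}\mathring{\mathrm{II}}^{ab}+(\mathring{\mathrm{II}}_{ab}\mathring{\mathrm{II}}^{ab})^2\Big).$$ -/

import Mathlib

open scoped Manifold ContDiff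

noncomputable section

namespace ConfHyp

/-- The coordinate space `ℝⁿ`. -/
abbrev E (n : ℕ) : Type := EuclideanSpace ℝ (Fin n)

/-! ### Riemannian geometry in coordinates

Below `G : E n → Matrix (Fin n) (Fin n) ℝ` is the matrix of components of a Riemannian metric in a
coordinate system, and tensor fields are given by their components, functions on `E n`. All
formulas are used only at interior points of the coordinate domain. -/

/-- The partial derivative `∂ᵢ f`. -/
def pd {n : ℕ} (i : Fin n) (f : E n → ℝ) (x : E n) : ℝ :=
  fderiv ℝ f x (EuclideanSpace.single i (1 : ℝ))

section Coordinates

variable {n : ℕ} (G : E n → Matrix (Fin n) (Fin n) ℝ)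

/-- The inverse metric `gⁱʲ`. -/
def ginv (i j : Fin n) (x : E n) : ℝ := (G x)⁻¹ i j

/-- The Christoffel symbols `Γᵏᵢⱼ` of the Levi-Civita connection. -/
def christoffel (k i j : Fin n) (x : E n) : ℝ :=
  ∑ l, (1 / 2 : ℝ) * ginv G k l x *
    (pd i (fun y => G y j l) x + pd j (fun y => G y i l) x - pd l (fun y => G y i j) x)

/-- The Riemann tensor `R_{ab}{}^c{}_d`, where `R(u,v)w = u^a v^b w^d R_{ab}{}^c{}_d` and
`R(u,v)w = ∇_u ∇_v w - ∇_v ∇_u w - ∇_{[u,v]} w`. -/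
def riemann (a b c d : Fin n) (x : E n) : ℝ :=
  pd a (christoffel G c b d) x - pd b (christoffel G c a d) x
    + ∑ e, (christoffel G c a e x * christoffel G e b d x
      - christoffel G c b e x * christoffel G e a d x)

/-- The Ricci tensor `Ric_{ab} = R_{ca}{}^c{}_b`. -/
def ricci (a b : Fin n) (x : E n) : ℝ := ∑ c, riemann G c a c b x

/-- The scalar curvature `Sc = g^{ab} Ric_{ab}`. -/
def scalarCurv (x : E n) : ℝ := ∑ a, ∑ b, ginv G a b x * ricci G a b x

/-- The quantity `J = Sc / (2 (n - 1))`; in dimension two, `J = Sc / 2` is the Gauss curvature. -/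
def schoutenJ (x : E n) : ℝ := scalarCurv G x / (2 * ((n : ℝ) - 1))

/-- The Schouten tensor (for `n ≥ 3`), determined by `Ric = (n - 2) P + J g`. -/
def schouten (a b : Fin n) (x : E n) : ℝ :=
  (ricci G a b x - schoutenJ G x * G x a b) / ((n : ℝ) - 2)

/-- The Laplacian `Δ f = g^{ij} ∇ᵢ ∇ⱼ f` on functions. -/
def laplacian (f : E n → ℝ) (x : E n) : ℝ :=
  ∑ i, ∑ j, ginv G i j x * (pd i (pd j f) x - ∑ k, christoffel G k i j x * pd k f x)

/-- The squared length `|df|²` of the gradient. -/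
def gradSq (f : E n → ℝ) (x : E n) : ℝ := ∑ i, ∑ j, ginv G i j x * pd i f x * pd j f x

/-- The covariant derivative `∇_a θ_b` of a covector field `θ`. -/
def nabla1 (θ : Fin n → E n → ℝ) (a b : Fin n) (x : E n) : ℝ :=
  pd a (θ b) x - ∑ k, christoffel G k a b x * θ k x

/-- The covariant derivative `∇_c T_{ab}` of a covariant 2-tensor. -/
def nabla2 (T : Fin n → Fin n → E n → ℝ) (c a b : Fin n) (x : E n) : ℝ :=
  pd c (T a b) x - ∑ k, christoffel G k c a x * T k b x - ∑ k, christoffel G k c b x * T a k x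

/-- The covariant derivative `∇_e T_{cab}` of a covariant 3-tensor. -/
def nabla3 (T : Fin n → Fin n → Fin n → E n → ℝ) (e c a b : Fin n) (x : E n) : ℝ :=
  pd e (T c a b) x - ∑ k, christoffel G k e c x * T k a b x
    - ∑ k, christoffel G k e a x * T c k b x - ∑ k, christoffel G k e b x * T c a k x

/-- The components `T^{ab}` of a covariant 2-tensor with indices raised. -/
def raise2 (T : Fin n → Fin n → E n → ℝ) (a b : Fin n) (x : E n) : ℝ :=
  ∑ c, ∑ d, ginv G a c x * ginv G b d x * T c d x

/-- The full contraction `T_{ab} T'^{ab}`. -/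
def inner2 (T T' : Fin n → Fin n → E n → ℝ) (x : E n) : ℝ :=
  ∑ a, ∑ b, T a b x * raise2 G T' a b x

/-- The singular Yamabe operator `S(u) = |∇u|² - (2/n) u (Δ + Sc / (2 (n - 1))) u`. -/
def yamabeS (u : E n → ℝ) (x : E n) : ℝ :=
  gradSq G u x - (2 / (n : ℝ)) * u x * (laplacian G u x + schoutenJ G x * u x)

/-- The unit conormal `n̂ = du / |du|` of the level sets of `u`. -/
def unitConormal (u : E n → ℝ) (a : Fin n) (x : E n) : ℝ := pd a u x / √(gradSq G u x)

end Coordinates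

/-! ### The hypersurface `x₀ = 0` in coordinates

Here `G` is the matrix of an ambient metric in coordinates `(x₀, x₁, …, x_m)`, and `u` is a function
with zero set `x₀ = 0` there, so that `(x₁, …, x_m)` are coordinates on the hypersurface. The
hypersurface quantities are functions of `y ∈ E m`. -/

section Slice

/-- The inclusion `y ↦ (0, y)` of the hypersurface. -/
def incl {m : ℕ} (y : E m) : E (m + 1) := WithLp.toLp 2 (Fin.cons 0 fun i => y i)

/-- The tangential coordinates `(x₁, …, x_m)` of `x`. -/
def tang {m : ℕ} (x : E (m + 1)) : E m := WithLp.toLp 2 fun i => x i.succ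

variable {m : ℕ} (G : E (m + 1) → Matrix (Fin (m + 1)) (Fin (m + 1)) ℝ)

/-- The induced metric `ḡ`. -/
def inducedMetric (y : E m) : Matrix (Fin m) (Fin m) ℝ :=
  Matrix.of fun i j => G (incl y) i.succ j.succ

variable (u : E (m + 1) → ℝ)

/-- The second fundamental form `II_{ij}`, the tangential part of `∇_i n̂_j`. -/
def secondFF (i j : Fin m) (y : E m) : ℝ :=
  nabla1 G (unitConormal G u) i.succ j.succ (incl y)

/-- The mean curvature `H = (1/m) II^a_a`, where `m = d - 1`. -/
def meanCurv (y : E m) : ℝ :=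
  (1 / (m : ℝ)) * ∑ i, ∑ j, ginv (inducedMetric G) i j y * secondFF G u i j y

/-- The trace-free second fundamental form. -/
def tfSecondFF (i j : Fin m) (y : E m) : ℝ :=
  secondFF G u i j y - meanCurv G u y * inducedMetric G y i j

/-- The tangential part `P^⊤` of the ambient Schouten tensor. -/
def schoutenTop (i j : Fin m) (y : E m) : ℝ := schouten G i.succ j.succ (incl y)

/-- The intrinsic covariant derivative `∇̄_c II°_{ab}`. -/
def dII (c a b : Fin m) (y : E m) : ℝ := nabla2 (inducedMetric G) (tfSecondFF G u) c a b y

/-- The second intrinsic covariant derivative `∇̄_e ∇̄_c II°_{ab}`. -/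
def ddII (e c a b : Fin m) (y : E m) : ℝ := nabla3 (inducedMetric G) (dII G u) e c a b y

/-- `∇̄_a ∇̄_b II°^{ab}`. -/
def divdivII (y : E m) : ℝ :=
  ∑ a, ∑ b, ∑ c, ∑ d,
    ginv (inducedMetric G) a c y * ginv (inducedMetric G) b d y * ddII G u a b c d y

/-- `Δ̄ II°_{ab}`. -/
def lapII (a b : Fin m) (y : E m) : ℝ :=
  ∑ c, ∑ d, ginv (inducedMetric G) c d y * ddII G u c d a b y

/-- `∇̄^b II°_{ab}`. -/
def divII (a : Fin m) (y : E m) : ℝ :=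
  ∑ b, ∑ c, ginv (inducedMetric G) b c y * dII G u c a b y

/-- `(∇̄_c II°_{ab})²`. -/
def normSqDII (y : E m) : ℝ :=
  ∑ c, ∑ c', ginv (inducedMetric G) c c' y *
    inner2 (inducedMetric G) (dII G u c) (dII G u c') y

/-- `(∇̄^b II°_{ab}) ∇̄^c II°^a{}_c`. -/
def normSqDivII (y : E m) : ℝ :=
  ∑ a, ∑ a', ginv (inducedMetric G) a a' y * divII G u a y * divII G u a' y

/-- `II°_{ab} II°^{ab}`. -/
def normSqII (y : E m) : ℝ := inner2 (inducedMetric G) (tfSecondFF G u) (tfSecondFF G u) y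

/-- `-(1/3) (∇̄_a ∇̄_b + H II°_{ab} + P^⊤_{ab}) II°^{ab}`. -/
def surfaceFormula (y : E m) : ℝ :=
  -(1 / 3 : ℝ) * (divdivII G u y + meanCurv G u y * normSqII G u y
    + inner2 (inducedMetric G) (schoutenTop G) (tfSecondFF G u) y)

/-- The Willmore invariant `Δ̄ H + 2 H (H² - K)`. For `m = 2` the Gauss curvature `K` of the surface
is `J̄ = S̄c / 2`. -/
def willmoreInvariant (y : E m) : ℝ :=
  laplacian (inducedMetric G) (meanCurv G u) y
    + 2 * meanCurv G u y * (meanCurv G u y ^ 2 - schoutenJ (inducedMetric G) y)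

/-- `(1/6) ((∇̄_c II°_{ab})² + 2 II°^{ab} Δ̄ II°_{ab} + (3/2) (∇̄^b II°_{ab}) ∇̄^c II°^a{}_c
- 2 J̄ II°_{ab} II°^{ab} + (II°_{ab} II°^{ab})²)`. -/
def threefoldFormula (y : E m) : ℝ :=
  (1 / 6 : ℝ) * (normSqDII G u y
    + 2 * inner2 (inducedMetric G) (lapII G u) (tfSecondFF G u) y
    + (3 / 2 : ℝ) * normSqDivII G u y
    - 2 * schoutenJ (inducedMetric G) y * normSqII G u y
    + normSqII G u y ^ 2)

end Slice

/-! ### Conformal manifolds and densities -/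

section Manifold

variable {n : ℕ} (M : Type*) [TopologicalSpace M] [ChartedSpace (E n) M]
  [IsManifold (𝓡 n) ∞ M]

/-- Smooth Riemannian metrics on the `n`-manifold `M`. -/
abbrev Metric (n : ℕ) (M : Type*) [TopologicalSpace M] [ChartedSpace (E n) M]
    [IsManifold (𝓡 n) ∞ M] : Type _ :=
  Bundle.ContMDiffRiemannianMetric (𝓡 n) ∞ (E n) (fun x : M => TangentSpace (𝓡 n) x)

variable {M}

/-- `g' = Ω² g`, with `Ω` positive. -/
def IsRescaling (Ω : M → ℝ) (g g' : Metric n M) : Prop :=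
  (∀ x, 0 < Ω x) ∧
    ∀ (x : M) (v w : TangentSpace (𝓡 n) x), g'.inner x v w = Ω x ^ 2 * g.inner x v w

variable (n M) in
/-- A conformal structure: an equivalence class of smooth Riemannian metrics for the relation
`g' = Ω² g` with `Ω` smooth and positive. -/
structure ConformalStructure where
  metrics : Set (Metric n M)
  nonempty : metrics.Nonempty
  mem_iff : ∀ g ∈ metrics, ∀ g' : Metric n M,
    g' ∈ metrics ↔ ∃ Ω : M → ℝ, ContMDiff (𝓡 n) 𝓘(ℝ, ℝ) ∞ Ω ∧ IsRescaling Ω g g'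

/-- A smooth conformal density of weight `w`: a smooth function `f_g` for each metric `g` of the
conformal class, such that `f_{Ω² g} = Ω^w f_g`. -/
structure Density (c : ConformalStructure n M) (w : ℤ) where
  val : c.metrics → M → ℝ
  smooth : ∀ g, ContMDiff (𝓡 n) 𝓘(ℝ, ℝ) ∞ (val g)
  rescale : ∀ (g g' : c.metrics) (Ω : M → ℝ), IsRescaling Ω g.1 g'.1 →
    ∀ x, val g' x = Ω x ^ w * val g x

/-- `σ` is a defining density for the hypersurface `S`: `S` is its zero locus, and its
derivative vanishes nowhere along `S`. -/
def IsDefiningDensity {c : ConformalStructure n M} (σ : Density c 1) (S : Set M) : Prop :=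
  ∀ g : c.metrics, (∀ x, σ.val g x = 0 ↔ x ∈ S) ∧
    ∀ x ∈ S, mfderiv (𝓡 n) 𝓘(ℝ, ℝ) (σ.val g) x ≠ 0

/-- The smooth coordinate systems of `M`. -/
abbrev IsChart (e : OpenPartialHomeomorph M (E n)) : Prop :=
  e ∈ IsManifold.maximalAtlas (𝓡 n) ∞ M

/-- The components `g(∂ᵢ, ∂ⱼ)` of the metric `g` in the coordinate system `e`. -/
def metricIn (g : Metric n M) (e : OpenPartialHomeomorph M (E n)) (x : E n) :
    Matrix (Fin n) (Fin n) ℝ :=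
  Matrix.of fun i j => g.inner (e.symm x)
    (mfderiv (𝓡 n) (𝓡 n) e.symm x (EuclideanSpace.single i (1 : ℝ) : E n))
    (mfderiv (𝓡 n) (𝓡 n) e.symm x (EuclideanSpace.single j (1 : ℝ) : E n))

/-- The metric `g` is flat on `U`: its Riemann tensor vanishes there. -/
def IsFlatOn (g : Metric n M) (U : Set M) : Prop :=
  ∀ e : OpenPartialHomeomorph M (E n), IsChart e → ∀ x ∈ e.target, e.symm x ∈ U →
    ∀ a b c d, riemann (metricIn g e) a b c d x = 0

/-- The equation `S(σ) = 1 + σⁿ B` between densities of weight `0`. -/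
def SolvesYamabe {c : ConformalStructure n M} (σ : Density c 1) (B : Density c (-(n : ℤ))) :
    Prop :=
  ∀ (g : c.metrics) (e : OpenPartialHomeomorph M (E n)), IsChart e → ∀ x ∈ e.target,
    yamabeS (metricIn g.1 e) (fun z => σ.val g (e.symm z)) x
      = 1 + σ.val g (e.symm x) ^ n * B.val g (e.symm x)

/-- `B`, restricted to `S`, is the ASC obstruction density of the hypersurface `S`, with `σ` as the
conformal unit defining density: `σ` is a smooth defining density for `S` and
`S(σ) = 1 + σⁿ B` with `B` a smooth density of weight `-n`. -/
def IsASCObstruction {c : ConformalStructure n M} (S : Set M) (σ : Density c 1)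
    (B : Density c (-(n : ℤ))) : Prop :=
  IsDefiningDensity σ S ∧ SolvesYamabe σ B

/-- A coordinate system adapted to the hypersurface `S`, in which `S` is given by `x₀ = 0`. -/
def IsSliceChart {m : ℕ} {M : Type*} [TopologicalSpace M] [ChartedSpace (E (m + 1)) M]
    [IsManifold (𝓡 (m + 1)) ∞ M] (S : Set M) (e : OpenPartialHomeomorph M (E (m + 1))) : Prop :=
  IsChart e ∧ ∀ x ∈ e.source, x ∈ S ↔ e x 0 = 0

end Manifold

end ConfHyp

end

/-! Fix a scale `g` and read `σ` as a function. Let `v = |dσ|` and `N = 1/v`, let `e₀` be the unit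
normal of the level sets of `σ`, and put `X = N e₀`, so that `Xσ = 1`. In a frame adapted to the
level sets `Δσ = e₀v + vT`, where `T` is the trace of their second fundamental form `II`
(`IsAdaptedFrame.hess_trace`). As `e₀v = v Xv = ½ X(v²)`, the hypothesis becomes an equation along
the flow of `X`: v² − (2/d) σ (½ X(v²) + vT + Jσ) = 1 + σᵈ B.

Apply `X` to it `j` times and restrict to `σ = 0`. For 0 < j < d this gives (1 − j/d) Xʲ(v²) =
(2j/d) Xʲ⁻¹(vT + Jσ), which determines the normal derivatives of `v` one after another; in
particular `Xv = H` on Σ. At j = d the coefficient of Xᵈ(v²) vanishes, and what is left is d! B = −2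
Xᵈ⁻¹(vT + Jσ): the obstruction (`yamabe_three_expansion`, `yamabe_four_expansion`).

The normal derivatives of `T` come from the Riccati equation for `II` along the flow
(`IsAdapted.flow_sff`), whose terms are −∇̄²N, −N II², a rotation of the frame that drops out of
traces, and ambient curvature. Since `N = 1` on Σ, the Hessian of `N` contributes there only through
normal derivatives of `N`, and these are known from those of `v`.

For d = 3 the remaining term `XJ` is turned into tangential derivatives of curvature by the
differential Bianchi identity (`IsFrameConn.bianchi_three`); with the Codazzi equation they complete
the double divergence of the trace-free part of `II`. In a flat scale this double divergence is the
Laplacian of `H`, and the Gauss equation gives the Willmore invariant. For d = 4 and `g` flat, X³T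
requires the commutator of `X` with the Laplacian of the leaves (`IsAdapted.flow_lap`); Gauss,
Codazzi and Simons' identity then bring the result to the stated form (`threefold_identity`).

All of this is algebra in a commutative ring with derivations, restriction to Σ being a ring
homomorphism. The rest of the proof realizes the algebra by smooth functions on an open set of a
slice chart: it matches coordinate expressions with frame components (`Agrees`), identifies the
tangential connection with the intrinsic one (`IsAdaptedFrame.slice_conn`), and constructs adapted
frames by Gram–Schmidt (`exists_isAdaptedFrame`). -/

open scoped Manifold ContDiff

set_option autoImplicit false
set_option linter.unusedSectionVars false

noncomputable section

namespace ConfHyp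

/-! ### Derivations of matrices -/

section FrameAlgebra

variable {A : Type*} [CommRing A] [Algebra ℝ A] {n : ℕ}

/-- A derivation applied to all entries of a matrix. -/
def dmat {k l : Type*} (δ : Derivation ℝ A A) (M : Matrix k l A) : Matrix k l A := M.map δ

lemma dmat_apply {k l : Type*} (δ : Derivation ℝ A A) (M : Matrix k l A) (i : k) (j : l) :
    dmat δ M i j = δ (M i j) := rfl

lemma dmat_sub {k l : Type*} (δ : Derivation ℝ A A) (M N : Matrix k l A) :
    dmat δ (M - N) = dmat δ M - dmat δ N := by
  ext i j; simp [dmat]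

lemma dmat_mul {k l m : Type*} [Fintype l] (δ : Derivation ℝ A A) (M : Matrix k l A)
    (N : Matrix l m A) : dmat δ (M * N) = dmat δ M * N + M * dmat δ N := by
  ext i j
  simp only [dmat_apply, Matrix.mul_apply, Matrix.add_apply, map_sum, Derivation.leibniz,
    smul_eq_mul, ← Finset.sum_add_distrib]
  exact Finset.sum_congr rfl fun _ _ => by ring

lemma dmat_transpose {k l : Type*} (δ : Derivation ℝ A A) (M : Matrix k l A) :
    dmat δ M.transpose = (dmat δ M).transpose := rfl

lemma dmat_one {k : Type*} [DecidableEq k] (δ : Derivation ℝ A A) :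
    dmat δ (1 : Matrix k k A) = 0 := by
  ext i j
  by_cases h : i = j <;> simp [dmat, h]

/-! ### Orthonormal frames -/

/-- The data of a metric `G` with its Christoffel symbols `(Γ i) k j = Γᵏᵢⱼ` and of an orthonormal
frame, whose members are the rows of `F`, over a ring with commuting derivations `p i`. -/
structure IsOrthoFrame (p : Fin n → Derivation ℝ A A) (G : Matrix (Fin n) (Fin n) A)
    (Γ : Fin n → Matrix (Fin n) (Fin n) A) (F : Matrix (Fin n) (Fin n) A) : Prop where
  comm : ∀ i j f, p i (p j f) = p j (p i f)
  symm : G.transpose = G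
  torsion : ∀ i j k, Γ i k j = Γ j k i
  compat : ∀ i, dmat (p i) G = (Γ i).transpose * G + G * Γ i
  ortho : F * G * F.transpose = 1

/-- The derivation along a member of the frame. -/
def frameD (p : Fin n → Derivation ℝ A A) (F : Matrix (Fin n) (Fin n) A) (a : Fin n) :
    Derivation ℝ A A := ∑ i, F a i • p i

lemma frameD_apply (p : Fin n → Derivation ℝ A A) (F : Matrix (Fin n) (Fin n) A) (a : Fin n)
    (f : A) : frameD p F a f = ∑ i, F a i * p i f := by
  have h : (Derivation.coeFnAddMonoidHom (frameD p F a) : A → A) = _ :=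
    map_sum Derivation.coeFnAddMonoidHom (fun i => F a i • p i) Finset.univ
  have h' := congrFun h f
  rw [Finset.sum_apply] at h'
  exact h'

/-- The connection matrices `g(∇ᵢ e_b, e_c)` of the frame. -/
def connMat (p : Fin n → Derivation ℝ A A) (G : Matrix (Fin n) (Fin n) A)
    (Γ : Fin n → Matrix (Fin n) (Fin n) A) (F : Matrix (Fin n) (Fin n) A) (i : Fin n) :
    Matrix (Fin n) (Fin n) A :=
  (dmat (p i) F + F * (Γ i).transpose) * G * F.transpose

/-- The connection coefficients `w_{abc} = g(∇_{e_a} e_b, e_c)` of the frame. -/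
def conn (p : Fin n → Derivation ℝ A A) (G : Matrix (Fin n) (Fin n) A)
    (Γ : Fin n → Matrix (Fin n) (Fin n) A) (F : Matrix (Fin n) (Fin n) A) (a b c : Fin n) : A :=
  ∑ i, F a i * connMat p G Γ F i b c

/-- The properties of the connection coefficients of an orthonormal frame. -/
structure IsFrameConn (D : Fin n → Derivation ℝ A A) (w : Fin n → Fin n → Fin n → A) : Prop where
  skew : ∀ a b c, w a b c = -w a c b
  bracket : ∀ a b f, D a (D b f) - D b (D a f) = ∑ c, (w a b c - w b a c) * D c f

/-- The components `g(R(e_a, e_b) e_c, e_d)` of the Riemann tensor in a frame. -/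
def frameRiem (D : Fin n → Derivation ℝ A A) (w : Fin n → Fin n → Fin n → A) (a b c d : Fin n) :
    A :=
  D a (w b c d) - D b (w a c d) + ∑ f, (w b c f * w a f d - w a c f * w b f d)
    - ∑ f, (w a b f - w b a f) * w f c d

/-- The curvature matrices `∂ᵢ Γⱼ - ∂ⱼ Γᵢ + [Γᵢ, Γⱼ]`. -/
def curvMat (p : Fin n → Derivation ℝ A A) (Γ : Fin n → Matrix (Fin n) (Fin n) A) (i j : Fin n) :
    Matrix (Fin n) (Fin n) A :=
  dmat (p i) (Γ j) - dmat (p j) (Γ i) + (Γ i * Γ j - Γ j * Γ i)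

variable {p : Fin n → Derivation ℝ A A} {G : Matrix (Fin n) (Fin n) A}
  {Γ : Fin n → Matrix (Fin n) (Fin n) A} {F : Matrix (Fin n) (Fin n) A}

namespace IsOrthoFrame

lemma transpose_mul (h : IsOrthoFrame p G Γ F) : F.transpose * (F * G) = 1 :=
  mul_eq_one_comm.mp h.ortho

/-- Orthonormality inverted: `Fᵀ F` is the inverse metric. Every contraction in a frame rests on
this. -/
lemma metric_inv (h : IsOrthoFrame p G Γ F) : G * (F.transpose * F) = 1 := by
  have := h.transpose_mul
  rw [← Matrix.mul_assoc] at this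
  exact mul_eq_one_comm.mp this

/-- This is ∇ᵢ e_b = Σ ω_{bc} e_c in matrix form: the definition of `connMat` is solved for the
derivative of `F` by means of `metric_inv`. -/
lemma dmat_frame (h : IsOrthoFrame p G Γ F) (i : Fin n) :
    dmat (p i) F = connMat p G Γ F i * F - F * (Γ i).transpose := by
  have h1 := h.metric_inv
  simp only [connMat]
  rw [Matrix.mul_assoc, Matrix.mul_assoc, h1, Matrix.mul_one]
  abel

/-- Differentiate `F G Fᵀ = 1` and use compatibility of the connection with the metric. -/
lemma connMat_skew (h : IsOrthoFrame p G Γ F) (i : Fin n) :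
    (connMat p G Γ F i).transpose = -connMat p G Γ F i := by
  have h1 : dmat (p i) (F * G * F.transpose) = 0 := by rw [h.ortho, dmat_one]
  rw [dmat_mul, dmat_mul, h.compat, dmat_transpose] at h1
  simp only [connMat, Matrix.transpose_mul, Matrix.transpose_add, Matrix.transpose_transpose,
    h.symm]
  rw [eq_neg_iff_add_eq_zero, ← h1]
  noncomm_ring

lemma p_frame (h : IsOrthoFrame p G Γ F) (i b k : Fin n) :
    p i (F b k) = ∑ c, connMat p G Γ F i b c * F c k - ∑ j, F b j * Γ i k j := by
  have := congrFun (congrFun (h.dmat_frame i) b) k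
  simpa [dmat_apply, Matrix.mul_apply] using this

lemma frameD_frame (h : IsOrthoFrame p G Γ F) (a b k : Fin n) :
    frameD p F a (F b k)
      = ∑ c, conn p G Γ F a b c * F c k - ∑ i, ∑ j, F a i * F b j * Γ i k j := by
  simp only [frameD_apply, h.p_frame, mul_sub, Finset.sum_sub_distrib, conn, Finset.sum_mul,
    Finset.mul_sum, mul_assoc]
  congr 1
  exact Finset.sum_comm

/-- Torsion-freeness, [e_a, e_b] = ∇_a e_b − ∇_b e_a: the Christoffel terms are symmetric in the two
frame members and cancel. -/
lemma frameD_bracket_frame (h : IsOrthoFrame p G Γ F) (a b k : Fin n) :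
    frameD p F a (F b k) - frameD p F b (F a k)
      = ∑ c, (conn p G Γ F a b c - conn p G Γ F b a c) * F c k := by
  have h2 : ∑ i, ∑ j, F a i * F b j * Γ i k j = ∑ i, ∑ j, F b i * F a j * Γ i k j := by
    rw [Finset.sum_comm]
    refine Finset.sum_congr rfl fun i _ => Finset.sum_congr rfl fun j _ => ?_
    rw [h.torsion j i k]; ring
  rw [h.frameD_frame, h.frameD_frame, h2]
  simp only [sub_mul, Finset.sum_sub_distrib]
  ring

lemma isFrameConn (h : IsOrthoFrame p G Γ F) : IsFrameConn (frameD p F) (conn p G Γ F) where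
  skew a b c := by
    simp only [conn, ← Finset.sum_neg_distrib]
    refine Finset.sum_congr rfl fun i _ => ?_
    have := congrFun (congrFun (h.connMat_skew i) c) b
    simp only [Matrix.transpose_apply, Matrix.neg_apply] at this
    rw [this]; ring
  bracket a b f := by
    have key : ∀ a b, frameD p F a (frameD p F b f)
        = ∑ k, frameD p F a (F b k) * p k f + ∑ i, ∑ j, F a i * F b j * p i (p j f) := by
      intro a b
      rw [frameD_apply p F b f, map_sum]
      simp only [Derivation.leibniz, smul_eq_mul, Finset.sum_add_distrib]
      rw [add_comm]
      congr 1
      · exact Finset.sum_congr rfl fun _ _ => mul_comm _ _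
      · simp only [frameD_apply, Finset.mul_sum]
        rw [Finset.sum_comm]
        exact Finset.sum_congr rfl fun i _ => Finset.sum_congr rfl fun j _ => by ring
    have h2 : ∑ i, ∑ j, F a i * F b j * p i (p j f) = ∑ i, ∑ j, F b i * F a j * p i (p j f) := by
      rw [Finset.sum_comm]
      refine Finset.sum_congr rfl fun i _ => Finset.sum_congr rfl fun j _ => ?_
      rw [h.comm j i f]; ring
    rw [key a b, key b a, h2, add_sub_add_right_eq_sub, ← Finset.sum_sub_distrib]
    simp only [← sub_mul, h.frameD_bracket_frame, Finset.sum_mul]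
    rw [Finset.sum_comm]
    simp only [frameD_apply p F _ f, Finset.mul_sum, mul_assoc]

/-- The curvature of the connection matrices of the frame. -/
lemma connMat_curv (h : IsOrthoFrame p G Γ F) (i j : Fin n) :
    (dmat (p i) (connMat p G Γ F j) - dmat (p j) (connMat p G Γ F i)
      + (connMat p G Γ F j * connMat p G Γ F i - connMat p G Γ F i * connMat p G Γ F j)) * F
      = F * (curvMat p Γ i j).transpose := by
  -- Commuting second derivatives of the frame are the integrability condition of `dmat_frame`;
  -- inserting that equation twice yields the curvature identity.
  have hc : dmat (p i) (dmat (p j) F) = dmat (p j) (dmat (p i) F) := by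
    ext a b; exact h.comm i j _
  rw [h.dmat_frame i, h.dmat_frame j, dmat_sub, dmat_sub, dmat_mul, dmat_mul, dmat_mul, dmat_mul,
    h.dmat_frame i, h.dmat_frame j] at hc
  simp only [curvMat, Matrix.transpose_add, Matrix.transpose_sub, Matrix.transpose_mul,
    dmat_transpose] at hc ⊢
  rw [← sub_eq_zero] at hc ⊢
  rw [← hc]
  noncomm_ring

/-- Tensoriality in the first two slots: the derivatives of `F` produced by differentiating `conn`
are exactly those in the bracket term of `frameRiem`, so they cancel. -/
lemma frameRiem_eq_connMat (h : IsOrthoFrame p G Γ F) (a b c d : Fin n) :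
    frameRiem (frameD p F) (conn p G Γ F) a b c d
      = ∑ i, ∑ j, F a i * F b j *
        (dmat (p i) (connMat p G Γ F j) - dmat (p j) (connMat p G Γ F i)
          + (connMat p G Γ F j * connMat p G Γ F i
            - connMat p G Γ F i * connMat p G Γ F j)) c d := by
  set M := connMat p G Γ F with hM
  have hD : ∀ a b, frameD p F a (conn p G Γ F b c d)
      = ∑ j, frameD p F a (F b j) * M j c d + ∑ i, ∑ j, F a i * F b j * p i (M j c d) := by
    intro a b
    rw [conn, map_sum]
    simp only [Derivation.leibniz, smul_eq_mul, Finset.sum_add_distrib]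
    rw [add_comm]
    congr 1
    · exact Finset.sum_congr rfl fun _ _ => mul_comm _ _
    · simp only [frameD_apply, Finset.mul_sum]
      rw [Finset.sum_comm]
      exact Finset.sum_congr rfl fun i _ => Finset.sum_congr rfl fun j _ => by ring
  have hq : ∀ a b, ∑ f, conn p G Γ F b c f * conn p G Γ F a f d
      = ∑ i, ∑ j, F a i * F b j * (M j * M i) c d := by
    intro a b
    simp only [conn, Matrix.mul_apply, Finset.mul_sum, Finset.sum_mul]
    rw [Finset.sum_comm]
    refine Finset.sum_congr rfl fun i _ => ?_
    rw [Finset.sum_comm]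
    exact Finset.sum_congr rfl fun j _ => Finset.sum_congr rfl fun f _ => by ring
  have ht : ∑ f, (conn p G Γ F a b f - conn p G Γ F b a f) * conn p G Γ F f c d
      = ∑ j, frameD p F a (F b j) * M j c d - ∑ j, frameD p F b (F a j) * M j c d := by
    simp only [← Finset.sum_sub_distrib, ← sub_mul, h.frameD_bracket_frame]
    have hcd : ∀ f, conn p G Γ F f c d = ∑ j, F f j * M j c d := fun _ => rfl
    simp only [hcd, Finset.mul_sum, Finset.sum_mul]
    rw [Finset.sum_comm]
    exact Finset.sum_congr rfl fun j _ => Finset.sum_congr rfl fun f _ => by ring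
  have hs : ∀ N : Fin n → Fin n → A, ∑ i, ∑ j, F b i * F a j * N i j
      = ∑ i, ∑ j, F a i * F b j * N j i := by
    intro N
    rw [Finset.sum_comm]
    exact Finset.sum_congr rfl fun j _ => Finset.sum_congr rfl fun f _ => by ring
  rw [frameRiem, hD a b, hD b a, ht, Finset.sum_sub_distrib, hq a b, hq b a,
    hs fun i j => p i (M j c d), hs fun i j => (M j * M i) c d]
  simp only [Matrix.add_apply, Matrix.sub_apply, dmat_apply, mul_add, mul_sub,
    Finset.sum_add_distrib, Finset.sum_sub_distrib]
  ring

/-- The components of the Riemann tensor in the frame, in terms of those in coordinates. -/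
lemma frameRiem_eq (h : IsOrthoFrame p G Γ F) (a b c d : Fin n) :
    frameRiem (frameD p F) (conn p G Γ F) a b c d
      = ∑ i, ∑ j, F a i * F b j * (F * (curvMat p Γ i j).transpose * G * F.transpose) c d := by
  rw [h.frameRiem_eq_connMat]
  refine Finset.sum_congr rfl fun i _ => Finset.sum_congr rfl fun j _ => ?_
  rw [← h.connMat_curv, Matrix.mul_assoc _ F G, Matrix.mul_assoc, h.ortho, Matrix.mul_one]

end IsOrthoFrame

end FrameAlgebra

section FrameTensors

variable {A : Type*} [CommRing A] [Algebra ℝ A] {n : ℕ}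

/-! ### Covariant derivatives -/

/-- The covariant derivative `∇_a θ_b`, with the connection coefficients `w a b k`. -/
def cov1 (D : Fin n → Derivation ℝ A A) (w : Fin n → Fin n → Fin n → A) (θ : Fin n → A)
    (a b : Fin n) : A := D a (θ b) - ∑ k, w a b k * θ k

/-- The covariant derivative `∇_c T_{ab}`. -/
def cov2 (D : Fin n → Derivation ℝ A A) (w : Fin n → Fin n → Fin n → A) (T : Fin n → Fin n → A)
    (c a b : Fin n) : A := D c (T a b) - ∑ k, w c a k * T k b - ∑ k, w c b k * T a k

/-- The covariant derivative `∇_e T_{cab}`. -/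
def cov3 (D : Fin n → Derivation ℝ A A) (w : Fin n → Fin n → Fin n → A)
    (T : Fin n → Fin n → Fin n → A) (e c a b : Fin n) : A :=
  D e (T c a b) - ∑ k, w e c k * T k a b - ∑ k, w e a k * T c k b - ∑ k, w e b k * T c a k

/-- The Christoffel symbols as connection coefficients of the coordinate frame. -/
def coordConn (Γ : Fin n → Matrix (Fin n) (Fin n) A) (i j k : Fin n) : A := Γ i k j

/-- The components of a covector in a frame. -/
def fr1 (F : Matrix (Fin n) (Fin n) A) (θ : Fin n → A) (a : Fin n) : A := ∑ i, F a i * θ i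

/-- The components of a covariant 2-tensor in a frame. -/
def fr2 (F : Matrix (Fin n) (Fin n) A) (T : Fin n → Fin n → A) (a b : Fin n) : A :=
  fr1 F (fun i => fr1 F (T i) b) a

/-- The components of a covariant 3-tensor in a frame. -/
def fr3 (F : Matrix (Fin n) (Fin n) A) (T : Fin n → Fin n → Fin n → A) (a b c : Fin n) : A :=
  fr1 F (fun i => fr2 F (T i) b c) a

/-- The components of a covariant 4-tensor in a frame. -/
def fr4 (F : Matrix (Fin n) (Fin n) A) (T : Fin n → Fin n → Fin n → Fin n → A)
    (a b c d : Fin n) : A :=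
  fr1 F (fun i => fr3 F (T i) b c d) a

variable (F : Matrix (Fin n) (Fin n) A)

lemma fr1_add (θ η : Fin n → A) (a : Fin n) :
    fr1 F (fun i => θ i + η i) a = fr1 F θ a + fr1 F η a := by
  simp only [fr1, mul_add, Finset.sum_add_distrib]

lemma fr1_sub (θ η : Fin n → A) (a : Fin n) :
    fr1 F (fun i => θ i - η i) a = fr1 F θ a - fr1 F η a := by
  simp only [fr1, mul_sub, Finset.sum_sub_distrib]

lemma fr1_sum {ι : Type*} (s : Finset ι) (θ : ι → Fin n → A) (a : Fin n) :
    fr1 F (fun i => ∑ k ∈ s, θ k i) a = ∑ k ∈ s, fr1 F (θ k) a := by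
  simp only [fr1, Finset.mul_sum]
  exact Finset.sum_comm

lemma fr1_mul_left (f : A) (θ : Fin n → A) (a : Fin n) :
    fr1 F (fun i => f * θ i) a = f * fr1 F θ a := by
  simp only [fr1, Finset.mul_sum]
  exact Finset.sum_congr rfl fun _ _ => by ring

lemma fr1_mul_right (f : A) (θ : Fin n → A) (a : Fin n) :
    fr1 F (fun i => θ i * f) a = fr1 F θ a * f := by
  simp only [fr1, Finset.sum_mul, mul_assoc]

lemma fr1_comm (T : Fin n → Fin n → A) (a b : Fin n) :
    fr1 F (fun i => fr1 F (fun j => T i j) b) a = fr1 F (fun j => fr1 F (fun i => T i j) a) b := by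
  simp only [fr1, Finset.mul_sum]
  rw [Finset.sum_comm]
  exact Finset.sum_congr rfl fun _ _ => Finset.sum_congr rfl fun _ _ => by ring

lemma fr2_mul_left (f : A) (T : Fin n → Fin n → A) (a b : Fin n) :
    fr2 F (fun i j => f * T i j) a b = f * fr2 F T a b := by
  simp only [fr2, fr1_mul_left]

lemma fr2_sub (T S : Fin n → Fin n → A) (a b : Fin n) :
    fr2 F (fun i j => T i j - S i j) a b = fr2 F T a b - fr2 F S a b := by
  simp only [fr2, fr1_sub]

lemma fr2_metric {p : Fin n → Derivation ℝ A A} {G : Matrix (Fin n) (Fin n) A}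
    {Γ : Fin n → Matrix (Fin n) (Fin n) A} {F : Matrix (Fin n) (Fin n) A}
    (h : IsOrthoFrame p G Γ F) (a b : Fin n) :
    fr2 F G a b = if a = b then 1 else 0 := by
  have := congrFun (congrFun h.ortho a) b
  rw [Matrix.one_apply] at this
  rw [← this]
  simp only [fr2, fr1, Matrix.mul_apply, Matrix.transpose_apply, Finset.sum_mul, Finset.mul_sum]
  rw [Finset.sum_comm]
  exact Finset.sum_congr rfl fun _ _ => Finset.sum_congr rfl fun _ _ => by ring

/-- The contraction of two indices, in an orthonormal frame. -/
lemma contract_eq (T : Fin n → Fin n → A) :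
    ∑ i, ∑ j, (∑ a, F a i * F a j) * T i j = ∑ a, fr2 F T a a := by
  simp only [fr2, fr1, Finset.mul_sum, Finset.sum_mul]
  symm
  rw [Finset.sum_comm]
  refine Finset.sum_congr rfl fun i _ => ?_
  rw [Finset.sum_comm]
  exact Finset.sum_congr rfl fun j _ => Finset.sum_congr rfl fun a _ => by ring

variable {p : Fin n → Derivation ℝ A A} {G : Matrix (Fin n) (Fin n) A}
  {Γ : Fin n → Matrix (Fin n) (Fin n) A} {F}

namespace IsOrthoFrame

lemma p_frame' (h : IsOrthoFrame p G Γ F) (i b k : Fin n) :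
    p i (F b k) = ∑ c, connMat p G Γ F i b c * F c k - ∑ j, F b j * coordConn Γ i j k :=
  h.p_frame i b k

/-- The Leibniz rule for θ(e_b): one part differentiates the covector, the other the frame. Applied
slot by slot it shows that covariant differentiation commutes with passing to frame components, for
tensors of every rank needed. -/
lemma p_fr1 (h : IsOrthoFrame p G Γ F) (i b : Fin n) (θ : Fin n → A) :
    p i (fr1 F θ b) = fr1 F (fun j => p i (θ j) - ∑ k, coordConn Γ i j k * θ k) b
      + ∑ c, connMat p G Γ F i b c * fr1 F θ c := by
  simp only [fr1, map_sum, Derivation.leibniz, smul_eq_mul, h.p_frame', mul_sub,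
    Finset.sum_add_distrib, Finset.sum_sub_distrib, Finset.mul_sum]
  have h1 : ∑ k, ∑ c, θ k * (connMat p G Γ F i b c * F c k)
      = ∑ c, ∑ k, connMat p G Γ F i b c * (F c k * θ k) := by
    rw [Finset.sum_comm]
    exact Finset.sum_congr rfl fun _ _ => Finset.sum_congr rfl fun _ _ => by ring
  have h2 : ∑ k, ∑ j, θ k * (F b j * coordConn Γ i j k) = ∑ j, ∑ k, F b j * (coordConn Γ i j k * θ k) := by
    rw [Finset.sum_comm]
    exact Finset.sum_congr rfl fun _ _ => Finset.sum_congr rfl fun _ _ => by ring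
  rw [h1, h2]; ring

lemma fr1_p (_h : IsOrthoFrame p G Γ F) (a : Fin n) (f : A) :
    fr1 F (fun i => p i f) a = frameD p F a f := (frameD_apply p F a f).symm

lemma fr1_connMat (_h : IsOrthoFrame p G Γ F) (a b c : Fin n) :
    fr1 F (fun i => connMat p G Γ F i b c) a = conn p G Γ F a b c := rfl

lemma fr2_cov1 (h : IsOrthoFrame p G Γ F) (θ : Fin n → A) (a b : Fin n) :
    fr2 F (cov1 p (coordConn Γ) θ) a b
      = cov1 (frameD p F) (conn p G Γ F) (fr1 F θ) a b := by
  have h1 : ∀ i, fr1 F (cov1 p (coordConn Γ) θ i) b = p i (fr1 F θ b)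
      - ∑ c, connMat p G Γ F i b c * fr1 F θ c := by
    intro i
    rw [h.p_fr1, add_sub_cancel_right]
    rfl
  rw [fr2]
  simp only [h1, fr1_sub, fr1_p h, fr1_sum, cov1]
  simp only [fr1_mul_right, h.fr1_connMat]

lemma p_fr2 (h : IsOrthoFrame p G Γ F) (i a b : Fin n) (T : Fin n → Fin n → A) :
    p i (fr2 F T a b) = fr2 F (fun l j => p i (T l j) - ∑ k, coordConn Γ i l k * T k j
        - ∑ k, coordConn Γ i j k * T l k) a b
      + ∑ c, connMat p G Γ F i a c * fr2 F T c b + ∑ c, connMat p G Γ F i b c * fr2 F T a c := by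
  rw [fr2, h.p_fr1]
  simp only [h.p_fr1, fr2, fr1_sub, fr1_add, fr1_sum, fr1_mul_left]
  ring

lemma p_fr3 (h : IsOrthoFrame p G Γ F) (i a b c : Fin n) (T : Fin n → Fin n → Fin n → A) :
    p i (fr3 F T a b c) = fr3 F (fun l j m => p i (T l j m) - ∑ k, coordConn Γ i l k * T k j m
        - ∑ k, coordConn Γ i j k * T l k m - ∑ k, coordConn Γ i m k * T l j k) a b c
      + ∑ d, connMat p G Γ F i a d * fr3 F T d b c + ∑ d, connMat p G Γ F i b d * fr3 F T a d c
      + ∑ d, connMat p G Γ F i c d * fr3 F T a b d := by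
  rw [fr3, h.p_fr1]
  simp only [h.p_fr2]
  simp only [fr3, fr2, fr1_sub, fr1_add, fr1_sum, fr1_mul_left]
  ring

lemma fr3_cov2 (h : IsOrthoFrame p G Γ F) (T : Fin n → Fin n → A) (a b c : Fin n) :
    fr3 F (cov2 p (coordConn Γ) T) a b c
      = cov2 (frameD p F) (conn p G Γ F) (fr2 F T) a b c := by
  have h1 : ∀ i, fr2 F (cov2 p (coordConn Γ) T i) b c = p i (fr2 F T b c)
      - ∑ d, connMat p G Γ F i b d * fr2 F T d c - ∑ d, connMat p G Γ F i c d * fr2 F T b d := by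
    intro i
    have h0 : p i (fr2 F T b c) = fr2 F (cov2 p (coordConn Γ) T i) b c + _ + _ :=
      h.p_fr2 i b c T
    rw [h0]; ring
  rw [fr3]
  simp only [h1, fr1_sub, fr1_p h, fr1_sum, cov2]
  simp only [fr1_mul_right, h.fr1_connMat]

lemma fr4_cov3 (h : IsOrthoFrame p G Γ F) (T : Fin n → Fin n → Fin n → A) (a b c d : Fin n) :
    fr4 F (cov3 p (coordConn Γ) T) a b c d
      = cov3 (frameD p F) (conn p G Γ F) (fr3 F T) a b c d := by
  have h1 : ∀ i, fr3 F (cov3 p (coordConn Γ) T i) b c d = p i (fr3 F T b c d)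
      - ∑ k, connMat p G Γ F i b k * fr3 F T k c d - ∑ k, connMat p G Γ F i c k * fr3 F T b k d
      - ∑ k, connMat p G Γ F i d k * fr3 F T b c k := by
    intro i
    have h0 : p i (fr3 F T b c d) = fr3 F (cov3 p (coordConn Γ) T i) b c d + _ + _ + _ :=
      h.p_fr3 i b c d T
    rw [h0]; ring
  rw [fr4]
  simp only [h1, fr1_sub, fr1_p h, fr1_sum, cov3]
  simp only [fr1_mul_right, h.fr1_connMat]

/-! ### Curvature -/

/-- The trace over an orthonormal frame of the lowered Riemann tensor is the coordinate trace,
because `Fᵀ F` cancels the `G` that lowered the index. -/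
lemma fr2_ricci (h : IsOrthoFrame p G Γ F) (a b : Fin n) :
    fr2 F (fun i j => ∑ k, curvMat p Γ k i k j) a b
      = ∑ c, frameRiem (frameD p F) (conn p G Γ F) c a b c := by
  have key : ∀ i j, ∑ c, F c i * (F * (curvMat p Γ i j).transpose * G * F.transpose) b c
      = ∑ l, F b l * curvMat p Γ i j i l := by
    intro i j
    have : (F * (curvMat p Γ i j).transpose * G * F.transpose * F) b i
        = (F * (curvMat p Γ i j).transpose) b i := by
      rw [Matrix.mul_assoc, Matrix.mul_assoc, h.metric_inv, Matrix.mul_one]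
    rw [Matrix.mul_apply, Matrix.mul_apply] at this
    simpa only [Matrix.transpose_apply, mul_comm] using this
  simp only [h.frameRiem_eq]
  calc fr2 F (fun i j => ∑ k, curvMat p Γ k i k j) a b
      = ∑ i, ∑ j, F a j * ∑ l, F b l * curvMat p Γ i j i l := by
        simp only [fr2, fr1, Finset.mul_sum]
        conv_lhs => enter [2, i]; rw [Finset.sum_comm]
        rw [Finset.sum_comm]
    _ = _ := by
        simp only [← key, Finset.mul_sum]
        symm
        rw [Finset.sum_comm]
        refine Finset.sum_congr rfl fun i _ => ?_
        rw [Finset.sum_comm]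
        exact Finset.sum_congr rfl fun _ _ => Finset.sum_congr rfl fun _ _ => by ring

lemma _root_.ConfHyp.frameRiem_skew_left (D : Fin n → Derivation ℝ A A) (w : Fin n → Fin n → Fin n → A)
    (a b c d : Fin n) : frameRiem D w a b c d = -frameRiem D w b a c d := by
  simp only [frameRiem, Finset.sum_sub_distrib, sub_mul]
  ring

lemma _root_.ConfHyp.IsFrameConn.frameRiem_skew_right {D : Fin n → Derivation ℝ A A}
    {w : Fin n → Fin n → Fin n → A} (h : IsFrameConn D w)
    (a b c d : Fin n) : frameRiem D w a b c d = -frameRiem D w a b d c := by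
  have h1 : ∀ a b, ∑ f, w b d f * w a f c = ∑ f, w a c f * w b f d := by
    intro a b
    refine Finset.sum_congr rfl fun f _ => ?_
    rw [h.skew b d f, h.skew a f c]; ring
  have h2 : ∑ f, (w a b f - w b a f) * w f d c = -∑ f, (w a b f - w b a f) * w f c d := by
    rw [← Finset.sum_neg_distrib]
    refine Finset.sum_congr rfl fun f _ => ?_
    rw [h.skew f d c]; ring
  simp only [frameRiem, Finset.sum_sub_distrib, h2]
  rw [h1 a b, h1 b a, h.skew b d c, h.skew a d c, map_neg, map_neg]
  ring

/-- The algebraic Bianchi identity. Symmetry of `Γ` in its lower indices makes both the derivative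
terms and the quadratic terms cancel in pairs. -/
lemma curvMat_cyclic (h : IsOrthoFrame p G Γ F) (i j k l : Fin n) :
    curvMat p Γ i j l k + curvMat p Γ j k l i + curvMat p Γ k i l j = 0 := by
  simp only [curvMat, Matrix.add_apply, Matrix.sub_apply, dmat_apply, Matrix.mul_apply]
  have h1 : ∀ i j k, ∑ m, Γ i l m * Γ j m k = ∑ m, Γ i l m * Γ k m j := fun i j k =>
    Finset.sum_congr rfl fun m _ => by rw [h.torsion j k m]
  rw [h1 i j k, h1 j k i, h1 k i j, h.torsion j k l, h.torsion i k l, h.torsion i j l]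
  ring

lemma frameRiem_cyclic (h : IsOrthoFrame p G Γ F) (a b c d : Fin n) :
    frameRiem (frameD p F) (conn p G Γ F) a b c d + frameRiem (frameD p F) (conn p G Γ F) b c a d
      + frameRiem (frameD p F) (conn p G Γ F) c a b d = 0 := by
  let S : Fin n → Fin n → Fin n → A := fun i j k =>
    ∑ l, curvMat p Γ i j l k * (G * F.transpose) l d
  have hS : ∀ i j k, S i j k + S j k i + S k i j = 0 := by
    intro i j k
    simp only [S, ← Finset.sum_add_distrib, ← add_mul, h.curvMat_cyclic, zero_mul,
      Finset.sum_const_zero]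
  have h1 : ∀ a b c, frameRiem (frameD p F) (conn p G Γ F) a b c d
      = ∑ i, ∑ j, ∑ k, F a i * F b j * F c k * S i j k := by
    intro a b c
    rw [h.frameRiem_eq]
    refine Finset.sum_congr rfl fun i _ => Finset.sum_congr rfl fun j _ => ?_
    rw [Matrix.mul_assoc, Matrix.mul_assoc, Matrix.mul_apply]
    simp only [Finset.mul_sum, S]
    refine Finset.sum_congr rfl fun k _ => ?_
    rw [Matrix.mul_apply]
    simp only [Finset.mul_sum, Matrix.transpose_apply]
    exact Finset.sum_congr rfl fun _ _ => by ring
  have h2 : ∑ i, ∑ j, ∑ k, F b i * F c j * F a k * S i j k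
      = ∑ i, ∑ j, ∑ k, F a i * F b j * F c k * S j k i := by
    conv_lhs => enter [2, i]; rw [Finset.sum_comm]
    rw [Finset.sum_comm]
    exact Finset.sum_congr rfl fun _ _ => Finset.sum_congr rfl fun _ _ =>
      Finset.sum_congr rfl fun _ _ => by ring
  have h3 : ∑ i, ∑ j, ∑ k, F c i * F a j * F b k * S i j k
      = ∑ i, ∑ j, ∑ k, F a i * F b j * F c k * S k i j := by
    rw [Finset.sum_comm]
    conv_lhs => enter [2, i]; rw [Finset.sum_comm]
    exact Finset.sum_congr rfl fun _ _ => Finset.sum_congr rfl fun _ _ =>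
      Finset.sum_congr rfl fun _ _ => by ring
  rw [h1 a b c, h1 b c a, h1 c a b, h2, h3]
  simp only [← Finset.sum_add_distrib, ← mul_add, hS, mul_zero, Finset.sum_const_zero]

end IsOrthoFrame

end FrameTensors

/-! ### Geometry of the level sets: Gauss, Codazzi and evolution along the normal flow. -/

section Foliation

variable {A : Type*} [CommRing A] [Algebra ℝ A] {m : ℕ}

/-- Substitute for division: in an ℝ-algebra every nonzero natural number is a unit. -/
lemma natCast_mul_cancel {k : ℕ} (hk : k ≠ 0) {a b : A} (h : (k : A) * a = k * b) : a = b := by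
  have hk' : (k : ℝ) ≠ 0 := Nat.cast_ne_zero.mpr hk
  have h1 : ∀ x : A, algebraMap ℝ A (k : ℝ)⁻¹ * (k * x) = x := by
    intro x
    rw [← map_natCast (algebraMap ℝ A) k, ← mul_assoc, ← map_mul, inv_mul_cancel₀ hk', map_one,
      one_mul]
  rw [← h1 a, h, h1]

/-- A frame adapted to the level sets of `σ`: `e₀` is normal to them and `e₀ σ = v`, where `v` is
invertible with inverse `N`. -/
structure IsAdapted (D : Fin (m + 1) → Derivation ℝ A A)
    (w : Fin (m + 1) → Fin (m + 1) → Fin (m + 1) → A) (σ v N : A) : Prop extends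
    IsFrameConn D w where
  tangent : ∀ i : Fin m, D i.succ σ = 0
  normal : D 0 σ = v
  inv : N * v = 1

/-- The second fundamental form of the level sets. -/
def sff (w : Fin (m + 1) → Fin (m + 1) → Fin (m + 1) → A) (i j : Fin m) : A := w i.succ 0 j.succ

/-- The tangential connection coefficients. -/
def tconn (w : Fin (m + 1) → Fin (m + 1) → Fin (m + 1) → A) (i j k : Fin m) : A :=
  w i.succ j.succ k.succ

/-- The rotation of the tangential frame along the normal flow. -/
def spin (N : A) (w : Fin (m + 1) → Fin (m + 1) → Fin (m + 1) → A) (i j : Fin m) : A :=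
  N * w 0 i.succ j.succ

/-- The tangential derivations. -/
def tanD (D : Fin (m + 1) → Derivation ℝ A A) (i : Fin m) : Derivation ℝ A A := D i.succ

/-- The derivation along the normal flow, normalized by `X σ = 1`. -/
def flowD (N : A) (D : Fin (m + 1) → Derivation ℝ A A) : Derivation ℝ A A := N • D 0

lemma flowD_apply (N : A) (D : Fin (m + 1) → Derivation ℝ A A) (f : A) :
    flowD N D f = N * D 0 f := rfl

variable {D : Fin (m + 1) → Derivation ℝ A A}
  {w : Fin (m + 1) → Fin (m + 1) → Fin (m + 1) → A} {σ v N : A}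

lemma IsFrameConn.self_eq_zero {n : ℕ} {D : Fin n → Derivation ℝ A A}
    {w : Fin n → Fin n → Fin n → A} (h : IsFrameConn D w) (a b : Fin n) : w a b b = 0 := by
  refine natCast_mul_cancel two_ne_zero ?_
  have := h.skew a b b
  push_cast
  linear_combination this

namespace IsAdapted

lemma flow_sigma (h : IsAdapted D w σ v N) : flowD N D σ = 1 := by
  rw [flowD_apply, h.normal, h.inv]

lemma tconn_skew (h : IsAdapted D w σ v N) (i j k : Fin m) : tconn w i j k = -tconn w i k j :=
  h.skew _ _ _

lemma spin_skew (h : IsAdapted D w σ v N) (i j : Fin m) : spin N w i j = -spin N w j i := by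
  rw [spin, spin, h.skew 0 i.succ j.succ]; ring

lemma conn_normal (h : IsAdapted D w σ v N) (i j : Fin m) : w i.succ j.succ 0 = -sff w i j :=
  h.skew _ _ _

lemma mul_v_cancel (h : IsAdapted D w σ v N) {a : A} (ha : a * v = 0) : a = 0 := by
  linear_combination N * ha - a * h.inv

/-- Apply [e_i, e_j] to `σ`. Tangential derivations kill `σ`, so the normal component of the
bracket, multiplied by the invertible `v`, is zero. -/
lemma sff_symm (h : IsAdapted D w σ v N) (i j : Fin m) : sff w i j = sff w j i := by
  have h1 := h.bracket i.succ j.succ σ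
  rw [Fin.sum_univ_succ, h.tangent, h.tangent, h.normal] at h1
  simp only [h.tangent, mul_zero, Finset.sum_const_zero, map_zero, h.conn_normal] at h1
  rw [← sub_eq_zero]
  apply h.mul_v_cancel
  linear_combination h1

/-- Apply [e₀, e_i] to `σ`: the acceleration of the unit normal field is the tangential gradient of
log `v`. -/
lemma accel (h : IsAdapted D w σ v N) (i : Fin m) : w 0 0 i.succ = N * D i.succ v := by
  have h1 := h.bracket 0 i.succ σ
  rw [Fin.sum_univ_succ, h.tangent, h.normal] at h1
  simp only [h.tangent, mul_zero, Finset.sum_const_zero, map_zero, h.self_eq_zero] at h1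
  rw [h.skew 0 0 i.succ]
  linear_combination w 0 i.succ 0 * h.inv + N * h1

lemma D_inv (h : IsAdapted D w σ v N) (δ : Derivation ℝ A A) : δ N = -(N ^ 2 * δ v) := by
  have h1 : δ (N * v) = 0 := by rw [h.inv]; exact δ.map_one_eq_zero
  rw [Derivation.leibniz, smul_eq_mul, smul_eq_mul] at h1
  linear_combination N * h1 - δ N * h.inv

lemma mul_accel (h : IsAdapted D w σ v N) (i : Fin m) : N * w 0 0 i.succ = -D i.succ N := by
  rw [h.accel, h.D_inv]; ring

/-- As `Xσ = 1` is constant, the flow of `X` preserves the foliation, so [X, e_i] is tangential.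
Algebraically, `mul_accel` cancels the `e₀`-component of N[e₀, e_i] against the derivative of `N`.
-/
lemma flow_tan (h : IsAdapted D w σ v N) (i : Fin m) (f : A) :
    flowD N D (tanD D i f) = tanD D i (flowD N D f)
      + ∑ l, (spin N w i l - N * sff w i l) * tanD D l f := by
  have h1 := h.bracket 0 i.succ f
  have h2 := h.mul_accel i
  rw [h.skew 0 0 i.succ] at h2
  rw [Fin.sum_univ_succ, h.self_eq_zero] at h1
  have h3 : ∑ l, (spin N w i l - N * sff w i l) * tanD D l f
      = N * ∑ l : Fin m, (w 0 i.succ l.succ - w i.succ 0 l.succ) * D l.succ f := by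
    rw [Finset.mul_sum]
    exact Finset.sum_congr rfl fun l _ => by simp only [spin, sff, tanD]; ring
  rw [h3, flowD_apply, flowD_apply, tanD, Derivation.leibniz, smul_eq_mul, smul_eq_mul]
  linear_combination N * h1 - D 0 f * h2

/-- The Codazzi equation. -/
lemma codazzi (h : IsAdapted D w σ v N) (i j k : Fin m) :
    frameRiem D w i.succ j.succ 0 k.succ
      = cov2 (tanD D) (tconn w) (sff w) i j k - cov2 (tanD D) (tconn w) (sff w) j i k := by
  have h1 : ∀ i j : Fin m, ∑ f : Fin m, w j.succ 0 f.succ * w i.succ f.succ k.succ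
      = -∑ f, tconn w i k f * sff w j f := by
    intro i j
    rw [← Finset.sum_neg_distrib]
    refine Finset.sum_congr rfl fun f _ => ?_
    rw [h.tconn_skew i k f]
    simp only [sff, tconn]; ring
  rw [frameRiem, Fin.sum_univ_succ, Fin.sum_univ_succ]
  simp only [h.self_eq_zero, h.conn_normal, h.sff_symm j i, Finset.sum_sub_distrib, h1, sub_mul,
    cov2]
  simp only [sff, tconn, tanD]
  ring

/-- The Gauss equation. -/
lemma gauss (h : IsAdapted D w σ v N) (i j k l : Fin m) :
    frameRiem D w i.succ j.succ k.succ l.succ = frameRiem (tanD D) (tconn w) i j k l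
      - sff w j k * sff w i l + sff w i k * sff w j l := by
  rw [frameRiem, Fin.sum_univ_succ, Fin.sum_univ_succ]
  simp only [h.conn_normal, h.sff_symm j i, frameRiem]
  simp only [sff, tconn, tanD]
  ring

/-- The evolution of the second fundamental form along the normal flow. -/
lemma flow_sff (h : IsAdapted D w σ v N) (i j : Fin m) :
    flowD N D (sff w i j) = -cov1 (tanD D) (tconn w) (fun l => tanD D l N) i j
      - N * ∑ l, sff w i l * sff w l j + ∑ l, spin N w i l * sff w l j
      + ∑ l, spin N w j l * sff w i l + N * frameRiem D w 0 i.succ 0 j.succ := by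
  have ha := h.accel
  have h1 : ∑ l : Fin m, w i.succ 0 l.succ * w 0 l.succ j.succ
      = -∑ l : Fin m, w 0 j.succ l.succ * sff w i l := by
    rw [← Finset.sum_neg_distrib]
    refine Finset.sum_congr rfl fun f _ => ?_
    rw [h.skew 0 j.succ f.succ]
    simp only [sff]; ring
  have h2 : ∑ l : Fin m, w 0 0 l.succ * w i.succ l.succ j.succ
      = -∑ l : Fin m, tconn w i j l * (N * D l.succ v) := by
    rw [← Finset.sum_neg_distrib]
    refine Finset.sum_congr rfl fun f _ => ?_
    rw [h.tconn_skew i j f, ha]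
    simp only [tconn]; ring
  -- The acceleration is a derivative of `v` by `accel`. Its tangential derivative, with the
  -- correction in `h2`, assembles into −∇²N because `N = 1/v`; `h4` expresses that Hessian through
  -- `v`.
  have h3 : D i.succ (w 0 0 j.succ) = N * D i.succ (D j.succ v) + D j.succ v * D i.succ N := by
    rw [ha, Derivation.leibniz, smul_eq_mul, smul_eq_mul]
  have h4 : cov1 (tanD D) (tconn w) (fun l => tanD D l N) i j
      = -(N ^ 2 * D i.succ (D j.succ v)) - 2 * N * D i.succ N * D j.succ v
        + N * ∑ l : Fin m, tconn w i j l * (N * D l.succ v) := by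
    simp only [cov1, tanD]
    rw [h.D_inv (D j.succ), map_neg, Derivation.leibniz, smul_eq_mul, smul_eq_mul,
      Derivation.leibniz_pow]
    have : ∑ l, tconn w i j l * D l.succ N
        = -(N * ∑ l : Fin m, tconn w i j l * (N * D l.succ v)) := by
      rw [Finset.mul_sum, ← Finset.sum_neg_distrib]
      refine Finset.sum_congr rfl fun f _ => ?_
      rw [h.D_inv]; ring
    rw [this]
    simp only [smul_eq_mul, nsmul_eq_mul]
    push_cast
    ring
  have h5 : ∀ k l : Fin m, spin N w k l = N * w 0 k.succ l.succ := fun _ _ => rfl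
  rw [frameRiem, Fin.sum_univ_succ, Fin.sum_univ_succ]
  have h6 : ∑ l, spin N w i l * sff w l j = N * ∑ l : Fin m, w 0 i.succ l.succ * sff w l j := by
    rw [Finset.mul_sum]
    exact Finset.sum_congr rfl fun f _ => by rw [h5]; ring
  have h7 : ∑ l, spin N w j l * sff w i l = N * ∑ l : Fin m, w 0 j.succ l.succ * sff w i l := by
    rw [Finset.mul_sum]
    exact Finset.sum_congr rfl fun f _ => by rw [h5]; ring
  have h8 : ∀ l : Fin m, w l.succ 0 j.succ = sff w l j := fun _ => rfl
  have h9 : ∀ l : Fin m, w i.succ 0 l.succ = sff w i l := fun _ => rfl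
  rw [h3, h4, h6, h7, Finset.sum_sub_distrib, h1, h2]
  simp only [h.self_eq_zero, Finset.sum_sub_distrib, sub_mul, h8, h9]
  rw [h.skew 0 i.succ 0, ha i, ha j, h.D_inv (D i.succ), flowD_apply]
  ring

/-- The evolution of the tangential connection coefficients along the normal flow. -/
lemma flow_tconn (h : IsAdapted D w σ v N) (i j l : Fin m) :
    flowD N D (tconn w i j l) = tanD D i (spin N w j l)
      - ∑ f, tconn w i j f * spin N w f l + ∑ f, spin N w j f * tconn w i f l
      - sff w i j * tanD D l N + tanD D j N * sff w i l
      + ∑ f, (spin N w i f - N * sff w i f) * tconn w f j l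
      + N * frameRiem D w 0 i.succ j.succ l.succ := by
  have ha := h.mul_accel
  have h5 : ∀ k l : Fin m, spin N w k l = N * w 0 k.succ l.succ := fun _ _ => rfl
  have h6 : tanD D i (spin N w j l)
      = N * D i.succ (w 0 j.succ l.succ) + w 0 j.succ l.succ * D i.succ N := by
    rw [spin, tanD, Derivation.leibniz, smul_eq_mul, smul_eq_mul]
  have h7 : ∑ f, tconn w i j f * spin N w f l
      = N * ∑ f : Fin m, w i.succ j.succ f.succ * w 0 f.succ l.succ := by
    rw [Finset.mul_sum]
    exact Finset.sum_congr rfl fun f _ => by simp only [spin, tconn]; ring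
  have h8 : ∑ f, spin N w j f * tconn w i f l
      = N * ∑ f : Fin m, w 0 j.succ f.succ * w i.succ f.succ l.succ := by
    rw [Finset.mul_sum]
    exact Finset.sum_congr rfl fun f _ => by simp only [spin, tconn]; ring
  have h9 : ∑ f, (spin N w i f - N * sff w i f) * tconn w f j l
      = N * ∑ f : Fin m, (w 0 i.succ f.succ - w i.succ 0 f.succ) * w f.succ j.succ l.succ := by
    rw [Finset.mul_sum]
    exact Finset.sum_congr rfl fun f _ => by simp only [spin, tconn, sff]; ring
  rw [h6, h7, h8, h9, frameRiem, Fin.sum_univ_succ, Fin.sum_univ_succ,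
    Finset.sum_sub_distrib, h.self_eq_zero, h.conn_normal, h.skew 0 j.succ 0, h.skew 0 i.succ 0]
  have hi := ha i
  have hj := ha j
  have hl := ha l
  simp only [flowD_apply, sff, tanD, tconn] at *
  linear_combination (w i.succ 0 j.succ) * hl - (w i.succ 0 l.succ) * hj - w 0 j.succ l.succ * hi

end IsAdapted

end Foliation

/-! ### Evolution of the traces of powers of the second fundamental form. -/

section FlowTraces

variable {A : Type*} [CommRing A] [Algebra ℝ A]

lemma derivation_trace {k : Type*} [Fintype k] (δ : Derivation ℝ A A) (M : Matrix k k A) :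
    δ M.trace = (dmat δ M).trace := by
  simp only [Matrix.trace, map_sum]; rfl

lemma derivation_trace_sq {k : Type*} [Fintype k] (δ : Derivation ℝ A A) (M : Matrix k k A) :
    δ (M * M).trace = 2 * (M * dmat δ M).trace := by
  rw [derivation_trace, dmat_mul, Matrix.trace_add, Matrix.trace_mul_comm (dmat δ M) M]
  ring

lemma derivation_trace_cube {k : Type*} [Fintype k] (δ : Derivation ℝ A A) (M : Matrix k k A) :
    δ (M * M * M).trace = 3 * (M * M * dmat δ M).trace := by
  rw [derivation_trace, dmat_mul, dmat_mul, Matrix.trace_add, add_mul, Matrix.trace_add,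
    Matrix.trace_mul_comm (dmat δ M * M) M, Matrix.trace_mul_comm (M * dmat δ M) M,
    Matrix.mul_assoc M M,
    Matrix.trace_mul_comm M (dmat δ M * M), Matrix.mul_assoc (dmat δ M) M M,
    Matrix.trace_mul_comm (dmat δ M) (M * M), Matrix.mul_assoc M M]
  ring

lemma trace_mul_matrix {k : Type*} [Fintype k] (M N : Matrix k k A) :
    (M * N).trace = ∑ i, ∑ j, M i j * N j i := by
  simp only [Matrix.trace, Matrix.diag_apply, Matrix.mul_apply]

/-- The Hessian `∇_a ∇_b f`. -/
def hess {n : ℕ} (D : Fin n → Derivation ℝ A A) (w : Fin n → Fin n → Fin n → A) (f : A) :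
    Matrix (Fin n) (Fin n) A := Matrix.of fun a b => cov1 D w (fun l => D l f) a b

lemma hess_apply {n : ℕ} (D : Fin n → Derivation ℝ A A) (w : Fin n → Fin n → Fin n → A) (f : A)
    (a b : Fin n) : hess D w f a b = D a (D b f) - ∑ k, w a b k * D k f := rfl

lemma IsFrameConn.hess_symm {n : ℕ} {D : Fin n → Derivation ℝ A A}
    {w : Fin n → Fin n → Fin n → A} (h : IsFrameConn D w) (f : A) (a b : Fin n) :
    hess D w f a b = hess D w f b a := by
  have := h.bracket a b f
  simp only [sub_mul, Finset.sum_sub_distrib] at this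
  rw [hess_apply, hess_apply]
  linear_combination this

variable {m : ℕ} {D : Fin (m + 1) → Derivation ℝ A A}
  {w : Fin (m + 1) → Fin (m + 1) → Fin (m + 1) → A} {σ v N : A}

/-- The second fundamental form as a matrix. -/
def sffMat (w : Fin (m + 1) → Fin (m + 1) → Fin (m + 1) → A) : Matrix (Fin m) (Fin m) A :=
  Matrix.of (sff w)

/-- The curvature components `g(R(e₀, e_i) e₀, e_j)`. -/
def radialRiem (D : Fin (m + 1) → Derivation ℝ A A)
    (w : Fin (m + 1) → Fin (m + 1) → Fin (m + 1) → A) : Matrix (Fin m) (Fin m) A :=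
  Matrix.of fun i j => frameRiem D w 0 i.succ 0 j.succ

namespace IsAdapted

/-- Skewness of `spin` turns the two rotation terms of `flow_sff` into a commutator with `II`, which
is invisible to traces of powers of `II`. -/
lemma flow_sffMat (h : IsAdapted D w σ v N) :
    dmat (flowD N D) (sffMat w) = -hess (tanD D) (tconn w) N - N • (sffMat w * sffMat w)
      + (Matrix.of (spin N w) * sffMat w - sffMat w * Matrix.of (spin N w))
      + N • radialRiem D w := by
  ext i j
  have h1 : ∑ l, spin N w j l * sff w i l = -∑ l, sff w i l * spin N w l j := by
    rw [← Finset.sum_neg_distrib]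
    exact Finset.sum_congr rfl fun l _ => by rw [h.spin_skew j l]; ring
  have h2 := h.flow_sff i j
  rw [h1] at h2
  simp only [dmat_apply, Matrix.add_apply, Matrix.sub_apply, Matrix.neg_apply, Matrix.smul_apply,
    Matrix.mul_apply, smul_eq_mul, hess, Matrix.of_apply, sffMat, radialRiem, h2]
  ring

lemma flow_trace (h : IsAdapted D w σ v N) :
    flowD N D (sffMat w).trace = -(hess (tanD D) (tconn w) N).trace
      - N * (sffMat w * sffMat w).trace + N * (radialRiem D w).trace := by
  rw [derivation_trace, h.flow_sffMat]
  simp only [Matrix.trace_add, Matrix.trace_sub, Matrix.trace_neg, Matrix.trace_smul, smul_eq_mul]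
  rw [Matrix.trace_mul_comm (Matrix.of (spin N w))]
  ring

lemma flow_trace_sq (h : IsAdapted D w σ v N) :
    flowD N D (sffMat w * sffMat w).trace
      = -(2 * (sffMat w * hess (tanD D) (tconn w) N).trace)
      - 2 * N * (sffMat w * sffMat w * sffMat w).trace
      + 2 * N * (sffMat w * radialRiem D w).trace := by
  rw [derivation_trace_sq, h.flow_sffMat]
  simp only [mul_add, mul_sub, mul_neg, Matrix.mul_smul, Matrix.trace_add, Matrix.trace_sub,
    Matrix.trace_neg, Matrix.trace_smul, smul_eq_mul]
  rw [← Matrix.mul_assoc _ (Matrix.of (spin N w)), Matrix.trace_mul_comm _ (sffMat w)]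
  simp only [Matrix.mul_assoc]
  ring

lemma flow_trace_cube (h : IsAdapted D w σ v N) :
    flowD N D (sffMat w * sffMat w * sffMat w).trace
      = -(3 * (sffMat w * sffMat w * hess (tanD D) (tconn w) N).trace)
      - 3 * N * (sffMat w * sffMat w * (sffMat w * sffMat w)).trace
      + 3 * N * (sffMat w * sffMat w * radialRiem D w).trace := by
  rw [derivation_trace_cube, h.flow_sffMat]
  simp only [mul_add, mul_sub, mul_neg, Matrix.mul_smul, Matrix.trace_add, Matrix.trace_sub,
    Matrix.trace_neg, Matrix.trace_smul, smul_eq_mul]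
  rw [← Matrix.mul_assoc _ (Matrix.of (spin N w)), Matrix.trace_mul_comm _ (sffMat w)]
  simp only [Matrix.mul_assoc]
  ring

/-- The commutator of the normal flow with the Laplacian of the level sets, in a flat metric. -/
lemma flow_lap {D : Fin 4 → Derivation ℝ A A} {w : Fin 4 → Fin 4 → Fin 4 → A}
    (h : IsAdapted (m := 3) D w σ v N) (flat : ∀ a b c d, frameRiem D w a b c d = 0) (f : A) :
    flowD N D (hess (tanD D) (tconn w) f).trace
      = (hess (tanD D) (tconn w) (flowD N D f)).trace
        - 2 * N * (sffMat w * hess (tanD D) (tconn w) f).trace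
        - ∑ l, (2 * ∑ i, tanD D i N * sff w i l - (sffMat w).trace * tanD D l N
          + N * ∑ i, cov2 (tanD D) (tconn w) (sff w) i i l) * tanD D l f := by
  have hc := h.flow_tconn
  simp only [flat, mul_zero, add_zero] at hc
  have hs := h.sff_symm
  have hr := h.spin_skew
  have hr0 : ∀ i, spin N w i i = 0 := fun i => by
    simp only [spin, h.self_eq_zero, mul_zero]
  have ht := h.tconn_skew
  have ht0 : ∀ i j, tconn w i j j = 0 := fun i j => h.self_eq_zero _ _
  -- Everything is expanded in the three tangential indices. The symmetry of `sff` and the skewness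
  -- of `spin` and `tconn` reduce to independent components, and what remains is a polynomial
  -- identity.
  rw [trace_mul_matrix]
  simp only [Matrix.trace, Matrix.diag_apply, hess_apply, Fin.sum_univ_three, map_add, map_sub,
    Derivation.leibniz, smul_eq_mul, h.flow_tan, hc, cov2, sffMat, Matrix.of_apply, hr0, ht0,
    hs 1 0, hs 2 0, hs 2 1, hr 1 0, hr 2 0, hr 2 1, ht _ 1 0, ht _ 2 0, ht _ 2 1, map_neg, map_zero]
  ring

end IsAdapted

end FlowTraces

/-! ### Restriction to the hypersurface: normal derivatives of the lapse, expansion of the Yamabe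
equation. -/

section Restriction

variable {A A' : Type*} [CommRing A] [Algebra ℝ A] [CommRing A'] [Algebra ℝ A'] {m : ℕ}

/-- Restriction of functions to the zero set of `σ`, where `v = 1`. -/
structure IsRestriction (D : Fin (m + 1) → Derivation ℝ A A)
    (w : Fin (m + 1) → Fin (m + 1) → Fin (m + 1) → A) (σ v N : A)
    (D' : Fin m → Derivation ℝ A' A') (r : A →+* A') : Prop extends
    IsAdapted D w σ v N where
  tan : ∀ i f, r (tanD D i f) = D' i (r f)
  sigma : r σ = 0
  speed : r v = 1

variable {D : Fin (m + 1) → Derivation ℝ A A}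
  {w : Fin (m + 1) → Fin (m + 1) → Fin (m + 1) → A} {σ v N : A}
  {D' : Fin m → Derivation ℝ A' A'} {r : A →+* A'}

namespace IsRestriction

lemma lapse (h : IsRestriction D w σ v N D' r) : r N = 1 := by
  have := congrArg r h.inv
  rwa [map_mul, h.speed, mul_one, map_one] at this

lemma tan_lapse (h : IsRestriction D w σ v N D' r) (i : Fin m) : r (tanD D i N) = 0 := by
  rw [h.tan, h.lapse, Derivation.map_one_eq_zero]

lemma flow_lapse (h : IsRestriction D w σ v N D' r) :
    r (flowD N D N) = -r (flowD N D v) := by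
  rw [h.toIsAdapted.D_inv, map_neg, map_mul, map_pow, h.lapse]; ring

lemma flow_flow_lapse (h : IsRestriction D w σ v N D' r) :
    r (flowD N D (flowD N D N)) = 2 * r (flowD N D v) ^ 2 - r (flowD N D (flowD N D v)) := by
  rw [h.toIsAdapted.D_inv (flowD N D)]
  simp only [Derivation.leibniz, Derivation.leibniz_pow, map_neg, map_add, map_mul, map_pow,
    smul_eq_mul, nsmul_eq_mul, h.lapse, h.flow_lapse, map_natCast]
  push_cast
  ring

lemma hess_eq (h : IsRestriction D w σ v N D' r) (f : A) (i j : Fin m) :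
    r (hess (tanD D) (tconn w) f i j) = hess D' (fun i j k => r (tconn w i j k)) (r f) i j := by
  simp only [hess_apply, map_sub, map_sum, map_mul, h.tan]

lemma hess_lapse (h : IsRestriction D w σ v N D' r) (i j : Fin m) :
    r (hess (tanD D) (tconn w) N i j) = 0 := by
  rw [h.hess_eq, h.lapse, hess_apply]
  simp

lemma flow_tan_lapse (h : IsRestriction D w σ v N D' r) (i : Fin m) :
    r (flowD N D (tanD D i N)) = D' i (r (flowD N D N)) := by
  rw [h.toIsAdapted.flow_tan, map_add, map_sum, h.tan]
  simp only [map_mul, h.tan_lapse, mul_zero, Finset.sum_const_zero, add_zero]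

/-- `N` is constant along the hypersurface, so all its tangential derivatives vanish there. The
commutators in `flow_tan` and the derivative of the connection multiply such derivatives and drop
out; only `XN` is left under the Hessian. -/
lemma flow_hess_lapse (h : IsRestriction D w σ v N D' r) (i j : Fin m) :
    r (flowD N D (hess (tanD D) (tconn w) N i j))
      = hess D' (fun i j k => r (tconn w i j k)) (r (flowD N D N)) i j := by
  have h1 : ∀ l, r (tanD D l (tanD D j N)) = 0 := fun l => by
    rw [h.tan, h.tan_lapse, map_zero]
  rw [hess_apply, hess_apply, map_sub, h.toIsAdapted.flow_tan i, h.toIsAdapted.flow_tan j]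
  simp only [map_add, map_sub, map_sum, map_mul, Derivation.leibniz, smul_eq_mul, h.tan,
    h.flow_tan_lapse, h.lapse]
  simp

lemma flow_mul_hess_lapse (h : IsRestriction D w σ v N D' r) (M : Matrix (Fin m) (Fin m) A) :
    r (flowD N D (M * hess (tanD D) (tconn w) N).trace)
      = (M.map r * hess D' (fun i j k => r (tconn w i j k)) (r (flowD N D N))).trace := by
  rw [trace_mul_matrix, trace_mul_matrix]
  simp only [map_sum, Derivation.leibniz, smul_eq_mul, map_add, map_mul, h.flow_hess_lapse,
    h.hess_lapse, zero_mul, add_zero, Matrix.map_apply]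

lemma mul_hess_lapse (h : IsRestriction D w σ v N D' r) (M : Matrix (Fin m) (Fin m) A) :
    r (M * hess (tanD D) (tconn w) N).trace = 0 := by
  rw [trace_mul_matrix]
  simp only [map_sum, map_mul, h.hess_lapse, mul_zero, Finset.sum_const_zero]

lemma flow_lap_lapse (h : IsRestriction D w σ v N D' r) :
    r (flowD N D (hess (tanD D) (tconn w) N).trace)
      = (hess D' (fun i j k => r (tconn w i j k)) (r (flowD N D N))).trace := by
  have := h.flow_mul_hess_lapse 1
  rw [Matrix.one_mul] at this
  rw [this]
  congr 1
  rw [show (1 : Matrix (Fin m) (Fin m) A).map r = 1 from Matrix.map_one r (map_zero r) (map_one r),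
    Matrix.one_mul]

lemma lap_lapse (h : IsRestriction D w σ v N D' r) :
    r (hess (tanD D) (tconn w) N).trace = 0 := by
  have := h.mul_hess_lapse 1
  rwa [Matrix.one_mul] at this

lemma cov2_sff (h : IsRestriction D w σ v N D' r) (i j k : Fin m) :
    r (cov2 (tanD D) (tconn w) (sff w) i j k)
      = cov2 D' (fun i j k => r (tconn w i j k)) (fun i j => r (sff w i j)) i j k := by
  simp only [cov2, map_sub, map_sum, map_mul, h.tan]

lemma frameRiem_tan (h : IsRestriction D w σ v N D' r) (i j k l : Fin m) :
    r (frameRiem (tanD D) (tconn w) i j k l)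
      = frameRiem D' (fun i j k => r (tconn w i j k)) i j k l := by
  simp only [frameRiem, map_add, map_sub, map_sum, map_mul, h.tan]

/-- Commute `X` past the Laplacian twice by `flow_lap`. The trace term and the gradient term each
survive twice: once from commuting with `XN` inside, and once from differentiating a term that
vanishes on the hypersurface. Hence the coefficients 4 and 2. -/
lemma flow_flow_lap_lapse {D : Fin 4 → Derivation ℝ A A} {w : Fin 4 → Fin 4 → Fin 4 → A}
    {D' : Fin 3 → Derivation ℝ A' A'}
    (h : IsRestriction (m := 3) D w σ v N D' r) (flat : ∀ a b c d, frameRiem D w a b c d = 0) :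
    r (flowD N D (flowD N D (hess (tanD D) (tconn w) N).trace))
      = (hess D' (fun i j k => r (tconn w i j k)) (r (flowD N D (flowD N D N)))).trace
        - 4 * ((sffMat w).map r
          * hess D' (fun i j k => r (tconn w i j k)) (r (flowD N D N))).trace
        - 2 * ∑ l, (∑ i, cov2 D' (fun i j k => r (tconn w i j k)) (fun i j => r (sff w i j)) i i l)
          * D' l (r (flowD N D N)) := by
  have e1 : r (hess (tanD D) (tconn w) (flowD N D (flowD N D N))).trace
      = (hess D' (fun i j k => r (tconn w i j k)) (r (flowD N D (flowD N D N)))).trace := by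
    simp only [Matrix.trace, map_sum, Matrix.diag_apply, h.hess_eq]
  have e2 : r (sffMat w * hess (tanD D) (tconn w) (flowD N D N)).trace
      = ((sffMat w).map r
          * hess D' (fun i j k => r (tconn w i j k)) (r (flowD N D N))).trace := by
    rw [trace_mul_matrix, trace_mul_matrix]
    simp only [map_sum, map_mul, h.hess_eq, Matrix.map_apply]
  rw [h.toIsAdapted.flow_lap flat N]
  simp only [map_sub, map_add, map_sum, Derivation.leibniz, smul_eq_mul, map_mul,
    h.toIsAdapted.flow_lap flat (flowD N D N), h.flow_mul_hess_lapse, h.mul_hess_lapse,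
    h.flow_tan_lapse, h.tan_lapse, e1, e2, h.lapse, map_ofNat, h.cov2_sff, mul_zero, zero_mul,
    add_zero, Finset.sum_const_zero, zero_add, sub_zero, one_mul, mul_one, h.tan]
  ring

end IsRestriction

/-- The consequences, on the zero set of `σ`, of the singular Yamabe equation in dimension four. -/
lemma yamabe_four_expansion (X : Derivation ℝ A A) (r : A →+* A') {σ v T B : A} (hσ : X σ = 1)
    (rσ : r σ = 0) (rv : r v = 1)
    (hS : 2 * v ^ 2 - σ * (v * X v + v * T) = 2 + 2 * σ ^ 4 * B) :
    3 * r (X v) = r T ∧ r (X (X v)) = 2 * r (X v) ^ 2 + r (X T) ∧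
    r (X (X (X v))) = 6 * r (X v) * r (X (X v)) + 6 * r (X v) * r (X T) + 3 * r (X (X T)) ∧
    -12 * r B = r (X (X (X v))) * r T + 3 * r (X (X v)) * r (X T) + 3 * r (X v) * r (X (X T))
      + r (X (X (X T))) := by
  -- `Q` stays opaque while `σ Q` is differentiated: on `σ = 0` the j-th derivative of `σ Q` is just
  -- j times the (j−1)-st derivative of `Q`.
  obtain ⟨Q, hQ⟩ : ∃ Q, Q = v * X v + v * T := ⟨_, rfl⟩
  rw [← hQ] at hS
  have x2 : X 2 = 0 := by simpa using X.map_natCast 2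
  have e0 : 2 * (v * v) = 2 + σ * Q + 2 * (σ * σ * σ * σ * B) := by linear_combination hS
  have e1 := congrArg X e0
  simp only [map_add, Derivation.leibniz, smul_eq_mul, x2, hσ] at e1
  have e2 := congrArg X e1
  simp only [map_add, Derivation.leibniz, smul_eq_mul, x2, hσ, map_zero, Derivation.map_one_eq_zero]
    at e2
  have e3 := congrArg X e2
  simp only [map_add, Derivation.leibniz, smul_eq_mul, x2, hσ, map_zero, Derivation.map_one_eq_zero]
    at e3
  have e4 := congrArg X e3
  simp only [map_add, Derivation.leibniz, smul_eq_mul, x2, hσ, map_zero, Derivation.map_one_eq_zero]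
    at e4
  have q1 := congrArg X hQ
  simp only [map_add, Derivation.leibniz, smul_eq_mul] at q1
  have q2 := congrArg X q1
  simp only [map_add, Derivation.leibniz, smul_eq_mul] at q2
  have q3 := congrArg X q2
  simp only [map_add, Derivation.leibniz, smul_eq_mul] at q3
  replace hQ := congrArg r hQ
  replace q1 := congrArg r q1
  replace q2 := congrArg r q2
  replace q3 := congrArg r q3
  replace e1 := congrArg r e1
  replace e2 := congrArg r e2
  replace e3 := congrArg r e3
  replace e4 := congrArg r e4
  simp only [map_add, map_mul, rσ, rv, map_one, map_ofNat, mul_zero, zero_mul, add_zero,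
    zero_add, mul_one, one_mul] at hQ q1 q2 q3 e1 e2 e3 e4
  have c1 : 3 * r (X v) = r T := by linear_combination e1 + hQ
  have c2 : r (X (X v)) = 2 * r (X v) ^ 2 + r (X T) := by
    refine natCast_mul_cancel (k := 2) two_ne_zero ?_
    push_cast
    linear_combination e2 + 2 * q1 - 2 * r (X v) * c1
  have c3 : r (X (X (X v))) = 6 * r (X v) * r (X (X v)) + 6 * r (X v) * r (X T)
      + 3 * r (X (X T)) := by
    linear_combination e3 + 3 * q2 - 3 * r (X (X v)) * c1
  refine ⟨c1, c2, c3, ?_⟩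
  -- In order four the derivatives of `v²` cancel: they enter as 2 X⁴(v²) on one side and as 4 · ½
  -- X⁴(v²), through `Q`, on the other. What is left is −12 B = X³(vT), expanded with `v = 1`.
  refine natCast_mul_cancel (k := 4) four_ne_zero ?_
  push_cast
  linear_combination e4 + 4 * q3

end Restriction

/-! ### Trace-free parts, traces and norms of tensors in an orthonormal frame. -/

section TraceFree

variable {A : Type*} [CommRing A] [Algebra ℝ A] {n : ℕ}

/-- The identity matrix times a function, as a 2-tensor. -/
def scalarTensor (H : A) (a b : Fin n) : A := if a = b then H else 0

variable {D : Fin n → Derivation ℝ A A} {c : Fin n → Fin n → Fin n → A}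

/-- The identity tensor is the metric in an orthonormal frame, hence parallel: the two connection
terms cancel by skewness, and only `H` is differentiated. -/
lemma cov2_sub_scalar (h : IsFrameConn D c) (k : Fin n → Fin n → A) (H : A) (e a b : Fin n) :
    cov2 D c (fun i j => k i j - scalarTensor H i j) e a b
      = cov2 D c k e a b - scalarTensor (D e H) a b := by
  have h1 : D e (scalarTensor H a b) = scalarTensor (D e H) a b := by
    unfold scalarTensor; split_ifs <;> simp
  simp only [cov2, map_sub, h1, mul_sub, Finset.sum_sub_distrib]
  simp only [scalarTensor, mul_ite, mul_zero, Finset.sum_ite_eq, Finset.sum_ite_eq',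
    Finset.mem_univ, if_true]
  rw [h.skew e a b]
  ring

lemma cov3_sub_scalar (h : IsFrameConn D c) (k : Fin n → Fin n → Fin n → A) (H : A)
    (d e a b : Fin n) :
    cov3 D c (fun e i j => k e i j - scalarTensor (D e H) i j) d e a b
      = cov3 D c k d e a b - scalarTensor (hess D c H d e) a b := by
  have h1 : D d (scalarTensor (D e H) a b) - ∑ l, c d e l * scalarTensor (D l H) a b
      = scalarTensor (hess D c H d e) a b := by
    unfold scalarTensor; split_ifs <;> simp [hess_apply]
  simp only [cov3, map_sub, mul_sub, Finset.sum_sub_distrib, ← h1]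
  simp only [scalarTensor, mul_ite, mul_zero, Finset.sum_ite_eq, Finset.sum_ite_eq',
    Finset.mem_univ, if_true]
  rw [h.skew d a b]
  ring

/-- Contraction commutes with covariant differentiation, again by skewness of the connection. -/
lemma cov2_trace (h : IsFrameConn D c) (k : Fin n → Fin n → A) (e : Fin n) :
    ∑ a, cov2 D c k e a a = D e (∑ a, k a a) := by
  simp only [cov2, Finset.sum_sub_distrib, map_sum]
  have : ∑ a, ∑ l, c e a l * k a l = -∑ a, ∑ l, c e a l * k l a := by
    rw [Finset.sum_comm]
    simp only [← Finset.sum_neg_distrib]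
    exact Finset.sum_congr rfl fun i _ => Finset.sum_congr rfl fun j _ => by
      rw [h.skew e j i]; ring
  rw [this]; ring

lemma cov3_trace (h : IsFrameConn D c) (k : Fin n → Fin n → Fin n → A) (d e : Fin n) :
    ∑ a, cov3 D c k d e a a = cov1 D c (fun e => ∑ a, k e a a) d e := by
  simp only [cov3, cov1, Finset.sum_sub_distrib, map_sum, Finset.mul_sum]
  have : ∑ a, ∑ l, c d a l * k e a l = -∑ a, ∑ l, c d a l * k e l a := by
    rw [Finset.sum_comm]
    simp only [← Finset.sum_neg_distrib]
    exact Finset.sum_congr rfl fun i _ => Finset.sum_congr rfl fun j _ => by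
      rw [h.skew d j i]; ring
  have h2 : ∑ a, ∑ l, c d e l * k l a a = ∑ l, ∑ a, c d e l * k l a a := Finset.sum_comm
  rw [this, h2]; ring

lemma derivation_inner (h : IsFrameConn D c) (S T : Fin n → Fin n → A) (e : Fin n) :
    D e (∑ a, ∑ b, S a b * T a b)
      = ∑ a, ∑ b, (cov2 D c S e a b * T a b + S a b * cov2 D c T e a b) := by
  have h1 : ∑ a, ∑ b, (∑ l, c e a l * S l b) * T a b
      = -∑ a, ∑ b, S a b * ∑ l, c e a l * T l b := by
    simp only [Finset.mul_sum, Finset.sum_mul, ← Finset.sum_neg_distrib]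
    conv_lhs => enter [2, a]; rw [Finset.sum_comm]
    rw [Finset.sum_comm]
    refine Finset.sum_congr rfl fun i _ => ?_
    rw [Finset.sum_comm]
    refine Finset.sum_congr rfl fun j _ => Finset.sum_congr rfl fun l _ => ?_
    rw [h.skew e l i]; ring
  have h2 : ∑ a, ∑ b, (∑ l, c e b l * S a l) * T a b
      = -∑ a, ∑ b, S a b * ∑ l, c e b l * T a l := by
    simp only [Finset.mul_sum, Finset.sum_mul, ← Finset.sum_neg_distrib]
    refine Finset.sum_congr rfl fun i _ => ?_
    rw [Finset.sum_comm]
    refine Finset.sum_congr rfl fun j _ => Finset.sum_congr rfl fun l _ => ?_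
    rw [h.skew e l j]; ring
  simp only [map_sum, Derivation.leibniz, smul_eq_mul, cov2, sub_mul, mul_sub,
    Finset.sum_add_distrib, Finset.sum_sub_distrib, h1, h2]
  simp only [mul_comm (T _ _)]
  ring

/-- The Laplacian of the squared length of a 2-tensor. -/
lemma lap_inner_self (h : IsFrameConn D c) (k : Fin n → Fin n → A) :
    (hess D c (∑ a, ∑ b, k a b * k a b)).trace
      = 2 * ∑ e, ∑ a, ∑ b, cov2 D c k e a b ^ 2
        + 2 * ∑ a, ∑ b, k a b * ∑ e, cov3 D c (cov2 D c k) e e a b := by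
  have h1 : ∀ e, D e (∑ a, ∑ b, k a b * k a b) = 2 * ∑ a, ∑ b, cov2 D c k e a b * k a b := by
    intro e
    rw [derivation_inner h]
    simp only [Finset.mul_sum]
    exact Finset.sum_congr rfl fun i _ => Finset.sum_congr rfl fun j _ => by ring
  have d2 : ∀ (e : Fin n) (x : A), D e (2 * x) = 2 * D e x := by
    intro e x
    rw [two_mul, map_add, two_mul]
  have h2 : ∀ e, hess D c (∑ a, ∑ b, k a b * k a b) e e
      = 2 * ∑ a, ∑ b, (cov2 D c k e a b ^ 2 + k a b * cov3 D c (cov2 D c k) e e a b) := by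
    intro e
    -- With the index `e` frozen, `cov2` omits the connection term of the derivative slot. The
    -- Hessian of the squared length supplies exactly this term.
    have h3 : ∀ a b, cov2 D c (cov2 D c k e) e a b
        = cov3 D c (cov2 D c k) e e a b + ∑ l, c e e l * cov2 D c k l a b := by
      intro a b
      rw [cov3, cov2]; ring
    have h4 : ∑ a, ∑ b, (∑ l, c e e l * cov2 D c k l a b) * k a b
        = ∑ l, c e e l * ∑ a, ∑ b, cov2 D c k l a b * k a b := by
      simp only [Finset.mul_sum, Finset.sum_mul]
      conv_lhs => enter [2, a]; rw [Finset.sum_comm]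
      rw [Finset.sum_comm]
      exact Finset.sum_congr rfl fun i _ => Finset.sum_congr rfl fun j _ =>
        Finset.sum_congr rfl fun j _ => by ring
    have h5 : ∑ l, c e e l * (2 * ∑ a, ∑ b, cov2 D c k l a b * k a b)
        = 2 * ∑ l, c e e l * ∑ a, ∑ b, cov2 D c k l a b * k a b := by
      rw [Finset.mul_sum]
      exact Finset.sum_congr rfl fun j _ => by ring
    rw [hess_apply]
    simp only [h1, d2]
    rw [derivation_inner h, h5, ← h4, ← mul_sub, ← Finset.sum_sub_distrib]
    congr 1
    refine Finset.sum_congr rfl fun i _ => ?_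
    rw [← Finset.sum_sub_distrib]
    exact Finset.sum_congr rfl fun j _ => by rw [h3]; ring
  simp only [Matrix.trace, Matrix.diag_apply, h2, ← Finset.mul_sum]
  rw [← mul_add]
  congr 1
  simp only [Finset.sum_add_distrib, Finset.mul_sum]
  congr 1
  rw [Finset.sum_comm]
  refine Finset.sum_congr rfl fun i _ => ?_
  rw [Finset.sum_comm]

end TraceFree

/-! ### Commutation of covariant derivatives and Simons' identity for Codazzi tensors. -/

section RicciIdentity

variable {A : Type*} [CommRing A] [Algebra ℝ A]
variable {D : Fin 3 → Derivation ℝ A A} {c : Fin 3 → Fin 3 → Fin 3 → A}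

/-- The Ricci identity for covariant 2-tensors. -/
lemma ricci_identity (h : IsFrameConn D c) (k : Fin 3 → Fin 3 → A) (d e a b : Fin 3) :
    cov3 D c (cov2 D c k) d e a b - cov3 D c (cov2 D c k) e d a b
      = -∑ l, frameRiem D c d e a l * k l b - ∑ l, frameRiem D c d e b l * k a l := by
  have hb := h.bracket d e (k a b)
  rw [Fin.sum_univ_three] at hb
  simp only [cov3, cov2, frameRiem, Fin.sum_univ_three, map_add, map_sub, Derivation.leibniz,
    smul_eq_mul]
  linear_combination hb

end RicciIdentity

section Simons

variable {A : Type*} [CommRing A] [Algebra ℝ A]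
variable {D : Fin 3 → Derivation ℝ A A} {c : Fin 3 → Fin 3 → Fin 3 → A} {k : Fin 3 → Fin 3 → A}

lemma cov2_symm {n : ℕ} {D : Fin n → Derivation ℝ A A} {c : Fin n → Fin n → Fin n → A}
    {k : Fin n → Fin n → A} (hk : ∀ a b, k a b = k b a) (e a b : Fin n) :
    cov2 D c k e a b = cov2 D c k e b a := by
  have h1 : ∑ l, c e a l * k l b = ∑ l, c e a l * k b l :=
    Finset.sum_congr rfl fun l _ => by rw [hk l b]
  have h2 : ∑ l, c e b l * k a l = ∑ l, c e b l * k l a :=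
    Finset.sum_congr rfl fun l _ => by rw [hk a l]
  rw [cov2, cov2, h1, h2, hk a b]
  ring

lemma cov3_symm_left {n : ℕ} {D : Fin n → Derivation ℝ A A} {c : Fin n → Fin n → Fin n → A}
    {k : Fin n → Fin n → Fin n → A} (hk : ∀ e a b, k e a b = k a e b) (d e a b : Fin n) :
    cov3 D c k d e a b = cov3 D c k d a e b := by
  have h1 : ∑ l, c d e l * k l a b = ∑ l, c d e l * k a l b :=
    Finset.sum_congr rfl fun l _ => by rw [hk l a]
  have h2 : ∑ l, c d a l * k e l b = ∑ l, c d a l * k l e b :=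
    Finset.sum_congr rfl fun l _ => by rw [hk e l]
  have h3 : ∑ l, c d b l * k e a l = ∑ l, c d b l * k a e l :=
    Finset.sum_congr rfl fun l _ => by rw [hk e a]
  rw [cov3, cov3, h1, h2, h3, hk e a b]
  ring

lemma cov3_symm_right {n : ℕ} {D : Fin n → Derivation ℝ A A} {c : Fin n → Fin n → Fin n → A}
    {k : Fin n → Fin n → Fin n → A} (hk : ∀ e a b, k e a b = k e b a) (d e a b : Fin n) :
    cov3 D c k d e a b = cov3 D c k d e b a := by
  have h1 : ∑ l, c d e l * k l a b = ∑ l, c d e l * k l b a :=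
    Finset.sum_congr rfl fun l _ => by rw [hk l a]
  have h2 : ∑ l, c d a l * k e l b = ∑ l, c d a l * k e b l :=
    Finset.sum_congr rfl fun l _ => by rw [hk e l]
  have h3 : ∑ l, c d b l * k e a l = ∑ l, c d b l * k e l a :=
    Finset.sum_congr rfl fun l _ => by rw [hk e a]
  rw [cov3, cov3, h1, h2, h3, hk e a b]
  ring

/-- Simons' identity for a Codazzi tensor satisfying the Gauss equation of a flat metric. -/
lemma simons_identity (h : IsFrameConn D c) (hk : ∀ a b, k a b = k b a)
    (codazzi : ∀ a b e, cov2 D c k a b e = cov2 D c k b a e)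
    (gauss : ∀ a b e l, frameRiem D c a b e l = k b e * k a l - k a e * k b l) :
    ∑ a, ∑ b, k a b * ∑ e, cov3 D c (cov2 D c k) e e a b
      = ∑ a, ∑ b, k a b * hess D c (∑ e, k e e) a b
        + (∑ e, k e e) * (∑ a, ∑ b, ∑ e, k a b * k b e * k e a)
        - (∑ a, ∑ b, k a b * k a b) ^ 2 := by
  have s1 := cov3_symm_left (D := D) (c := c) codazzi
  have s2 := cov3_symm_right (D := D) (c := c) (cov2_symm (D := D) (c := c) hk)
  -- By Codazzi ∇_e∇_e k_ab = ∇_e∇_a k_eb. The Ricci identity exchanges the derivatives at the cost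
  -- of curvature, given by Gauss, and Codazzi once more moves `b` out of the tensor. The sum over
  -- `e` then yields the Hessian of the trace.
  have key : ∀ a b e, cov3 D c (cov2 D c k) e e a b = cov3 D c (cov2 D c k) a b e e
      - ∑ l, (k a e * k e l - k e e * k a l) * k l b
      - ∑ l, (k a b * k e l - k e b * k a l) * k e l := by
    intro a b e
    have := ricci_identity h k e a e b
    simp only [gauss] at this
    rw [s1 e e a b, s1 a b e e, s2 a e b e]
    linear_combination this
  have ht : ∀ a b, ∑ e, cov3 D c (cov2 D c k) a b e e = hess D c (∑ e, k e e) a b := by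
    intro a b
    rw [cov3_trace h]
    simp only [cov2_trace h]
    rfl
  simp only [key, Finset.sum_sub_distrib, ht]
  simp only [Fin.sum_univ_three, hk 1 0, hk 2 0, hk 2 1]
  ring

/-- The combination of invariants of a Codazzi tensor `k` with trace `3 H` that arises from the
expansion of the singular Yamabe equation, in terms of the trace-free part of `k`. -/
lemma threefold_identity (h : IsFrameConn D c) (hk : ∀ a b, k a b = k b a)
    (codazzi : ∀ a b e, cov2 D c k a b e = cov2 D c k b a e)
    (gauss : ∀ a b e l, frameRiem D c a b e l = k b e * k a l - k a e * k b l)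
    {H J B : A} (hH : 3 * H = ∑ e, k e e) (hJ : 4 * J = ∑ a, ∑ e, frameRiem D c e a a e)
    {k0 : Fin 3 → Fin 3 → A} (hk0 : ∀ a b, k0 a b = k a b - scalarTensor H a b)
    (hB : -12 * B = 36 * H ^ 4 - 30 * H ^ 2 * (∑ a, ∑ b, k a b * k a b)
      + 18 * H * (∑ a, ∑ b, ∑ e, k a b * k b e * k e a) + 2 * (∑ a, ∑ b, k a b * k a b) ^ 2
      - 6 * (∑ a, ∑ b, (∑ e, k a e * k e b) ^ 2) + 12 * H * (hess D c H).trace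
      - (hess D c (∑ a, ∑ b, k a b * k a b)).trace - 6 * (∑ a, ∑ b, k a b * hess D c H a b)
      - 2 * ∑ l, (∑ i, cov2 D c k i i l) * D l H) :
    12 * B = 2 * (∑ e, ∑ a, ∑ b, cov2 D c k0 e a b ^ 2)
      + 4 * (∑ a, ∑ b, (∑ e, cov3 D c (cov2 D c k0) e e a b) * k0 a b)
      + 3 * ∑ a, (∑ b, cov2 D c k0 b a b) ^ 2
      - 4 * J * (∑ a, ∑ b, k0 a b * k0 a b) + 2 * (∑ a, ∑ b, k0 a b * k0 a b) ^ 2 := by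
  obtain rfl : k0 = fun a b => k a b - scalarTensor H a b := by ext a b; exact hk0 a b
  have h3 : ∀ (i : Fin 3) (x : A), D i (3 * x) = 3 * D i x := by
    intro i x
    rw [show (3 : A) * x = x + x + x by ring, map_add, map_add]; ring
  have dH : ∀ e, ∑ a, cov2 D c k e a a = 3 * D e H := by
    intro e
    rw [cov2_trace h, ← hH, h3]
  have hessT : ∀ a b, hess D c (∑ e, k e e) a b = 3 * hess D c H a b := by
    intro a b
    simp only [hess_apply, ← hH, h3, Finset.mul_sum, mul_sub]
    congr 1
    exact Finset.sum_congr rfl fun j _ => by ring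
  have s1 := cov2_symm (D := D) (c := c) hk
  have ediv : ∀ a, ∑ b, cov2 D c k b a b = 3 * D a H := by
    -- By Codazzi the divergence of `k` is the gradient of its trace `3H`.
    intro a; rw [← dH]; exact Finset.sum_congr rfl fun b _ => codazzi b a b
  have ediv2 : ∀ a, ∑ b, cov2 D c k b b a = 3 * D a H := by
    intro a; rw [← ediv]; exact Finset.sum_congr rfl fun b _ => s1 b b a
  have ec2 : cov2 D c (fun i j => k i j - scalarTensor H i j)
      = fun e a b => cov2 D c k e a b - scalarTensor (D e H) a b := by
    ext e a b; exact cov2_sub_scalar h k H e a b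
  have ec3 : ∀ d e a b, cov3 D c (cov2 D c (fun i j => k i j - scalarTensor H i j)) d e a b
      = cov3 D c (cov2 D c k) d e a b - scalarTensor (hess D c H d e) a b := by
    intro d e a b
    rw [ec2, cov3_sub_scalar h]
  have hSimons := simons_identity h hk codazzi gauss
  rw [lap_inner_self h, hSimons] at hB
  have trC : ∑ a, ∑ e, cov3 D c (cov2 D c k) e e a a = 3 * (hess D c H).trace := by
    rw [Finset.sum_comm]
    simp only [cov3_trace h, cov2_trace h, Matrix.trace, Matrix.diag_apply, Finset.mul_sum]
    exact Finset.sum_congr rfl fun e _ => hessT e e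
  simp only [hessT] at hB hSimons
  rw [hJ]
  -- Removing the trace subtracts one gradient of `H` from the three of `ediv`, leaving the factor
  -- 2.
  have hdiv : ∀ a, ∑ b, cov2 D c (fun i j => k i j - scalarTensor H i j) b a b = 2 * D a H := by
    intro a
    simp only [ec2]
    simp only [Finset.sum_sub_distrib, ediv, scalarTensor, Finset.sum_ite_eq,
      Finset.mem_univ, if_true]
    ring
  have hgrad : ∑ e, ∑ a, ∑ b, cov2 D c (fun i j => k i j - scalarTensor H i j) e a b ^ 2
      = ∑ e, ∑ a, ∑ b, cov2 D c k e a b ^ 2 - 3 * ∑ e, D e H ^ 2 := by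
    have h0 := dH 0
    have h1 := dH 1
    have h2 := dH 2
    simp only [ec2]
    simp only [scalarTensor]
    simp only [Fin.sum_univ_three, Fin.isValue, Fin.reduceEq, if_true, if_false] at h0 h1 h2 ⊢
    linear_combination -2 * D 0 H * h0 - 2 * D 1 H * h1 - 2 * D 2 H * h2
  have hlap : ∑ a, ∑ b, (∑ e, cov3 D c (cov2 D c (fun i j => k i j - scalarTensor H i j)) e e a b)
        * (k a b - scalarTensor H a b)
      = ∑ a, ∑ b, k a b * (∑ e, cov3 D c (cov2 D c k) e e a b) - 3 * H * (hess D c H).trace := by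
    have hz : ∀ a b, ∑ e, cov3 D c (cov2 D c (fun i j => k i j - scalarTensor H i j)) e e a b
        = ∑ e, cov3 D c (cov2 D c k) e e a b - scalarTensor (hess D c H).trace a b := by
      intro a b
      simp only [ec3, Finset.sum_sub_distrib]
      congr 1
      unfold scalarTensor; split_ifs <;> simp [Matrix.trace]
    simp only [hz]
    -- The rough Laplacian of `k` matters only through its trace and its pairing with `k`, so it is
    -- replaced by an arbitrary tensor with known trace.
    generalize hx : (fun a b => ∑ e, cov3 D c (cov2 D c k) e e a b) = x at *
    have hx' : ∀ a b, ∑ e, cov3 D c (cov2 D c k) e e a b = x a b := fun a b => by rw [← hx]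
    simp only [hx'] at trC ⊢
    simp only [scalarTensor]
    simp only [Fin.sum_univ_three, Fin.isValue, Fin.reduceEq, if_true, if_false] at trC hH ⊢
    linear_combination -H * trC + (hess D c H).trace * hH
  rw [hgrad, hlap, hSimons]
  simp only [hdiv, gauss]
  simp only [ediv2] at hB
  generalize hx : hess D c H = x at *
  generalize ∑ e, ∑ a, ∑ b, cov2 D c k e a b ^ 2 = z at *
  simp only [Fin.sum_univ_three, hk 1 0, hk 2 0, hk 2 1, scalarTensor, Fin.isValue, Fin.reduceEq,
    if_true, if_false, Matrix.trace, Matrix.diag_apply] at hH hB ⊢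
  -- The trace condition eliminates one diagonal entry, and the remaining claim is a polynomial
  -- identity in independent quantities.
  obtain hk22 : k 2 2 = 3 * H - k 0 0 - k 1 1 := by linear_combination -hH
  simp only [hk22] at hB ⊢
  linear_combination -hB

end Simons

/-! ### The obstruction in a flat four-manifold. -/

section ObstructionFour

variable {A A' : Type*} [CommRing A] [Algebra ℝ A] [CommRing A'] [Algebra ℝ A']
  {D : Fin 4 → Derivation ℝ A A} {w : Fin 4 → Fin 4 → Fin 4 → A} {σ v N : A}
  {D' : Fin 3 → Derivation ℝ A' A'} {r : A →+* A'}

/-- The ASC obstruction of a hypersurface in a flat 4-manifold, in an adapted frame. -/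
theorem IsRestriction.obstruction_four (h : IsRestriction (m := 3) D w σ v N D' r)
    (flat : ∀ a b c d, frameRiem D w a b c d = 0) {B : A}
    (hS : 2 * v ^ 2 - σ * (D 0 v + v * ∑ i, sff w i i) = 2 + 2 * σ ^ 4 * B)
    {c' : Fin 3 → Fin 3 → Fin 3 → A'} (hc' : ∀ i j k, r (tconn w i j k) = c' i j k)
    (hF : IsFrameConn D' c') {k : Fin 3 → Fin 3 → A'} (hk : ∀ i j, r (sff w i j) = k i j)
    {H J : A'} (hH : 3 * H = ∑ e, k e e) (hJ : 4 * J = ∑ a, ∑ e, frameRiem D' c' e a a e)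
    {k0 : Fin 3 → Fin 3 → A'} (hk0 : ∀ a b, k0 a b = k a b - scalarTensor H a b) :
    12 * r B = 2 * (∑ e, ∑ a, ∑ b, cov2 D' c' k0 e a b ^ 2)
      + 4 * (∑ a, ∑ b, (∑ e, cov3 D' c' (cov2 D' c' k0) e e a b) * k0 a b)
      + 3 * ∑ a, (∑ b, cov2 D' c' k0 b a b) ^ 2
      - 4 * J * (∑ a, ∑ b, k0 a b * k0 a b) + 2 * (∑ a, ∑ b, k0 a b * k0 a b) ^ 2 := by
  have hA := h.toIsAdapted
  obtain rfl : (fun i j k => r (tconn w i j k)) = c' := by ext i j k; exact hc' i j k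
  obtain rfl : (fun i j => r (sff w i j)) = k := by ext i j; exact hk i j
  -- The normal derivative becomes a derivative along `X`, as `e₀ = v X`.
  have hD0 : D 0 v = v * flowD N D v := by
    rw [flowD_apply]; linear_combination -(D 0 v * hA.inv)
  rw [hD0] at hS
  obtain ⟨y1, y2, y3, yB⟩ := yamabe_four_expansion (flowD N D) r hA.flow_sigma h.sigma h.speed hS
  set T := ∑ i, sff w i i with hT
  have hT' : (sffMat w).trace = T := rfl
  have hR : radialRiem D w = 0 := by ext i j; exact flat _ _ _ _
  have f1 := hA.flow_trace
  have f2 := hA.flow_trace_sq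
  have f3 := hA.flow_trace_cube
  rw [hR] at f1 f2 f3
  simp only [mul_zero, Matrix.trace_zero, add_zero] at f1 f2 f3
  rw [hT'] at f1
  have g1 := h.flow_mul_hess_lapse
  have g2 := h.flow_lap_lapse
  have g3 := h.flow_flow_lap_lapse flat
  rw [mul_assoc 2 N] at f2
  set X := flowD N D with hX
  have rT : r T = 3 * H := by rw [hH, hT, map_sum]
  -- First order of the Yamabe equation: 3 Xv = T = 3H on the hypersurface.
  have hy : r (X v) = H := by
    refine natCast_mul_cancel (k := 3) three_ne_zero ?_
    push_cast
    rw [y1, rT]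
  have n1 : r (X N) = -H := by rw [h.flow_lapse, hy]
  have t1 : r (X T) = -r (sffMat w * sffMat w).trace := by
    rw [f1, map_sub, map_neg, h.lap_lapse, map_mul, h.lapse]; ring
  have n2 : r (X (X N)) = r (sffMat w * sffMat w).trace := by
    rw [h.flow_flow_lapse, y2, t1, hy]; ring
  have u1 : r (X (sffMat w * sffMat w).trace) = -2 * r (sffMat w * sffMat w * sffMat w).trace := by
    rw [f2, map_sub, map_neg, map_mul, map_mul, map_mul, h.mul_hess_lapse, h.lapse, map_ofNat]
    ring
  have u1' : r (X (sffMat w * sffMat w * sffMat w).trace)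
      = -3 * r (sffMat w * sffMat w * (sffMat w * sffMat w)).trace := by
    rw [f3, map_sub, map_neg, map_mul, map_mul, map_mul, h.mul_hess_lapse, h.lapse, map_ofNat]
    ring
  have X2 : ∀ x, X (2 * x) = 2 * X x := fun x => by rw [two_mul, map_add, two_mul]
  -- Differentiating the evolution equations once and twice more gives X² tr(II²), X²T and X³T on
  -- the hypersurface, with only `H`, `II` and tangential derivatives on the right.
  have u2 := congrArg r (congrArg X f2)
  have t2 := congrArg r (congrArg X f1)
  have t3 := congrArg r (congrArg X (congrArg X f1))
  simp only [map_sub, map_neg, X2, map_mul, map_ofNat, g1,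
    Derivation.leibniz, smul_eq_mul, map_add, h.lapse, n1, u1', one_mul] at u2
  simp only [map_sub, map_neg, map_mul, g2,
    Derivation.leibniz, smul_eq_mul, map_add, h.lapse, n1, u1, one_mul] at t2
  simp only [map_sub, map_neg, map_mul, g3, n2,
    Derivation.leibniz, smul_eq_mul, map_add, h.lapse, n1, u1, one_mul] at t3
  have hneg : ∀ a b, hess D' (fun i j k => r (tconn w i j k)) (-H) a b
      = -hess D' (fun i j k => r (tconn w i j k)) H a b := by
    intro a b
    simp only [hess_apply, map_neg, mul_neg, Finset.sum_neg_distrib]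
    ring
  have hmap : ∀ a b, (sffMat w).map r a b = r (sff w a b) := fun _ _ => rfl
  have p2 : r (sffMat w * sffMat w).trace = ∑ a, ∑ b, r (sff w a b) * r (sff w a b) := by
    rw [trace_mul_matrix]
    simp only [map_sum, map_mul, sffMat, Matrix.of_apply]
    exact Finset.sum_congr rfl fun a _ => Finset.sum_congr rfl fun b _ => by rw [hA.sff_symm b a]
  have p3 : r (sffMat w * sffMat w * sffMat w).trace
      = ∑ a, ∑ b, ∑ e, r (sff w a b) * r (sff w b e) * r (sff w e a) := by
    rw [trace_mul_matrix]
    simp only [map_sum, map_mul, sffMat, Matrix.of_apply, Matrix.mul_apply, Finset.sum_mul]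
    exact Finset.sum_congr rfl fun a _ => Finset.sum_comm
  have p4 : r (sffMat w * sffMat w * (sffMat w * sffMat w)).trace
      = ∑ a, ∑ b, (∑ e, r (sff w a e) * r (sff w e b)) ^ 2 := by
    rw [trace_mul_matrix]
    simp only [map_sum, map_mul, sffMat, Matrix.of_apply, Matrix.mul_apply]
    refine Finset.sum_congr rfl fun a _ => Finset.sum_congr rfl fun b _ => ?_
    rw [sq]
    congr 1
    exact Finset.sum_congr rfl fun e _ => by rw [hA.sff_symm b e, hA.sff_symm e a]; ring
  have tn : (hess D' (fun i j k => r (tconn w i j k)) (-H)).trace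
      = -(hess D' (fun i j k => r (tconn w i j k)) H).trace := by
    simp only [Matrix.trace, Matrix.diag_apply, hneg, Finset.sum_neg_distrib]
  have tm : ((sffMat w).map r * hess D' (fun i j k => r (tconn w i j k)) (-H)).trace
      = -∑ a, ∑ b, r (sff w a b) * hess D' (fun i j k => r (tconn w i j k)) H a b := by
    rw [trace_mul_matrix]
    simp only [hneg, hmap, mul_neg, Finset.sum_neg_distrib]
    simp only [neg_inj]
    exact Finset.sum_congr rfl fun a _ => Finset.sum_congr rfl fun b _ => by rw [hF.hess_symm H]
  rw [p3, tn] at t2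
  rw [p4, p3, tm] at u2
  rw [u2, p3, p2, tm] at t3
  rw [p2] at t1 t2
  -- The two geometric hypotheses on `k` are the Codazzi and Gauss equations with vanishing ambient
  -- curvature.
  refine threefold_identity hF (fun a b => congrArg r (hA.sff_symm a b)) ?_ ?_ hH hJ hk0 ?_
  · intro a b e
    have := hA.codazzi a b e
    rw [flat] at this
    rw [← h.cov2_sff, ← h.cov2_sff, sub_eq_zero.mp this.symm]
  · intro a b e l
    have := hA.gauss a b e l
    rw [flat] at this
    rw [← h.frameRiem_tan, ← map_mul, ← map_mul, ← map_sub]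
    congr 1
    linear_combination -this
  · simp only [mul_neg, Finset.sum_neg_distrib] at t3
    rw [yB, y3, y2, hy, rT, t3, t2, t1]
    ring

end ObstructionFour

/-! ### The obstruction in a conformal three-manifold. -/

section ObstructionThree

variable {A A' : Type*} [CommRing A] [Algebra ℝ A] [CommRing A'] [Algebra ℝ A']

/-- The consequences, on the zero set of `σ`, of the singular Yamabe equation in dimension three. -/
lemma yamabe_three_expansion (X : Derivation ℝ A A) (r : A →+* A') {σ v T J B : A} (hσ : X σ = 1)
    (rσ : r σ = 0) (rv : r v = 1)
    (hS : 3 * v ^ 2 - 2 * σ * (v * X v + v * T + J * σ) = 3 + 3 * σ ^ 3 * B) :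
    2 * r (X v) = r T ∧ r (X (X v)) = 3 * r (X v) ^ 2 + 2 * r (X T) + 2 * r J ∧
    -3 * r B = r (X (X v)) * r T + 2 * r (X v) * r (X T) + r (X (X T)) + 2 * r (X J) := by
  obtain ⟨Q, hQ⟩ : ∃ Q, Q = v * X v + v * T + J * σ := ⟨_, rfl⟩
  rw [← hQ] at hS
  have x2 : X 2 = 0 := by simpa using X.map_natCast 2
  have x3 : X 3 = 0 := by simpa using X.map_natCast 3
  have e0 : 3 * (v * v) = 3 + 2 * (σ * Q) + 3 * (σ * σ * σ * B) := by linear_combination hS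
  have e1 := congrArg X e0
  simp only [map_add, Derivation.leibniz, smul_eq_mul, x2, x3, hσ] at e1
  have e2 := congrArg X e1
  simp only [map_add, Derivation.leibniz, smul_eq_mul, x2, x3, hσ, map_zero,
    Derivation.map_one_eq_zero] at e2
  have e3 := congrArg X e2
  simp only [map_add, Derivation.leibniz, smul_eq_mul, x2, x3, hσ, map_zero,
    Derivation.map_one_eq_zero] at e3
  have q1 := congrArg X hQ
  simp only [map_add, Derivation.leibniz, smul_eq_mul, hσ] at q1
  have q2 := congrArg X q1
  simp only [map_add, Derivation.leibniz, smul_eq_mul, hσ, Derivation.map_one_eq_zero] at q2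
  replace hQ := congrArg r hQ
  replace q1 := congrArg r q1
  replace q2 := congrArg r q2
  replace e1 := congrArg r e1
  replace e2 := congrArg r e2
  replace e3 := congrArg r e3
  simp only [map_add, map_mul, rσ, rv, map_one, map_ofNat, mul_zero, zero_mul, add_zero,
    zero_add, mul_one, one_mul] at hQ q1 q2 e1 e2 e3
  have c1 : 2 * r (X v) = r T := by
    refine natCast_mul_cancel (k := 2) two_ne_zero ?_
    push_cast
    linear_combination e1 + 2 * hQ
  have c2 : r (X (X v)) = 3 * r (X v) ^ 2 + 2 * r (X T) + 2 * r J := by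
    refine natCast_mul_cancel (k := 2) two_ne_zero ?_
    push_cast
    linear_combination e2 + 4 * q1 - 4 * r (X v) * c1
  refine ⟨c1, c2, ?_⟩
  -- As in dimension four, the third derivative of `v²` cancels between the two sides. There remains
  -- −3 B = X²(vT + Jσ), in which `Jσ` contributes 2 XJ.
  refine natCast_mul_cancel (k := 6) (by norm_num) ?_
  push_cast
  linear_combination e3 + 6 * q2

/-- The differential Bianchi identity in a 3-dimensional frame. -/
lemma IsFrameConn.bianchi_three {D : Fin 3 → Derivation ℝ A A} {w : Fin 3 → Fin 3 → Fin 3 → A}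
    (h : IsFrameConn D w)
    (cyc : ∀ a b c d, frameRiem D w a b c d + frameRiem D w b c a d + frameRiem D w c a b d = 0) :
    D 0 (frameRiem D w 1 2 1 2) + D 1 (frameRiem D w 2 0 1 2) + D 2 (frameRiem D w 0 1 1 2)
      = ∑ f, (w 0 1 f - w 1 0 f) * frameRiem D w f 2 1 2
        + ∑ f, (w 1 2 f - w 2 1 f) * frameRiem D w f 0 1 2
        + ∑ f, (w 2 0 f - w 0 2 f) * frameRiem D w f 1 1 2
        + (w 0 1 0 * frameRiem D w 1 2 0 2 + w 0 2 0 * frameRiem D w 1 2 1 0)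
        + (w 1 1 0 * frameRiem D w 2 0 0 2 + w 1 2 0 * frameRiem D w 2 0 1 0)
        + (w 2 1 0 * frameRiem D w 0 1 0 2 + w 2 2 0 * frameRiem D w 0 1 1 0) := by
  have c0 := cyc 0 1 2 0
  have c1 := cyc 0 1 2 1
  have c2 := cyc 0 1 2 2
  have z := h.self_eq_zero
  have b0 := h.bracket 0 1 (w 2 1 2)
  have b1 := h.bracket 1 2 (w 0 1 2)
  have b2 := h.bracket 2 0 (w 1 1 2)
  simp only [frameRiem, Fin.sum_univ_three, map_add, map_sub, Derivation.leibniz, smul_eq_mul, z,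
    h.skew _ 1 0, h.skew _ 2 0, h.skew _ 2 1, map_neg, map_zero] at *
  -- The bracket relations cancel the second derivatives of the connection coefficients. The
  -- algebraic identities `c0`, `c1`, `c2` play the role of the Jacobi identity for the structure
  -- functions.
  linear_combination b0 + b1 + b2 - w 0 1 2 * c0 - w 1 1 2 * c1 - w 2 1 2 * c2

lemma hess_neg {n : ℕ} (D : Fin n → Derivation ℝ A A) (w : Fin n → Fin n → Fin n → A) (f : A) :
    hess D w (-f) = -hess D w f := by
  ext a b
  simp only [hess_apply, Matrix.neg_apply, map_neg, mul_neg, Finset.sum_neg_distrib]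
  ring

/-- Contraction commutes with ∇, so the double divergence can be computed as the divergence of the
covector of divergences. -/
lemma cov3_contract_two {D : Fin 2 → Derivation ℝ A A} {c : Fin 2 → Fin 2 → Fin 2 → A}
    (h : IsFrameConn D c) (S : Fin 2 → Fin 2 → Fin 2 → A) :
    ∑ a, ∑ b, cov3 D c S a b a b = ∑ a, cov1 D c (fun a => ∑ b, S b a b) a a := by
  simp only [cov3, cov1, Fin.sum_univ_two, map_add, h.self_eq_zero, h.skew _ 1 0]
  ring

/-- The ASC obstruction of a surface in a 3-manifold, in an adapted frame. -/
theorem IsRestriction.obstruction_three {D : Fin 3 → Derivation ℝ A A}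
    {w : Fin 3 → Fin 3 → Fin 3 → A} {σ v N : A}
    {D' : Fin 2 → Derivation ℝ A' A'} {r : A →+* A'}
    (h : IsRestriction (m := 2) D w σ v N D' r)
    (cyc : ∀ a b c d, frameRiem D w a b c d + frameRiem D w b c a d + frameRiem D w c a b d = 0)
    {B J : A} (hJ : 4 * J = ∑ a, ∑ c, frameRiem D w c a a c)
    (hS : 3 * v ^ 2 - 2 * σ * (D 0 v + v * ∑ i, sff w i i + J * σ) = 3 + 3 * σ ^ 3 * B)
    {c' : Fin 2 → Fin 2 → Fin 2 → A'} (hc' : ∀ i j k, r (tconn w i j k) = c' i j k)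
    (hF : IsFrameConn D' c') {k : Fin 2 → Fin 2 → A'} (hk : ∀ i j, r (sff w i j) = k i j)
    {H : A'} (hH : 2 * H = ∑ e, k e e)
    {k0 : Fin 2 → Fin 2 → A'} (hk0 : ∀ a b, k0 a b = k a b - scalarTensor H a b) :
    -3 * r B = ∑ a, ∑ b, cov3 D' c' (cov2 D' c' k0) a b a b + H * ∑ a, ∑ b, k0 a b * k0 a b
      + ∑ a, ∑ b, r (∑ e, frameRiem D w e a.succ b.succ e - scalarTensor J a.succ b.succ)
        * k0 a b := by
  have hA := h.toIsAdapted
  obtain rfl : (fun i j k => r (tconn w i j k)) = c' := by ext i j k; exact hc' i j k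
  obtain rfl : (fun i j => r (sff w i j)) = k := by ext i j; exact hk i j
  obtain rfl : k0 = fun a b => r (sff w a b) - scalarTensor H a b := by ext a b; exact hk0 a b
  have hD0 : D 0 v = v * flowD N D v := by
    rw [flowD_apply]; linear_combination -(D 0 v * hA.inv)
  rw [hD0] at hS
  obtain ⟨y1, y2, yB⟩ := yamabe_three_expansion (flowD N D) r hA.flow_sigma h.sigma h.speed hS
  have skl := frameRiem_skew_left D w
  have skr := hA.toIsFrameConn.frameRiem_skew_right
  have skl0 : ∀ a c d, frameRiem D w a a c d = 0 := fun a c d =>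
    natCast_mul_cancel (k := 2) two_ne_zero (by push_cast; linear_combination skl a a c d)
  have skr0 : ∀ a b c, frameRiem D w a b c c = 0 := fun a b c =>
    natCast_mul_cancel (k := 2) two_ne_zero (by push_cast; linear_combination skr a b c c)
  -- The pair symmetry of the Riemann tensor, derived for the three component pairs needed from
  -- skewness and the cyclic identity.
  have p1 : frameRiem D w 1 2 0 1 = frameRiem D w 0 1 1 2 := by
    linear_combination cyc 1 2 0 1 - skr0 2 0 1 - skr 0 1 2 1
  have p2 : frameRiem D w 1 2 0 2 = frameRiem D w 0 2 1 2 := by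
    linear_combination cyc 1 2 0 2 - skr0 0 1 2 - skl 2 0 1 2
  have p3 : frameRiem D w 0 2 0 1 = frameRiem D w 0 1 0 2 := by
    linear_combination cyc 0 1 2 0 - skr0 1 2 0 - skr 0 1 2 0 - skl 2 0 1 0 + skr 0 2 1 0
  -- Here `4J = Sc`, and `Sc` is minus twice the sum of R₀₁₀₁, R₀₂₀₂ and R₁₂₁₂. The first two form
  -- the trace of `radialRiem`.
  have h2J : 2 * J = -(radialRiem D w).trace - frameRiem D w 1 2 1 2 := by
    refine natCast_mul_cancel (k := 2) two_ne_zero ?_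
    simp only [Fin.sum_univ_three, skl0, Matrix.trace, Matrix.diag_apply, Fin.sum_univ_two,
      radialRiem, Matrix.of_apply, Fin.succ_zero_eq_one, Fin.succ_one_eq_two] at hJ ⊢
    push_cast
    linear_combination hJ + skl 1 0 0 1 + skl 2 0 0 2 + skr 0 1 1 0 + skl 2 1 1 2 + skr 0 2 2 0
      + skr 1 2 2 1
  have f1 := hA.flow_trace
  have f2 := hA.flow_trace_sq
  have hT' : (sffMat w).trace = ∑ i, sff w i i := rfl
  rw [hT'] at f1
  have g1 := h.flow_mul_hess_lapse
  have g2 := h.flow_lap_lapse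
  have bi := congrArg r (hA.toIsFrameConn.bianchi_three cyc)
  -- The acceleration of the normal is −∇N up to a factor, so it vanishes on the hypersurface. This
  -- removes its terms from the Bianchi identity.
  have acc : ∀ i : Fin 2, r (w 0 0 i.succ) = 0 := by
    intro i
    have := congrArg r (hA.mul_accel i)
    rw [map_mul, h.lapse, one_mul] at this
    rw [this, map_neg]
    exact (congrArg Neg.neg (h.tan_lapse i)).trans neg_zero
  have acc1 : r (w 0 0 1) = 0 := acc 0
  have acc2 : r (w 0 0 2) = 0 := acc 1
  have rt : r (flowD N D (frameRiem D w 1 2 1 2)) = r (D 0 (frameRiem D w 1 2 1 2)) := by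
    rw [flowD_apply, map_mul, h.lapse, one_mul]
  -- In X²T + 2 XJ the normal derivative of the radial trace cancels. Only e₀R₁₂₁₂ remains, and the
  -- Bianchi identity `bi` converts it into tangential derivatives.
  have hXJ : 2 * r (flowD N D J) = -r (flowD N D (radialRiem D w).trace)
      - r (D 0 (frameRiem D w 1 2 1 2)) := by
    have x2 : flowD N D 2 = 0 := by simpa using (flowD N D).map_natCast 2
    have := congrArg r (congrArg (flowD N D) h2J)
    simp only [Derivation.leibniz, smul_eq_mul, x2, map_sub, map_neg, rt, map_mul, map_ofNat,
      mul_zero, add_zero] at this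
    exact this
  set X := flowD N D with hX
  have rT : r (∑ i, sff w i i) = 2 * H := by rw [hH, map_sum]
  have hy : r (X v) = H := by
    refine natCast_mul_cancel (k := 2) two_ne_zero ?_
    push_cast
    rw [y1, rT]
  have n1 : r (X N) = -H := by rw [h.flow_lapse, hy]
  have t1 : r (X (∑ i, sff w i i)) = -r (sffMat w * sffMat w).trace + r (radialRiem D w).trace := by
    rw [f1, map_add, map_sub, map_neg, h.lap_lapse, map_mul, map_mul, h.lapse]; ring
  have u1 : r (X (sffMat w * sffMat w).trace) = -2 * r (sffMat w * sffMat w * sffMat w).trace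
      + 2 * r (sffMat w * radialRiem D w).trace := by
    rw [f2, map_add, map_sub, map_neg, map_mul, map_mul, map_mul, map_mul, map_mul,
      h.mul_hess_lapse, h.lapse, map_ofNat]
    ring
  have t2 := congrArg r (congrArg X f1)
  simp only [map_sub, map_neg, map_mul, g2, Derivation.leibniz, smul_eq_mul, map_add, h.lapse, n1,
    u1, one_mul] at t2
  have tn : (hess D' (fun i j k => r (tconn w i j k)) (-H)).trace
      = -(hess D' (fun i j k => r (tconn w i j k)) H).trace := by
    rw [hess_neg, Matrix.trace_neg]
  rw [tn] at t2
  have hcod : ∀ j, cov2 D' (fun i j k => r (tconn w i j k)) (fun i j => r (sff w i j)) 0 1 j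
      - cov2 D' (fun i j k => r (tconn w i j k)) (fun i j => r (sff w i j)) 1 0 j
      = r (frameRiem D w 1 2 0 j.succ) := by
    intro j
    rw [← h.cov2_sff, ← h.cov2_sff, ← map_sub]
    exact congrArg r (hA.codazzi 0 1 j).symm
  have hcod0 := hcod 0
  have hcod1 := hcod 1
  rw [Fin.succ_zero_eq_one, p1] at hcod0
  rw [Fin.succ_one_eq_two, p2] at hcod1
  have dH : ∀ e, ∑ a, cov2 D' (fun i j k => r (tconn w i j k)) (fun i j => r (sff w i j)) e a a
      = 2 * D' e H := by
    intro e
    rw [cov2_trace hF, ← hH, two_mul, map_add, two_mul]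
  have ec2 : cov2 D' (fun i j k => r (tconn w i j k)) (fun i j => r (sff w i j) - scalarTensor H i j)
      = fun e a b => cov2 D' (fun i j k => r (tconn w i j k)) (fun i j => r (sff w i j)) e a b
        - scalarTensor (D' e H) a b := by
    ext e a b; exact cov2_sub_scalar hF _ H e a b
  -- By Codazzi the divergence of the trace-free part is `dH` plus ambient curvature. The divergence
  -- of this curvature part is what the Bianchi identity produced.
  have hV : (fun a => ∑ b, cov2 D' (fun i j k => r (tconn w i j k))
      (fun i j => r (sff w i j) - scalarTensor H i j) b a b)
      = ![D' 0 H - r (frameRiem D w 0 2 1 2), D' 1 H + r (frameRiem D w 0 1 1 2)] := by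
    have h0 := dH 0
    have h1 := dH 1
    simp only [ec2]
    simp only [Fin.sum_univ_two, scalarTensor] at h0 h1 ⊢
    ext a
    fin_cases a
    · simp
      linear_combination h0 - hcod1
    · simp
      linear_combination h1 + hcod0
  rw [cov3_contract_two hF, hV]
  have tan0 : ∀ f, r (D 1 f) = D' 0 (r f) := h.tan 0
  have tan1 : ∀ f, r (D 2 f) = D' 1 (r f) := h.tan 1
  have skn := hA.skew
  have z := hA.toIsFrameConn.self_eq_zero
  have ks : sff w 1 0 = sff w 0 1 := hA.sff_symm 1 0
  have e00 : w 1 0 1 = sff w 0 0 := rfl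
  have e01 : w 1 0 2 = sff w 0 1 := rfl
  have e10 : w 2 0 1 = sff w 1 0 := rfl
  have e11 : w 2 0 2 = sff w 1 1 := rfl
  have c0 : w 1 1 2 = tconn w 0 0 1 := rfl
  have c1 : w 2 1 2 = tconn w 1 0 1 := rfl
  have ct : ∀ i, tconn w i 1 0 = -tconn w i 0 1 := fun i => hA.tconn_skew i 1 0
  have ct0 : ∀ i j, tconn w i j j = 0 := fun i j => z _ _
  simp only [Fin.sum_univ_three, map_add, map_sub, map_mul, map_neg, tan0, tan1, skl 2 0, skl 1 0,
    skl 2 1, skl0, skr _ _ 1 0, skn _ 1 0, skn _ 2 0, skn _ 2 1, z, acc1, acc2, e00, e01, e10, e11,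
    c0, c1, ks, p1, p2, p3, map_zero] at bi
  rw [trace_mul_matrix, trace_mul_matrix] at t2
  rw [trace_mul_matrix] at t1
  have rJ := congrArg r h2J
  rw [← sub_eq_zero]
  refine natCast_mul_cancel (k := 2) two_ne_zero ?_
  simp only [Fin.sum_univ_two, Fin.sum_univ_three, Matrix.trace, Matrix.diag_apply, radialRiem,
    sffMat, Matrix.of_apply, Matrix.mul_apply, Fin.succ_zero_eq_one, Fin.succ_one_eq_two, map_add,
    map_sub, map_mul, map_neg, map_ofNat, ks, p3, hess_apply, cov1, scalarTensor, Fin.isValue,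
    Fin.reduceEq, if_true, if_false, Matrix.cons_val_zero, Matrix.cons_val_one, ct, ct0, skl0,
    skl 2 1, skr0, skr _ _ 1 0, skr _ _ 2 0, skr _ _ 2 1, map_zero]
    at t1 t2 hH rJ hXJ y2 yB rT ⊢
  obtain hk11 : r (sff w 1 1) = 2 * H - r (sff w 0 0) := by linear_combination -hH
  rw [hy] at y2 yB
  rw [hk11] at t1 t2 yB bi ⊢
  push_cast
  linear_combination 2 * yB + 4 * H * y2 + 12 * H * t1 + 2 * t2 + 2 * hXJ - 2 * bi + 4 * H * rJ

/-- In a flat scale the obstruction of a surface is a multiple of the Willmore invariant. -/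
theorem IsRestriction.obstruction_three_flat {D : Fin 3 → Derivation ℝ A A}
    {w : Fin 3 → Fin 3 → Fin 3 → A} {σ v N : A}
    {D' : Fin 2 → Derivation ℝ A' A'} {r : A →+* A'}
    (h : IsRestriction (m := 2) D w σ v N D' r) (flat : ∀ a b c d, frameRiem D w a b c d = 0)
    {B : A} (hS : 3 * v ^ 2 - 2 * σ * (D 0 v + v * ∑ i, sff w i i) = 3 + 3 * σ ^ 3 * B)
    {c' : Fin 2 → Fin 2 → Fin 2 → A'} (hc' : ∀ i j k, r (tconn w i j k) = c' i j k)
    (hF : IsFrameConn D' c') {H K : A'} (hH : 2 * H = ∑ e, r (sff w e e))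
    (hK : 2 * K = ∑ a, ∑ e, frameRiem D' c' e a a e) :
    -3 * r B = (hess D' c' H).trace + 2 * H * (H ^ 2 - K) := by
  have hA := h.toIsAdapted
  rw [h.obstruction_three (J := 0) (by simp [flat]) (by simp [flat]) (by rw [← hS]; ring) hc' hF
    (fun _ _ => rfl) hH (fun _ _ => rfl)]
  obtain rfl : (fun i j k => r (tconn w i j k)) = c' := by ext i j k; exact hc' i j k
  set k : Fin 2 → Fin 2 → A' := fun i j => r (sff w i j) with hk
  have codazzi : ∀ a b e, cov2 D' (fun i j k => r (tconn w i j k)) k a b e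
      = cov2 D' (fun i j k => r (tconn w i j k)) k b a e := by
    intro a b e
    have := hA.codazzi a b e
    rw [flat] at this
    rw [hk, ← h.cov2_sff, ← h.cov2_sff, sub_eq_zero.mp this.symm]
  have gauss : ∀ a b e l, frameRiem D' (fun i j k => r (tconn w i j k)) a b e l
      = k b e * k a l - k a e * k b l := by
    intro a b e l
    have := hA.gauss a b e l
    rw [flat] at this
    rw [hk, ← h.frameRiem_tan, ← map_mul, ← map_mul, ← map_sub]
    congr 1
    linear_combination -this
  -- In a flat metric the divergence of the trace-free part is `dH`, so its double divergence is the
  -- Laplacian of `H`.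
  have hV : (fun a => ∑ b, cov2 D' (fun i j k => r (tconn w i j k))
      (fun i j => k i j - scalarTensor H i j) b a b) = fun a => D' a H := by
    ext a
    simp only [cov2_sub_scalar hF, Finset.sum_sub_distrib]
    rw [Finset.sum_congr rfl fun b _ => codazzi b a b, cov2_trace hF, ← hH]
    simp only [two_mul, map_add, scalarTensor, Finset.sum_ite_eq, Finset.mem_univ, if_true]
    ring
  rw [cov3_contract_two hF, hV]
  simp only [gauss] at hK
  have ks : r (sff w 1 0) = r (sff w 0 1) := congrArg r (hA.sff_symm 1 0)
  refine natCast_mul_cancel (k := 2) two_ne_zero ?_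
  simp only [flat, Finset.sum_const_zero, scalarTensor, ite_self, sub_zero, map_zero, zero_mul,
    add_zero, Matrix.trace, Matrix.diag_apply, hess_apply, cov1]
  simp only [hk, Fin.sum_univ_two, Fin.isValue, Fin.reduceEq, if_true, if_false, ks] at hK hH ⊢
  have hk11 : r (sff w 1 1) = 2 * H - r (sff w 0 0) := by linear_combination -hH
  rw [hk11] at hK ⊢
  push_cast
  -- By Gauss `K` is the determinant of `II`, so the squared length of the trace-free part is 2(H² −
  -- K).
  linear_combination 2 * H * hK

end ObstructionThree

/-! ### Algebras of smooth functions -/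

section SmoothFunctions

open TopologicalSpace

variable {n : ℕ}

/-- The extension by zero of a function on `W`. -/
def ext0 {W : Opens (E n)} (f : W → ℝ) : E n → ℝ := Function.extend Subtype.val f 0

lemma ext0_apply {W : Opens (E n)} (f : W → ℝ) (x : W) : ext0 f x = f x :=
  Subtype.val_injective.extend_apply f 0 x

/-- The algebra of smooth functions on the open set `W`. -/
def SmoothAlg (W : Opens (E n)) : Subalgebra ℝ (W → ℝ) where
  carrier := {f | ContDiffOn ℝ ∞ (ext0 f) W}
  mul_mem' {f g} hf hg := (hf.mul hg).congr fun x hx => by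
    have h := fun f : W → ℝ => ext0_apply f ⟨x, hx⟩
    simp only at h
    simp only [Pi.mul_apply, h]
  add_mem' {f g} hf hg := (hf.add hg).congr fun x hx => by
    have h := fun f : W → ℝ => ext0_apply f ⟨x, hx⟩
    simp only at h
    simp only [Pi.add_apply, h]
  algebraMap_mem' c := contDiffOn_const.congr fun x hx => by
    have h := fun f : W → ℝ => ext0_apply f ⟨x, hx⟩
    simp only at h
    rw [h]
    rfl

/-- `F`, as an element of the algebra of smooth functions on `W`, is the restriction of `f`. -/
def Agrees {W : Opens (E n)} (f : E n → ℝ) (F : SmoothAlg W) : Prop := ∀ x : W, f x = F.1 x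

/-- A smooth function on `W` as an element of the algebra. -/
def mkSmooth {W : Opens (E n)} (f : E n → ℝ) (hf : ContDiffOn ℝ ∞ f W) : SmoothAlg W :=
  ⟨fun x => f x, hf.congr fun x hx => ext0_apply (fun x : W => f x) ⟨x, hx⟩⟩

lemma agrees_mkSmooth {W : Opens (E n)} (f : E n → ℝ) (hf : ContDiffOn ℝ ∞ f W) :
    Agrees f (mkSmooth f hf) := fun _ => rfl

variable {W : Opens (E n)}

lemma agrees_ext0 (F : SmoothAlg W) : Agrees (ext0 F.1) F := fun x => ext0_apply F.1 x

lemma SmoothAlg.ext_apply {F G : SmoothAlg W} (h : ∀ x, F.1 x = G.1 x) : F = G :=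
  Subtype.ext (funext h)

lemma Agrees.contDiffOn {f : E n → ℝ} {F : SmoothAlg W} (h : Agrees f F) : ContDiffOn ℝ ∞ f W :=
  F.2.congr fun x hx => (h ⟨x, hx⟩).trans (agrees_ext0 F ⟨x, hx⟩).symm

lemma Agrees.eventuallyEq {f g : E n → ℝ} {F : SmoothAlg W} (hf : Agrees f F) (hg : Agrees g F)
    (x : W) : f =ᶠ[nhds x.1] g := by
  filter_upwards [W.isOpen.mem_nhds x.2] with y hy
  rw [hf ⟨y, hy⟩, hg ⟨y, hy⟩]

lemma pd_congr {f g : E n → ℝ} {x : E n} (h : f =ᶠ[nhds x] g) (i : Fin n) : pd i f x = pd i g x := by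
  rw [pd, pd, h.fderiv_eq]

lemma pd_contDiffOn {f : E n → ℝ} (hf : ContDiffOn ℝ ∞ f W) (i : Fin n) :
    ContDiffOn ℝ ∞ (pd i f) W :=
  (hf.fderiv_of_isOpen W.isOpen (by simp)).clm_apply contDiffOn_const

lemma Agrees.differentiableAt {f : E n → ℝ} {F : SmoothAlg W} (h : Agrees f F) (x : W) :
    DifferentiableAt ℝ f x.1 :=
  (h.contDiffOn.contDiffAt (W.isOpen.mem_nhds x.2)).differentiableAt (by simp)

lemma Agrees.add {f g : E n → ℝ} {F G : SmoothAlg W} (hf : Agrees f F) (hg : Agrees g G) :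
    Agrees (fun x => f x + g x) (F + G) := fun x => congrArg₂ (· + ·) (hf x) (hg x)

lemma Agrees.sub {f g : E n → ℝ} {F G : SmoothAlg W} (hf : Agrees f F) (hg : Agrees g G) :
    Agrees (fun x => f x - g x) (F - G) := fun x => congrArg₂ (· - ·) (hf x) (hg x)

lemma Agrees.mul {f g : E n → ℝ} {F G : SmoothAlg W} (hf : Agrees f F) (hg : Agrees g G) :
    Agrees (fun x => f x * g x) (F * G) := fun x => congrArg₂ (· * ·) (hf x) (hg x)

lemma Agrees.sum {ι : Type*} {s : Finset ι} {f : ι → E n → ℝ} {F : ι → SmoothAlg W}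
    (hf : ∀ i, Agrees (f i) (F i)) : Agrees (fun x => ∑ i ∈ s, f i x) (∑ i ∈ s, F i) := by
  classical
  intro x
  induction s using Finset.induction_on with
  | empty => simp
  | insert a s ha ih => 
    simp only [Finset.sum_insert ha] at ih ⊢
    exact congrArg₂ (· + ·) (hf a x) ih

/-- The partial derivatives of the algebra of smooth functions. -/
def pdAlg (W : Opens (E n)) (i : Fin n) : Derivation ℝ (SmoothAlg W) (SmoothAlg W) :=
  Derivation.mk'
    { toFun := fun F => mkSmooth (pd i (ext0 F.1)) (pd_contDiffOn F.2 i)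
      map_add' := fun F G => SmoothAlg.ext_apply fun x => by
        change pd i (ext0 (F + G).1) x = pd i (ext0 F.1) x + pd i (ext0 G.1) x
        rw [pd_congr ((agrees_ext0 (F + G)).eventuallyEq
          ((agrees_ext0 F).add (agrees_ext0 G)) x), pd,
          fderiv_fun_add ((agrees_ext0 F).differentiableAt x) ((agrees_ext0 G).differentiableAt x)]
        rfl
      map_smul' := fun c F => SmoothAlg.ext_apply fun x => by
        change pd i (ext0 (c • F).1) x = c * pd i (ext0 F.1) x
        have h : Agrees (fun x => c * ext0 F.1 x) (c • F) :=
          fun x => congrArg (c * ·) (agrees_ext0 F x)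
        rw [pd_congr ((agrees_ext0 (c • F)).eventuallyEq h x), pd,
          fderiv_const_mul ((agrees_ext0 F).differentiableAt x)]
        rfl }
    fun F G => SmoothAlg.ext_apply fun x => by
      change pd i (ext0 (F * G).1) x = F.1 x * pd i (ext0 G.1) x + G.1 x * pd i (ext0 F.1) x
      rw [pd_congr ((agrees_ext0 (F * G)).eventuallyEq
        ((agrees_ext0 F).mul (agrees_ext0 G)) x), pd,
        fderiv_fun_mul ((agrees_ext0 F).differentiableAt x) ((agrees_ext0 G).differentiableAt x),
        agrees_ext0 F x, agrees_ext0 G x]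
      rfl

lemma Agrees.pd {f : E n → ℝ} {F : SmoothAlg W} (hf : Agrees f F) (i : Fin n) :
    Agrees (pd i f) (pdAlg W i F) := fun x =>
  pd_congr (hf.eventuallyEq (agrees_ext0 F) x) i

lemma pdAlg_comm (i j : Fin n) (F : SmoothAlg W) :
    pdAlg W i (pdAlg W j F) = pdAlg W j (pdAlg W i F) := by
  refine SmoothAlg.ext_apply fun x => ?_
  have hF := agrees_ext0 F
  rw [← (hF.pd j).pd i x, ← (hF.pd i).pd j x]
  set f := ext0 F.1
  have hc : ContDiffAt ℝ ∞ f x.1 := hF.contDiffOn.contDiffAt (W.isOpen.mem_nhds x.2)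
  have hd : DifferentiableAt ℝ (fderiv ℝ f) x.1 :=
    (hc.fderiv_right (m := ∞) (by simp)).differentiableAt (by simp)
  have h2 : ∀ i j : Fin n, ConfHyp.pd i (ConfHyp.pd j f) x.1
      = fderiv ℝ (fderiv ℝ f) x.1 (EuclideanSpace.single i 1) (EuclideanSpace.single j 1) := by
    intro i j
    change fderiv ℝ (fun y => fderiv ℝ f y (EuclideanSpace.single j 1)) x.1 _ = _
    rw [fderiv_clm_apply hd (differentiableAt_const _)]
    simp
  rw [h2, h2]
  exact (hc.isSymmSndFDerivAt
    (by rw [minSmoothness_of_isRCLikeNormedField]; exact WithTop.coe_le_coe.2 le_top)).eq _ _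

/-- A smooth function without zeros is invertible. -/
lemma exists_smooth_inv (F : SmoothAlg W) (hF : ∀ x, F.1 x ≠ 0) : ∃ G : SmoothAlg W, G * F = 1 := by
  have h := agrees_ext0 F
  refine ⟨mkSmooth (fun x => (ext0 F.1 x)⁻¹) (h.contDiffOn.inv fun x hx => ?_), ?_⟩
  · rw [h ⟨x, hx⟩]; exact hF _
  · refine SmoothAlg.ext_apply fun x => ?_
    change (ext0 F.1 x)⁻¹ * F.1 x = 1
    rw [h x, inv_mul_cancel₀ (hF x)]

/-- A smooth positive function has a smooth square root. -/
lemma exists_smooth_sqrt (F : SmoothAlg W) (hF : ∀ x, 0 < F.1 x) :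
    ∃ G : SmoothAlg W, (∀ x, G.1 x = √(F.1 x)) ∧ G * G = F := by
  have h := agrees_ext0 F
  have hs : ∀ x : W, √(ext0 F.1 x) = √(F.1 x) := fun x => by rw [h x]
  refine ⟨mkSmooth (fun x => √(ext0 F.1 x)) (h.contDiffOn.sqrt fun x hx => ?_), hs, ?_⟩
  · rw [h ⟨x, hx⟩]; exact (hF _).ne'
  · refine SmoothAlg.ext_apply fun x => ?_
    change √(ext0 F.1 x) * √(ext0 F.1 x) = F.1 x
    rw [hs, Real.mul_self_sqrt (hF x).le]

end SmoothFunctions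

/-! ### Restriction of smooth functions to the slice `x₀ = 0`. -/

section Slicing

open TopologicalSpace

variable {m : ℕ}

/-- The inclusion of the hypersurface as a continuous linear map. -/
def inclL (m : ℕ) : E m →L[ℝ] E (m + 1) :=
  LinearMap.toContinuousLinearMap
    { toFun := incl
      map_add' := fun x y => by
        ext i; refine Fin.cases ?_ (fun j => ?_) i <;> simp [incl]
      map_smul' := fun c x => by
        ext i; refine Fin.cases ?_ (fun j => ?_) i <;> simp [incl] }

lemma inclL_apply (y : E m) : inclL m y = incl y := rfl

lemma incl_zero (y : E m) : incl y 0 = 0 := rfl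

lemma incl_single (i : Fin m) :
    incl (EuclideanSpace.single i (1 : ℝ)) = EuclideanSpace.single i.succ (1 : ℝ) := by
  ext j
  refine Fin.cases ?_ (fun j => ?_) j
  · simp [incl]
  · simp [incl]

lemma incl_tang {x : E (m + 1)} (hx : x 0 = 0) : incl (tang x) = x := by
  ext j
  refine Fin.cases ?_ (fun j => ?_) j
  · simp [incl, hx]
  · simp [incl, tang]

/-- The part of the hypersurface in an open set. -/
def sliceOpen (W : Opens (E (m + 1))) : Opens (E m) :=
  ⟨incl ⁻¹' W, W.isOpen.preimage (inclL m).continuous⟩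

variable {W : Opens (E (m + 1))}

lemma pd_incl {f : E (m + 1) → ℝ} {y : E m} (hf : DifferentiableAt ℝ f (incl y)) (i : Fin m) :
    pd i (fun y => f (incl y)) y = pd i.succ f (incl y) := by
  have h := fderiv_comp y (g := f) (f := inclL m) hf (inclL m).differentiableAt
  rw [ContinuousLinearMap.fderiv] at h
  change fderiv ℝ (f ∘ inclL m) y _ = _
  rw [h]
  simp only [pd, ContinuousLinearMap.comp_apply, inclL_apply, incl_single]

/-- Restriction of smooth functions to the hypersurface. -/
def sliceHom (W : Opens (E (m + 1))) : SmoothAlg W →+* SmoothAlg (sliceOpen W) where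
  toFun F := mkSmooth (fun y => ext0 F.1 (incl y))
    (F.2.comp (inclL m).contDiff.contDiffOn fun _ hy => hy)
  map_one' := SmoothAlg.ext_apply fun x => ext0_apply (1 : W → ℝ) ⟨incl x, x.2⟩
  map_zero' := SmoothAlg.ext_apply fun x => ext0_apply (0 : W → ℝ) ⟨incl x, x.2⟩
  map_mul' F G := SmoothAlg.ext_apply fun x => by
    change ext0 (F * G).1 (incl x) = ext0 F.1 (incl x) * ext0 G.1 (incl x)
    have h := fun f : W → ℝ => ext0_apply f ⟨incl x, x.2⟩
    simp only at h
    rw [h, h, h]; rfl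
  map_add' F G := SmoothAlg.ext_apply fun x => by
    change ext0 (F + G).1 (incl x) = ext0 F.1 (incl x) + ext0 G.1 (incl x)
    have h := fun f : W → ℝ => ext0_apply f ⟨incl x, x.2⟩
    simp only at h
    rw [h, h, h]; rfl

lemma sliceHom_apply (F : SmoothAlg W) (y : sliceOpen W) :
    (sliceHom W F).1 y = F.1 ⟨incl y, y.2⟩ := ext0_apply F.1 ⟨incl y, y.2⟩

lemma Agrees.slice {f : E (m + 1) → ℝ} {F : SmoothAlg W} (hf : Agrees f F) :
    Agrees (fun y => f (incl y)) (sliceHom W F) := fun y => by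
  rw [sliceHom_apply]; exact hf ⟨incl y, y.2⟩

lemma sliceHom_pd (i : Fin m) (F : SmoothAlg W) :
    sliceHom W (pdAlg W i.succ F) = pdAlg (sliceOpen W) i (sliceHom W F) := by
  refine SmoothAlg.ext_apply fun y => ?_
  have hF := agrees_ext0 F
  rw [← (hF.pd i.succ).slice y, ← (hF.slice).pd i y,
    pd_incl (hF.differentiableAt ⟨incl y, y.2⟩)]

end Slicing

/-! ### Contractions in an orthonormal frame -/

section Contractions

variable {A : Type*} [CommRing A] {n : ℕ} (F : Matrix (Fin n) (Fin n) A)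

/-- The inverse metric in terms of an orthonormal frame. -/
def frameInv (i j : Fin n) : A := ∑ a, F a i * F a j

lemma frameInv_symm (i j : Fin n) : frameInv F i j = frameInv F j i :=
  Finset.sum_congr rfl fun _ _ => mul_comm _ _

variable [Algebra ℝ A]

lemma contract_two (T : Fin n → Fin n → A) :
    ∑ i, ∑ j, frameInv F i j * T i j = ∑ a, fr2 F T a a := contract_eq F T

lemma contract_inner (T S : Fin n → Fin n → A) :
    ∑ a, ∑ b, T a b * ∑ c, ∑ d, frameInv F a c * frameInv F b d * S c d
      = ∑ a, ∑ b, fr2 F T a b * fr2 F S a b := by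
  have h1 : ∀ a c, ∑ b, ∑ d, frameInv F b d * (T a b * S c d)
      = ∑ b, fr1 F (T a) b * fr1 F (S c) b := by
    intro a c
    rw [contract_two]
    simp only [fr2, fr1_mul_left, fr1_mul_right]
  calc _ = ∑ a, ∑ c, frameInv F a c * ∑ b, ∑ d, frameInv F b d * (T a b * S c d) := by
        simp only [Finset.mul_sum]
        refine Finset.sum_congr rfl fun a _ => ?_
        rw [Finset.sum_comm]
        refine Finset.sum_congr rfl fun c _ => Finset.sum_congr rfl fun b _ =>
          Finset.sum_congr rfl fun d _ => by ring
    _ = _ := by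
        simp only [h1]
        rw [contract_two]
        simp only [fr2, fr1_sum, fr1_mul_left, fr1_mul_right]

lemma contract_four (S : Fin n → Fin n → Fin n → Fin n → A) :
    ∑ a, ∑ b, ∑ c, ∑ d, frameInv F a c * frameInv F b d * S a b c d
      = ∑ a, ∑ b, fr4 F S a b a b := by
  calc _ = ∑ a, ∑ c, frameInv F a c * ∑ b, ∑ d, frameInv F b d * S a b c d := by
        simp only [Finset.mul_sum]
        refine Finset.sum_congr rfl fun a _ => ?_
        rw [Finset.sum_comm]
        refine Finset.sum_congr rfl fun c _ => Finset.sum_congr rfl fun b _ =>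
          Finset.sum_congr rfl fun d _ => by ring
    _ = _ := by
        simp only [contract_two]
        simp only [fr4, fr3, fr2, fr1_sum]
        refine Finset.sum_congr rfl fun a _ => Finset.sum_congr rfl fun b _ => ?_
        congr 1
        ext i
        exact fr1_comm F _ a b

lemma contract_normSq (S : Fin n → Fin n → Fin n → A) :
    ∑ c, ∑ c', frameInv F c c' *
        ∑ a, ∑ b, S c a b * ∑ d, ∑ e, frameInv F a d * frameInv F b e * S c' d e
      = ∑ c, ∑ a, ∑ b, fr3 F S c a b ^ 2 := by
  simp only [contract_inner, contract_two]
  simp only [fr3, fr2, fr1_sum, fr1_mul_left, fr1_mul_right, sq]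

lemma fr2_contract (S : Fin n → Fin n → Fin n → Fin n → A) (a b : Fin n) :
    fr2 F (fun a b => ∑ c, ∑ d, frameInv F c d * S c d a b) a b = ∑ e, fr4 F S e e a b := by
  simp only [contract_two]
  simp only [fr4, fr3, fr2, fr1_sum]
  refine Finset.sum_congr rfl fun e _ => ?_
  calc fr1 F (fun i => fr1 F (fun j => fr1 F (fun k => fr1 F (fun l => S k l i j) e) e) b) a
      = fr1 F (fun i => fr1 F (fun k => fr1 F (fun j => fr1 F (fun l => S k l i j) e) b) e) a := by
        congr 1; ext i; exact fr1_comm F _ b e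
    _ = fr1 F (fun i => fr1 F (fun k => fr1 F (fun l => fr1 F (fun j => S k l i j) b) e) e) a := by
        congr 1; ext i; congr 1; ext k; exact fr1_comm F _ b e
    _ = fr1 F (fun k => fr1 F (fun i => fr1 F (fun l => fr1 F (fun j => S k l i j) b) e) a) e :=
        fr1_comm F _ a e
    _ = _ := by
        congr 1; ext i; exact fr1_comm F _ a e

lemma fr1_contract (S : Fin n → Fin n → Fin n → A) (a : Fin n) :
    fr1 F (fun a => ∑ b, ∑ c, frameInv F b c * S c a b) a = ∑ b, fr3 F S b a b := by
  have h : ∀ a, ∑ b, ∑ c, frameInv F b c * S c a b = ∑ b, fr2 F (fun c b => S c a b) b b := by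
    intro a
    rw [Finset.sum_comm, ← contract_two]
    exact Finset.sum_congr rfl fun _ _ => Finset.sum_congr rfl fun _ _ => by
      rw [frameInv_symm]
  simp only [h]
  simp only [fr3, fr2, fr1_sum]
  refine Finset.sum_congr rfl fun b _ => ?_
  exact fr1_comm F _ a b

lemma contract_sq (θ : Fin n → A) :
    ∑ a, ∑ b, frameInv F a b * θ a * θ b = ∑ a, fr1 F θ a ^ 2 := by
  simp only [mul_assoc]
  rw [contract_two]
  simp only [fr2, fr1_mul_left, fr1_mul_right, sq]

end Contractions

/-! ### Coordinate expressions as elements of the algebra of smooth functions -/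

section Coordinates

open TopologicalSpace

variable {n : ℕ} {W : Opens (E n)}

/-- Evaluation at a point. -/
def evalAt (x : W) : SmoothAlg W →+* ℝ :=
  (Pi.evalRingHom (fun _ : W => ℝ) x).comp (SmoothAlg W).val.toRingHom

lemma evalAt_apply (x : W) (F : SmoothAlg W) : evalAt x F = F.1 x := rfl

lemma agrees_const (c : ℝ) : Agrees (fun _ => c) (algebraMap ℝ (SmoothAlg W) c) := fun _ => rfl

lemma algebraMap_mul_cast {A : Type*} [CommRing A] [Algebra ℝ A] {k : ℕ} (hk : k ≠ 0) :
    (k : A) * algebraMap ℝ A (1 / k) = 1 := by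
  rw [← map_natCast (algebraMap ℝ A) k, ← map_mul, mul_one_div_cancel (Nat.cast_ne_zero.mpr hk),
    map_one]

/-- The Christoffel symbols of a metric with orthonormal frame `F`. -/
def christoffelAlg (GA F : Matrix (Fin n) (Fin n) (SmoothAlg W)) (i : Fin n) :
    Matrix (Fin n) (Fin n) (SmoothAlg W) :=
  Matrix.of fun k j => ∑ l, algebraMap ℝ _ (1 / 2) * frameInv F k l *
    (pdAlg W i (GA j l) + pdAlg W j (GA i l) - pdAlg W l (GA i j))

/-- A metric in coordinates with an orthonormal frame. -/
structure IsMetricFrame (G : E n → Matrix (Fin n) (Fin n) ℝ)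
    (GA F : Matrix (Fin n) (Fin n) (SmoothAlg W)) : Prop where
  agrees : ∀ i j, Agrees (fun x => G x i j) (GA i j)
  symm : GA.transpose = GA
  ortho : F * GA * F.transpose = 1

namespace IsMetricFrame

variable {G : E n → Matrix (Fin n) (Fin n) ℝ} {GA F : Matrix (Fin n) (Fin n) (SmoothAlg W)}

lemma inv_eq (h : IsMetricFrame G GA F) : GA * Matrix.of (frameInv F) = 1 := by
  have h1 : F.transpose * (F * GA) = 1 := mul_eq_one_comm.mp h.ortho
  rw [← Matrix.mul_assoc] at h1
  exact mul_eq_one_comm.mp h1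

lemma isOrthoFrame (h : IsMetricFrame G GA F) :
    IsOrthoFrame (pdAlg W) GA (christoffelAlg GA F) F where
  comm := pdAlg_comm
  symm := h.symm
  torsion i j k := by
    have hs : ∀ i j, GA i j = GA j i := fun i j => congrFun (congrFun h.symm j) i
    simp only [christoffelAlg, Matrix.of_apply]
    refine Finset.sum_congr rfl fun l _ => ?_
    rw [hs i j]; ring
  compat i := by
    have hs : ∀ i j, GA i j = GA j i := fun i j => congrFun (congrFun h.symm j) i
    -- With the upper index lowered, the Christoffel symbol is the Koszul half-sum. Adding its
    -- transpose leaves the derivative of the metric.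
    have low : ∀ l j, (GA * christoffelAlg GA F i) l j = algebraMap ℝ _ (1 / 2) *
        (pdAlg W i (GA j l) + pdAlg W j (GA i l) - pdAlg W l (GA i j)) := by
      intro l j
      have e : christoffelAlg GA F i = Matrix.of (frameInv F) * Matrix.of fun l j =>
          algebraMap ℝ _ (1 / 2) *
            (pdAlg W i (GA j l) + pdAlg W j (GA i l) - pdAlg W l (GA i j)) := by
        ext1 k j
        simp only [christoffelAlg, Matrix.mul_apply, Matrix.of_apply]
        exact Finset.sum_congr rfl fun _ _ => by ring
      rw [e, ← Matrix.mul_assoc, h.inv_eq, Matrix.one_mul, Matrix.of_apply]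
    have tr : (christoffelAlg GA F i).transpose * GA
        = (GA * christoffelAlg GA F i).transpose := by
      rw [Matrix.transpose_mul, h.symm]
    have h2 := algebraMap_mul_cast (A := SmoothAlg W) (k := 2) two_ne_zero
    push_cast at h2
    ext1 k l
    rw [tr, Matrix.add_apply, Matrix.transpose_apply, low, low, dmat_apply, hs l k]
    linear_combination -pdAlg W i (GA k l) * h2
  ortho := h.ortho

end IsMetricFrame

end Coordinates

/-! ### Coordinate expressions of curvature and derivatives in terms of the frame. -/

section CoordinateAgreement

open TopologicalSpace

variable {n : ℕ} {W : Opens (E n)}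

lemma Agrees.congr {f : E n → ℝ} {F F' : SmoothAlg W} (h : Agrees f F) (e : F = F') :
    Agrees f F' := e ▸ h

namespace IsMetricFrame

variable {G : E n → Matrix (Fin n) (Fin n) ℝ} {GA F : Matrix (Fin n) (Fin n) (SmoothAlg W)}

/-- The derivations along an orthonormal frame. -/
abbrev fd (F : Matrix (Fin n) (Fin n) (SmoothAlg W)) :
    Fin n → Derivation ℝ (SmoothAlg W) (SmoothAlg W) := frameD (pdAlg W) F

/-- The connection coefficients of an orthonormal frame. -/
abbrev fw (GA F : Matrix (Fin n) (Fin n) (SmoothAlg W)) : Fin n → Fin n → Fin n → SmoothAlg W :=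
  conn (pdAlg W) GA (christoffelAlg GA F) F

lemma ginv (h : IsMetricFrame G GA F) (i j : Fin n) : Agrees (ginv G i j) (frameInv F i j) := by
  intro x
  have h1 := congrArg (evalAt x).mapMatrix h.inv_eq
  rw [map_mul, map_one] at h1
  have h2 : (evalAt x).mapMatrix GA = G x := by
    ext i j; exact (h.agrees i j x).symm
  rw [h2] at h1
  rw [ConfHyp.ginv, Matrix.inv_eq_right_inv h1]
  rfl

lemma christoffel (h : IsMetricFrame G GA F) (k i j : Fin n) :
    Agrees (christoffel G k i j) (christoffelAlg GA F i k j) :=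
  Agrees.sum fun l => ((agrees_const _).mul (h.ginv k l)).mul
    ((((h.agrees j l).pd i).add ((h.agrees i l).pd j)).sub ((h.agrees i j).pd l))

lemma riemann (h : IsMetricFrame G GA F) (a b c d : Fin n) :
    Agrees (riemann G a b c d) (curvMat (pdAlg W) (christoffelAlg GA F) a b c d) := by
  refine Agrees.congr ((((h.christoffel c b d).pd a).sub ((h.christoffel c a d).pd b)).add
    (Agrees.sum (s := Finset.univ) fun e =>
      ((h.christoffel c a e).mul (h.christoffel e b d)).sub
        ((h.christoffel c b e).mul (h.christoffel e a d)))) ?_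
  simp only [curvMat, Matrix.add_apply, Matrix.sub_apply, Matrix.mul_apply, dmat_apply,
    Finset.sum_sub_distrib]

/-- The Ricci tensor. -/
abbrev ric (GA F : Matrix (Fin n) (Fin n) (SmoothAlg W)) (a b : Fin n) : SmoothAlg W :=
  ∑ k, curvMat (pdAlg W) (christoffelAlg GA F) k a k b

lemma ricci (h : IsMetricFrame G GA F) (a b : Fin n) : Agrees (ricci G a b) (ric GA F a b) :=
  Agrees.sum fun c => h.riemann c a c b

/-- The scalar curvature. -/
abbrev scal (GA F : Matrix (Fin n) (Fin n) (SmoothAlg W)) : SmoothAlg W :=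
  ∑ a, ∑ c, frameRiem (fd F) (fw GA F) c a a c

lemma scalarCurv (h : IsMetricFrame G GA F) : Agrees (scalarCurv G) (scal GA F) := by
  refine Agrees.congr (Agrees.sum (s := Finset.univ) fun a => Agrees.sum (s := Finset.univ)
    fun b => (h.ginv a b).mul (h.ricci a b)) ?_
  rw [contract_two]
  exact Finset.sum_congr rfl fun a _ => h.isOrthoFrame.fr2_ricci a a

/-- The trace of the Schouten tensor. -/
abbrev schJ (GA F : Matrix (Fin n) (Fin n) (SmoothAlg W)) : SmoothAlg W :=
  algebraMap ℝ _ (1 / (2 * ((n : ℝ) - 1))) * scal GA F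

lemma schoutenJ (h : IsMetricFrame G GA F) : Agrees (schoutenJ G) (schJ GA F) := fun x => by
  have := ((agrees_const (1 / (2 * ((n : ℝ) - 1)))).mul h.scalarCurv) x
  rw [← this, ConfHyp.schoutenJ]; ring

/-- Clears the denominator `2(n − 1)`, which is 2, 4 or 6 in dimension two, three or four. -/
lemma schJ_eq (GA F : Matrix (Fin n) (Fin n) (SmoothAlg W)) (k : ℕ) (hk : k ≠ 0)
    (hn : (k : ℝ) = 2 * ((n : ℝ) - 1)) : (k : SmoothAlg W) * schJ GA F = scal GA F := by
  rw [schJ, ← hn, ← mul_assoc, algebraMap_mul_cast hk, one_mul]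

lemma schouten (h : IsMetricFrame G GA F) (a b : Fin n) : Agrees (schouten G a b)
    (algebraMap ℝ _ (1 / ((n : ℝ) - 2)) * (ric GA F a b - schJ GA F * GA a b)) := fun x => by
  have := ((agrees_const (1 / ((n : ℝ) - 2))).mul
    ((h.ricci a b).sub (h.schoutenJ.mul (h.agrees a b)))) x
  rw [← this, ConfHyp.schouten]; ring

lemma fr2_schouten (h : IsMetricFrame G GA F) (a b : Fin n) :
    fr2 F (fun a b => algebraMap ℝ _ (1 / ((n : ℝ) - 2)) * (ric GA F a b - schJ GA F * GA a b)) a b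
      = algebraMap ℝ _ (1 / ((n : ℝ) - 2)) *
        (∑ c, frameRiem (fd F) (fw GA F) c a b c - scalarTensor (schJ GA F) a b) := by
  have e1 : fr2 F (fun a b => schJ GA F * GA a b) a b = scalarTensor (schJ GA F) a b := by
    refine (fr2_mul_left F (schJ GA F) (fun a b => GA a b) a b).trans ?_
    refine (congrArg (schJ GA F * ·) (fr2_metric h.isOrthoFrame a b)).trans ?_
    simp only [scalarTensor, mul_ite, mul_one, mul_zero]
  rw [fr2_mul_left, fr2_sub, e1, h.isOrthoFrame.fr2_ricci]

lemma fr1_grad (F : Matrix (Fin n) (Fin n) (SmoothAlg W)) (φ : SmoothAlg W) :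
    fr1 F (fun l => pdAlg W l φ) = fun a => fd F a φ := by
  ext1 a; rw [frameD_apply]; rfl

lemma gradSq (h : IsMetricFrame G GA F) {f : E n → ℝ} {φ : SmoothAlg W} (hf : Agrees f φ) :
    Agrees (gradSq G f) (∑ a, fd F a φ ^ 2) := by
  refine Agrees.congr (Agrees.sum (s := Finset.univ) fun a => Agrees.sum (s := Finset.univ)
    fun b => ((h.ginv a b).mul (hf.pd a)).mul (hf.pd b)) ?_
  rw [contract_sq, fr1_grad]

lemma nabla1 (h : IsMetricFrame G GA F) {θ : Fin n → E n → ℝ} {Θ : Fin n → SmoothAlg W}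
    (hθ : ∀ a, Agrees (θ a) (Θ a)) (a b : Fin n) : Agrees (nabla1 G θ a b)
      (cov1 (pdAlg W) (coordConn (christoffelAlg GA F)) Θ a b) :=
  ((hθ b).pd a).sub (Agrees.sum fun k => (h.christoffel k a b).mul (hθ k))

lemma nabla2 (h : IsMetricFrame G GA F) {T : Fin n → Fin n → E n → ℝ}
    {TA : Fin n → Fin n → SmoothAlg W} (hT : ∀ a b, Agrees (T a b) (TA a b)) (c a b : Fin n) :
    Agrees (nabla2 G T c a b) (cov2 (pdAlg W) (coordConn (christoffelAlg GA F)) TA c a b) :=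
  (((hT a b).pd c).sub (Agrees.sum fun k => (h.christoffel k c a).mul (hT k b))).sub
    (Agrees.sum fun k => (h.christoffel k c b).mul (hT a k))

lemma nabla3 (h : IsMetricFrame G GA F) {T : Fin n → Fin n → Fin n → E n → ℝ}
    {TA : Fin n → Fin n → Fin n → SmoothAlg W} (hT : ∀ c a b, Agrees (T c a b) (TA c a b))
    (e c a b : Fin n) : Agrees (nabla3 G T e c a b)
      (cov3 (pdAlg W) (coordConn (christoffelAlg GA F)) TA e c a b) :=
  ((((hT c a b).pd e).sub (Agrees.sum fun k => (h.christoffel k e c).mul (hT k a b))).sub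
    (Agrees.sum fun k => (h.christoffel k e a).mul (hT c k b))).sub
    (Agrees.sum fun k => (h.christoffel k e b).mul (hT c a k))

lemma laplacian (h : IsMetricFrame G GA F) {f : E n → ℝ} {φ : SmoothAlg W} (hf : Agrees f φ) :
    Agrees (laplacian G f) (hess (fd F) (fw GA F) φ).trace := by
  refine Agrees.congr (Agrees.sum (s := Finset.univ) fun i => Agrees.sum (s := Finset.univ)
    fun j => (h.ginv i j).mul (h.nabla1 (fun l => hf.pd l) i j)) ?_
  rw [contract_two]
  refine Finset.sum_congr rfl fun a _ => ?_
  rw [h.isOrthoFrame.fr2_cov1, fr1_grad]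
  rfl

lemma inner2 (h : IsMetricFrame G GA F) {T S : Fin n → Fin n → E n → ℝ}
    {TA SA : Fin n → Fin n → SmoothAlg W} (hT : ∀ a b, Agrees (T a b) (TA a b))
    (hS : ∀ a b, Agrees (S a b) (SA a b)) :
    Agrees (inner2 G T S) (∑ a, ∑ b, fr2 F TA a b * fr2 F SA a b) := by
  refine Agrees.congr (Agrees.sum (s := Finset.univ) fun a => Agrees.sum (s := Finset.univ)
    fun b => (hT a b).mul (Agrees.sum (s := Finset.univ) fun c => Agrees.sum (s := Finset.univ)
      fun d => ((h.ginv a c).mul (h.ginv b d)).mul (hS c d))) ?_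
  exact contract_inner F TA SA

lemma yamabeS (h : IsMetricFrame G GA F) {f : E n → ℝ} {φ : SmoothAlg W} (hf : Agrees f φ) :
    Agrees (yamabeS G f) (∑ a, fd F a φ ^ 2 - algebraMap ℝ _ (2 / (n : ℝ)) * φ *
      ((hess (fd F) (fw GA F) φ).trace + schJ GA F * φ)) :=
  (h.gradSq hf).sub (((agrees_const _).mul hf).mul ((h.laplacian hf).add (h.schoutenJ.mul hf)))

lemma frameRiem_eq_zero (h : IsMetricFrame G GA F)
    (flat : ∀ x ∈ W, ∀ a b c d, ConfHyp.riemann G a b c d x = 0) (a b c d : Fin n) :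
    frameRiem (fd F) (fw GA F) a b c d = 0 := by
  have h0 : ∀ i j, curvMat (pdAlg W) (christoffelAlg GA F) i j = 0 := by
    intro i j
    ext1 k l
    exact SmoothAlg.ext_apply fun x => (h.riemann i j k l x).symm.trans (flat x.1 x.2 i j k l)
  rw [h.isOrthoFrame.frameRiem_eq]
  simp [h0]

end IsMetricFrame

end CoordinateAgreement

/-! ### Frames adapted to a hypersurface -/

section AdaptedFrames

open TopologicalSpace

variable {m : ℕ} {W : Opens (E (m + 1))}

/-- An orthonormal frame whose first member is normal to the level sets of `u`, for a function `u`
with `u = 0` and `|du| = 1` on the hypersurface. -/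
structure IsAdaptedFrame (G : E (m + 1) → Matrix (Fin (m + 1)) (Fin (m + 1)) ℝ)
    (u : E (m + 1) → ℝ) (GA F : Matrix (Fin (m + 1)) (Fin (m + 1)) (SmoothAlg W))
    (φ v N : SmoothAlg W) : Prop extends IsMetricFrame G GA F where
  agrees_fun : Agrees u φ
  tangent : ∀ i : Fin m, frameD (pdAlg W) F i.succ φ = 0
  normal : frameD (pdAlg W) F 0 φ = v
  inv : N * v = 1
  pos : ∀ x, 0 < v.1 x
  slice : sliceHom W φ = 0
  speed : sliceHom W v = 1

/-- The components of tangential tensors restricted to the hypersurface. -/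
def sliceMat (T : Matrix (Fin (m + 1)) (Fin (m + 1)) (SmoothAlg W)) :
    Matrix (Fin m) (Fin m) (SmoothAlg (sliceOpen W)) :=
  Matrix.of fun i j => sliceHom W (T i.succ j.succ)

/-- The uniqueness argument for the Levi-Civita connection: alternating the two symmetries through
the permutations of the indices gives t = −t. -/
lemma torsion_free_skew_eq_zero {A : Type*} [CommRing A] [Algebra ℝ A] {n : ℕ}
    {t : Fin n → Fin n → Fin n → A} (hs : ∀ a b c, t a b c = -t a c b)
    (ht : ∀ a b c, t a b c = t b a c) (a b c : Fin n) : t a b c = 0 := by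
  refine natCast_mul_cancel two_ne_zero ?_
  push_cast
  linear_combination ht a b c + hs b a c - ht b c a - hs c b a + ht c a b + hs a c b

namespace IsAdaptedFrame

variable {G : E (m + 1) → Matrix (Fin (m + 1)) (Fin (m + 1)) ℝ} {u : E (m + 1) → ℝ}
  {GA F : Matrix (Fin (m + 1)) (Fin (m + 1)) (SmoothAlg W)} {φ v N : SmoothAlg W}

open IsMetricFrame

lemma isAdapted (h : IsAdaptedFrame G u GA F φ v N) : IsAdapted (fd F) (fw GA F) φ v N where
  toIsFrameConn := h.isOrthoFrame.isFrameConn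
  tangent := h.tangent
  normal := h.normal
  inv := h.inv

lemma slice_pd (h : IsAdaptedFrame G u GA F φ v N) (i : Fin m) :
    sliceHom W (pdAlg W i.succ φ) = 0 := by
  rw [sliceHom_pd, h.slice, map_zero]

/-- On the slice `φ` vanishes identically, so only its `∂₀` derivative survives. That derivative is
invertible since e₀φ = 1 there, and the tangential members annihilate `φ`; hence they have no `∂₀`
component. -/
lemma slice_frame (h : IsAdaptedFrame G u GA F φ v N) (i : Fin m) :
    sliceHom W (F i.succ 0) = 0 := by
  have h1 := congrArg (sliceHom W) (h.tangent i)
  have h2 := congrArg (sliceHom W) h.normal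
  rw [frameD_apply, Fin.sum_univ_succ] at h1 h2
  simp only [map_add, map_sum, map_mul, h.slice_pd, mul_zero, Finset.sum_const_zero, add_zero,
    h.speed, map_zero] at h1 h2
  linear_combination sliceHom W (F 0 0) * h1 - sliceHom W (F i.succ 0) * h2

lemma slice_fr1 (h : IsAdaptedFrame G u GA F φ v N) (θ : Fin (m + 1) → SmoothAlg W) (i : Fin m) :
    sliceHom W (fr1 F θ i.succ) = fr1 (sliceMat F) (fun j => sliceHom W (θ j.succ)) i := by
  rw [fr1, Fin.sum_univ_succ, map_add, map_mul, h.slice_frame, zero_mul, zero_add, map_sum]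
  simp only [map_mul]
  rfl

lemma slice_fr2 (h : IsAdaptedFrame G u GA F φ v N)
    (T : Fin (m + 1) → Fin (m + 1) → SmoothAlg W) (i j : Fin m) :
    sliceHom W (fr2 F T i.succ j.succ)
      = fr2 (sliceMat F) (fun i j => sliceHom W (T i.succ j.succ)) i j := by
  rw [fr2, h.slice_fr1]
  simp only [h.slice_fr1]
  rfl

lemma slice_frameD (h : IsAdaptedFrame G u GA F φ v N) (i : Fin m) (f : SmoothAlg W) :
    sliceHom W (fd F i.succ f) = fd (sliceMat F) i (sliceHom W f) := by
  have h1 := h.slice_fr1 (fun l => pdAlg W l f) i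
  rw [fr1_grad] at h1
  refine h1.trans ?_
  simp only [sliceHom_pd]
  rw [fr1_grad]

lemma isRestriction (h : IsAdaptedFrame G u GA F φ v N) :
    IsRestriction (fd F) (fw GA F) φ v N (fd (sliceMat F)) (sliceHom W) where
  toIsAdapted := h.isAdapted
  tan := h.slice_frameD
  sigma := h.slice
  speed := h.speed

lemma induced (h : IsAdaptedFrame G u GA F φ v N) :
    IsMetricFrame (inducedMetric G) (sliceMat GA) (sliceMat F) where
  agrees i j := (h.agrees i.succ j.succ).slice
  symm := by
    ext1 i j
    exact congrArg (sliceHom W) (congrFun (congrFun h.symm i.succ) j.succ)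
  ortho := by
    have key : ∀ {n : ℕ} {A : Type} [CommRing A] (F G : Matrix (Fin n) (Fin n) A) (a b : Fin n),
        (F * G * F.transpose) a b = fr1 F (fun i => fr1 F (G i) b) a := by
      intro n A _ F G a b
      simp only [fr1, Matrix.mul_apply, Matrix.transpose_apply, Finset.sum_mul, Finset.mul_sum]
      rw [Finset.sum_comm]
      exact Finset.sum_congr rfl fun _ _ => Finset.sum_congr rfl fun _ _ => by ring
    ext1 i j
    have h1 := congrArg (sliceHom W) ((key F GA i.succ j.succ).symm.trans
      (congrFun (congrFun h.ortho i.succ) j.succ))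
    rw [key]
    refine ((h.slice_fr2 (fun i j => GA i j) i j).symm.trans h1).trans ?_
    by_cases hij : i = j
    · subst hij
      exact (congrArg (sliceHom W) (Matrix.one_apply_eq _)).trans
        ((map_one _).trans (Matrix.one_apply_eq _).symm)
    · rw [Matrix.one_apply_ne hij, Matrix.one_apply_ne (by simpa using hij), map_zero]

/-- The difference of the two connections is skew, both being metric. It is also torsion-free, since
both compute the bracket of the same tangential fields, the ambient bracket having no normal part.
So it vanishes. -/
lemma slice_conn (h : IsAdaptedFrame G u GA F φ v N) (i j k : Fin m) :
    sliceHom W (tconn (fw GA F) i j k) = fw (sliceMat GA) (sliceMat F) i j k := by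
  have hA := h.isAdapted
  set t : Fin m → Fin m → Fin m → SmoothAlg (sliceOpen W) := fun i j k =>
    sliceHom W (tconn (fw GA F) i j k) - fw (sliceMat GA) (sliceMat F) i j k with ht
  refine sub_eq_zero.mp (torsion_free_skew_eq_zero (t := t) (fun a b c => ?_) (fun a b c => ?_)
    i j k)
  · simp only [ht, tconn]
    have e1 := congrArg (sliceHom W) (hA.skew a.succ b.succ c.succ)
    have e2 := h.induced.isOrthoFrame.isFrameConn.skew a b c
    rw [map_neg] at e1
    linear_combination e1 - e2
  · have key : ∀ k, ∑ c, (t a b c - t b a c) * sliceMat F c k = 0 := by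
      intro k
      have h1 := congrArg (sliceHom W) (h.isOrthoFrame.frameD_bracket_frame a.succ b.succ k.succ)
      have h2 := h.induced.isOrthoFrame.frameD_bracket_frame a b k
      have h3 : fw GA F a.succ b.succ 0 - fw GA F b.succ a.succ 0 = 0 := by
        have := hA.sff_symm a b
        simp only [sff] at this
        rw [hA.skew, hA.skew b.succ]
        linear_combination -this
      rw [map_sub, h.slice_frameD, h.slice_frameD, Fin.sum_univ_succ, h3, zero_mul, zero_add,
        map_sum] at h1
      have h4 := h1.symm.trans h2
      rw [← sub_eq_zero, ← Finset.sum_sub_distrib] at h4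
      rw [← h4]
      refine Finset.sum_congr rfl fun c _ => ?_
      simp only [ht, map_mul, map_sub, tconn]
      change _ = _ * sliceMat F c k - _
      ring
    -- `key` compares coordinate components of the brackets; invertibility of the restricted frame
    -- recovers the coefficients.
    have hv : Matrix.vecMul (fun c => t a b c - t b a c) (sliceMat F) = 0 := by
      ext1 k; exact key k
    have ho := h.induced.ortho
    rw [Matrix.mul_assoc] at ho
    have h5 := congrArg (fun x => Matrix.vecMul x (sliceMat GA * (sliceMat F).transpose)) hv
    simp only [Matrix.vecMul_vecMul, ho, Matrix.vecMul_one, Matrix.zero_vecMul] at h5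
    exact sub_eq_zero.mp (congrFun h5 c)

/-- The unit conormal. -/
lemma conormal (h : IsAdaptedFrame G u GA F φ v N) (a : Fin (m + 1)) :
    Agrees (unitConormal G u a) (N * pdAlg W a φ) := by
  intro x
  have h1 := h.gradSq h.agrees_fun x
  rw [Fin.sum_univ_succ] at h1
  simp only [fd, h.normal, h.tangent, ne_eq, OfNat.ofNat_ne_zero, not_false_eq_true, zero_pow,
    Finset.sum_const_zero, add_zero] at h1
  have h2 : (v ^ 2).1 x = v.1 x ^ 2 := rfl
  have h3 : N.1 x * v.1 x = 1 := congrArg (evalAt x) h.inv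
  rw [unitConormal, h1, h2, Real.sqrt_sq (h.pos x).le, h.agrees_fun.pd a x,
    div_eq_iff (h.pos x).ne']
  change _ = N.1 x * (pdAlg W a φ).1 x * v.1 x
  linear_combination -(pdAlg W a φ).1 x * h3

lemma fr1_conormal (h : IsAdaptedFrame G u GA F φ v N) (a : Fin (m + 1)) :
    fr1 F (fun a => N * pdAlg W a φ) a = if a = 0 then 1 else 0 := by
  rw [fr1_mul_left, fr1_grad]
  refine Fin.cases ?_ (fun i => ?_) a
  · rw [if_pos rfl, ← h.inv, ← h.normal]
  · rw [if_neg (Fin.succ_ne_zero i), ← mul_zero N, ← h.tangent i]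

/-- The second fundamental form in coordinates. -/
def secondAlg (GA F : Matrix (Fin (m + 1)) (Fin (m + 1)) (SmoothAlg W)) (φ N : SmoothAlg W)
    (i j : Fin m) : SmoothAlg (sliceOpen W) :=
  sliceHom W (cov1 (pdAlg W) (coordConn (christoffelAlg GA F)) (fun a => N * pdAlg W a φ)
    i.succ j.succ)

lemma secondFF (h : IsAdaptedFrame G u GA F φ v N) (i j : Fin m) :
    Agrees (secondFF G u i j) (secondAlg GA F φ N i j) :=
  (h.nabla1 h.conormal i.succ j.succ).slice

/-- The unit conormal has constant frame components, 1 along `e₀` and 0 otherwise. Its covariant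
derivative is therefore a pure connection term, which skewness turns into `sff`. -/
lemma fr2_secondAlg (h : IsAdaptedFrame G u GA F φ v N) (i j : Fin m) :
    fr2 (sliceMat F) (secondAlg GA F φ N) i j = sliceHom W (sff (fw GA F) i j) := by
  refine (h.slice_fr2 _ i j).symm.trans ?_
  rw [h.isOrthoFrame.fr2_cov1]
  have : fr1 F (fun a => N * pdAlg W a φ) = fun a => if a = 0 then 1 else 0 := by
    ext1 a; exact h.fr1_conormal a
  rw [this, cov1, if_neg (Fin.succ_ne_zero j), map_zero, zero_sub]
  simp only [mul_ite, mul_one, mul_zero, Finset.sum_ite_eq', Finset.mem_univ, if_true]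
  rw [sff, h.isAdapted.skew]

/-- The mean curvature. -/
def meanAlg (GA F : Matrix (Fin (m + 1)) (Fin (m + 1)) (SmoothAlg W)) : SmoothAlg (sliceOpen W) :=
  algebraMap ℝ _ (1 / (m : ℝ)) * ∑ e, sliceHom W (sff (fw GA F) e e)

lemma mul_meanAlg (hm : m ≠ 0) :
    (m : SmoothAlg (sliceOpen W)) * meanAlg GA F = ∑ e, sliceHom W (sff (fw GA F) e e) := by
  rw [meanAlg, ← mul_assoc, algebraMap_mul_cast hm, one_mul]

lemma meanCurv (h : IsAdaptedFrame G u GA F φ v N) : Agrees (meanCurv G u) (meanAlg GA F) := by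
  refine Agrees.congr ((agrees_const _).mul (Agrees.sum (s := Finset.univ) fun i =>
    Agrees.sum (s := Finset.univ) fun j => (h.induced.ginv i j).mul (h.secondFF i j))) ?_
  rw [contract_two]
  simp only [h.fr2_secondAlg]
  rfl

/-- The trace-free second fundamental form in coordinates. -/
def tfAlg (GA F : Matrix (Fin (m + 1)) (Fin (m + 1)) (SmoothAlg W)) (φ N : SmoothAlg W)
    (i j : Fin m) : SmoothAlg (sliceOpen W) :=
  secondAlg GA F φ N i j - meanAlg GA F * sliceMat GA i j

/-- The trace-free second fundamental form in the frame. -/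
def tfFrame (GA F : Matrix (Fin (m + 1)) (Fin (m + 1)) (SmoothAlg W))
    (i j : Fin m) : SmoothAlg (sliceOpen W) :=
  sliceHom W (sff (fw GA F) i j) - scalarTensor (meanAlg GA F) i j

lemma tfSecondFF (h : IsAdaptedFrame G u GA F φ v N) (i j : Fin m) :
    Agrees (tfSecondFF G u i j) (tfAlg GA F φ N i j) :=
  (h.secondFF i j).sub (h.meanCurv.mul (h.induced.agrees i j))

lemma fr2_tfAlg (h : IsAdaptedFrame G u GA F φ v N) :
    fr2 (sliceMat F) (tfAlg GA F φ N) = tfFrame GA F := by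
  ext1 i
  ext1 j
  refine (fr2_sub _ _ _ i j).trans ?_
  rw [tfFrame, h.fr2_secondAlg]
  congr 1
  refine (fr2_mul_left _ _ (fun i j => sliceMat GA i j) i j).trans ?_
  refine (congrArg (meanAlg GA F * ·) (fr2_metric h.induced.isOrthoFrame i j)).trans ?_
  simp only [scalarTensor, mul_ite, mul_one, mul_zero]

/-- The first covariant derivative of the trace-free second fundamental form. -/
abbrev dAlg (GA F : Matrix (Fin (m + 1)) (Fin (m + 1)) (SmoothAlg W)) (φ N : SmoothAlg W) :
    Fin m → Fin m → Fin m → SmoothAlg (sliceOpen W) :=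
  cov2 (pdAlg _) (coordConn (christoffelAlg (sliceMat GA) (sliceMat F))) (tfAlg GA F φ N)

/-- The second covariant derivative of the trace-free second fundamental form. -/
abbrev ddAlg (GA F : Matrix (Fin (m + 1)) (Fin (m + 1)) (SmoothAlg W)) (φ N : SmoothAlg W) :
    Fin m → Fin m → Fin m → Fin m → SmoothAlg (sliceOpen W) :=
  cov3 (pdAlg _) (coordConn (christoffelAlg (sliceMat GA) (sliceMat F))) (dAlg GA F φ N)

/-- The first covariant derivative of the trace-free second fundamental form, in the frame. -/
abbrev dFrame (GA F : Matrix (Fin (m + 1)) (Fin (m + 1)) (SmoothAlg W)) :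
    Fin m → Fin m → Fin m → SmoothAlg (sliceOpen W) :=
  cov2 (fd (sliceMat F)) (fw (sliceMat GA) (sliceMat F)) (tfFrame GA F)

/-- The second covariant derivative of the trace-free second fundamental form, in the frame. -/
abbrev ddFrame (GA F : Matrix (Fin (m + 1)) (Fin (m + 1)) (SmoothAlg W)) :
    Fin m → Fin m → Fin m → Fin m → SmoothAlg (sliceOpen W) :=
  cov3 (fd (sliceMat F)) (fw (sliceMat GA) (sliceMat F)) (dFrame GA F)

lemma dII (h : IsAdaptedFrame G u GA F φ v N) (c a b : Fin m) :
    Agrees (dII G u c a b) (dAlg GA F φ N c a b) := h.induced.nabla2 h.tfSecondFF c a b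

lemma ddII (h : IsAdaptedFrame G u GA F φ v N) (e c a b : Fin m) :
    Agrees (ddII G u e c a b) (ddAlg GA F φ N e c a b) := h.induced.nabla3 h.dII e c a b

lemma fr3_dAlg (h : IsAdaptedFrame G u GA F φ v N) :
    fr3 (sliceMat F) (dAlg GA F φ N) = dFrame GA F := by
  ext1 a; ext1 b; ext1 c
  rw [h.induced.isOrthoFrame.fr3_cov2, h.fr2_tfAlg]

lemma fr4_ddAlg (h : IsAdaptedFrame G u GA F φ v N) :
    fr4 (sliceMat F) (ddAlg GA F φ N) = ddFrame GA F := by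
  ext1 a; ext1 b; ext1 c; ext1 d
  rw [h.induced.isOrthoFrame.fr4_cov3, h.fr3_dAlg]

lemma divdivII (h : IsAdaptedFrame G u GA F φ v N) :
    Agrees (divdivII G u) (∑ a, ∑ b, ddFrame GA F a b a b) := by
  refine Agrees.congr (Agrees.sum (s := Finset.univ) fun a => Agrees.sum (s := Finset.univ)
    fun b => Agrees.sum (s := Finset.univ) fun c => Agrees.sum (s := Finset.univ) fun d =>
      ((h.induced.ginv a c).mul (h.induced.ginv b d)).mul (h.ddII a b c d)) ?_
  rw [contract_four, h.fr4_ddAlg]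

lemma lapII (h : IsAdaptedFrame G u GA F φ v N) (a b : Fin m) : Agrees (lapII G u a b)
    (∑ c, ∑ d, frameInv (sliceMat F) c d * ddAlg GA F φ N c d a b) :=
  Agrees.sum fun c => Agrees.sum fun d => (h.induced.ginv c d).mul (h.ddII c d a b)

lemma divII (h : IsAdaptedFrame G u GA F φ v N) (a : Fin m) : Agrees (divII G u a)
    (∑ b, ∑ c, frameInv (sliceMat F) b c * dAlg GA F φ N c a b) :=
  Agrees.sum fun b => Agrees.sum fun c => (h.induced.ginv b c).mul (h.dII c a b)

lemma inner_lapII (h : IsAdaptedFrame G u GA F φ v N) :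
    Agrees (inner2 (inducedMetric G) (ConfHyp.lapII G u) (ConfHyp.tfSecondFF G u))
      (∑ a, ∑ b, (∑ e, ddFrame GA F e e a b) * tfFrame GA F a b) := by
  refine (h.induced.inner2 h.lapII h.tfSecondFF).congr ?_
  simp only [fr2_contract, h.fr4_ddAlg, h.fr2_tfAlg]

lemma normSqDII (h : IsAdaptedFrame G u GA F φ v N) :
    Agrees (normSqDII G u) (∑ c, ∑ a, ∑ b, dFrame GA F c a b ^ 2) := by
  refine Agrees.congr (Agrees.sum (s := Finset.univ) fun c => Agrees.sum (s := Finset.univ)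
    fun c' => (h.induced.ginv c c').mul (h.induced.inner2 (h.dII c) (h.dII c'))) ?_
  rw [← h.fr3_dAlg, ← contract_normSq]
  simp only [contract_inner]

lemma normSqDivII (h : IsAdaptedFrame G u GA F φ v N) :
    Agrees (normSqDivII G u) (∑ a, (∑ b, dFrame GA F b a b) ^ 2) := by
  refine Agrees.congr (Agrees.sum (s := Finset.univ) fun a => Agrees.sum (s := Finset.univ)
    fun a' => ((h.induced.ginv a a').mul (h.divII a)).mul (h.divII a')) ?_
  rw [contract_sq]
  simp only [fr1_contract, h.fr3_dAlg]

lemma normSqII (h : IsAdaptedFrame G u GA F φ v N) :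
    Agrees (normSqII G u) (∑ a, ∑ b, tfFrame GA F a b * tfFrame GA F a b) := by
  refine (h.induced.inner2 h.tfSecondFF h.tfSecondFF).congr ?_
  simp only [h.fr2_tfAlg]

lemma schoutenTop (h : IsAdaptedFrame G u GA F φ v N) (i j : Fin m) :
    Agrees (schoutenTop G i j) (sliceHom W (algebraMap ℝ _ (1 / (((m + 1 : ℕ) : ℝ) - 2)) *
      (ric GA F i.succ j.succ - schJ GA F * GA i.succ j.succ))) :=
  (h.schouten i.succ j.succ).slice

lemma inner_schoutenTop (h : IsAdaptedFrame G u GA F φ v N) :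
    Agrees (inner2 (inducedMetric G) (ConfHyp.schoutenTop G) (ConfHyp.tfSecondFF G u))
      (∑ a, ∑ b, sliceHom W (algebraMap ℝ _ (1 / (((m + 1 : ℕ) : ℝ) - 2)) *
        (∑ e, frameRiem (fd F) (fw GA F) e a.succ b.succ e
          - scalarTensor (schJ GA F) a.succ b.succ)) * tfFrame GA F a b) := by
  refine (h.induced.inner2 h.schoutenTop h.tfSecondFF).congr ?_
  rw [h.fr2_tfAlg]
  refine Finset.sum_congr rfl fun a _ => Finset.sum_congr rfl fun b _ => ?_
  congr 1
  refine (h.slice_fr2 (fun a b => algebraMap ℝ _ (1 / (((m + 1 : ℕ) : ℝ) - 2)) *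
      (ric GA F a b - schJ GA F * GA a b)) a b).symm.trans ?_
  rw [h.fr2_schouten]

/-- In an adapted frame `dφ` is `v` times the unit conormal, so the Laplacian splits into the normal
derivative of `v` and `v` times the trace of `II`. -/
lemma hess_trace (h : IsAdaptedFrame G u GA F φ v N) :
    (hess (fd F) (fw GA F) φ).trace = fd F 0 v + v * ∑ i, sff (fw GA F) i i := by
  have h0 : fd F 0 φ = v := h.normal
  have ht : ∀ i : Fin m, fd F i.succ φ = 0 := h.tangent
  have hw : fw GA F 0 0 0 = 0 := h.isAdapted.toIsFrameConn.self_eq_zero 0 0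
  have hs : ∀ i : Fin m, fw GA F i.succ i.succ 0 = -sff (fw GA F) i i :=
    fun i => h.isAdapted.skew _ _ _
  simp only [hess, cov1, Matrix.trace, Matrix.diag_apply, Matrix.of_apply, Fin.sum_univ_succ, h0,
    ht, hw, hs, map_zero, mul_zero, zero_mul, Finset.sum_const_zero, add_zero, sub_zero, zero_sub]
  rw [Finset.mul_sum]
  congr 1
  exact Finset.sum_congr rfl fun _ _ => by ring

/-- The singular Yamabe equation in an adapted frame. -/
lemma yamabe (h : IsAdaptedFrame G u GA F φ v N) {b : E (m + 1) → ℝ} {BA : SmoothAlg W}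
    (hb : Agrees b BA) {k : ℕ} (hS : ∀ x ∈ W, yamabeS G u x = 1 + u x ^ k * b x) :
    v ^ 2 - algebraMap ℝ _ (2 / ((m + 1 : ℕ) : ℝ)) * φ *
      (fd F 0 v + v * ∑ i, sff (fw GA F) i i + schJ GA F * φ) = 1 + φ ^ k * BA := by
  have h1 := h.yamabeS h.agrees_fun
  rw [h.hess_trace, Fin.sum_univ_succ] at h1
  simp only [fd, h.normal, h.tangent, ne_eq, OfNat.ofNat_ne_zero, not_false_eq_true, zero_pow,
    Finset.sum_const_zero, add_zero] at h1
  refine SmoothAlg.ext_apply fun x => (h1 x).symm.trans ((hS x.1 x.2).trans ?_)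
  rw [h.agrees_fun x, hb x]
  rfl

end IsAdaptedFrame

end AdaptedFrames

/-! ### The obstruction density in coordinates with an adapted frame -/

/-- In dimension three `P = Ric − J g`, so the curvature factor of `obstruction_three` is the
tangential Schouten tensor; here it appears under a single name. -/
theorem IsRestriction.obstruction_three_of_tensor {A A' : Type*} [CommRing A] [Algebra ℝ A]
    [CommRing A'] [Algebra ℝ A'] {D : Fin (2 + 1) → Derivation ℝ A A}
    {w : Fin (2 + 1) → Fin (2 + 1) → Fin (2 + 1) → A} {σ v N : A}
    {D' : Fin 2 → Derivation ℝ A' A'} {r : A →+* A'} (h : IsRestriction D w σ v N D' r)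
    (cyc : ∀ a b c d, frameRiem D w a b c d + frameRiem D w b c a d + frameRiem D w c a b d = 0)
    {B J : A} (hJ : 4 * J = ∑ a, ∑ c, frameRiem D w c a a c)
    (hS : 3 * v ^ 2 - 2 * σ * (D 0 v + v * ∑ i, sff w i i + J * σ) = 3 + 3 * σ ^ 3 * B)
    {c' : Fin 2 → Fin 2 → Fin 2 → A'} (hc' : ∀ i j k, r (tconn w i j k) = c' i j k)
    (hF : IsFrameConn D' c') {H : A'} (hH : 2 * H = ∑ e, r (sff w e e))
    {k0 : Fin 2 → Fin 2 → A'} (hk0 : ∀ a b, k0 a b = r (sff w a b) - scalarTensor H a b)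
    {P : Fin 2 → Fin 2 → A'} (hP : ∀ a b : Fin 2,
      r (∑ e, frameRiem D w e a.succ b.succ e - scalarTensor J a.succ b.succ) = P a b) :
    -3 * r B = ∑ a, ∑ b, cov3 D' c' (cov2 D' c' k0) a b a b + H * ∑ a, ∑ b, k0 a b * k0 a b
      + ∑ a, ∑ b, P a b * k0 a b := by
  simp only [← hP]
  exact h.obstruction_three cyc hJ hS hc' hF (fun _ _ => rfl) hH hk0

namespace IsAdaptedFrame

open TopologicalSpace IsMetricFrame

section Surfaces

variable {W : Opens (E (2 + 1))} {G : E (2 + 1) → Matrix (Fin (2 + 1)) (Fin (2 + 1)) ℝ} {u : E (2 + 1) → ℝ}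
  {GA F : Matrix (Fin (2 + 1)) (Fin (2 + 1)) (SmoothAlg W)} {φ v N : SmoothAlg W}

lemma yamabe_three (h : IsAdaptedFrame (m := 2) G u GA F φ v N) {b : E (2 + 1) → ℝ} {BA : SmoothAlg W}
    (hb : Agrees b BA) (hS : ∀ x ∈ W, yamabeS G u x = 1 + u x ^ 3 * b x) :
    3 * v ^ 2 - 2 * φ * (fd F 0 v + v * ∑ i : Fin 2, sff (fw GA F) i i + schJ GA F * φ)
      = 3 + 3 * φ ^ 3 * BA := by
  have h1 := h.yamabe hb hS
  have h2 : (3 : SmoothAlg W) * algebraMap ℝ _ (2 / ((2 + 1 : ℕ) : ℝ)) = 2 := by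
    rw [← map_ofNat (algebraMap ℝ (SmoothAlg W)) 3, ← map_mul,
      ← map_ofNat (algebraMap ℝ (SmoothAlg W)) 2]
    norm_num
  linear_combination 3 * h1 +
    φ * (fd F 0 v + v * ∑ i : Fin 2, sff (fw GA F) i i + schJ GA F * φ) * h2

lemma surface (h : IsAdaptedFrame (m := 2) G u GA F φ v N) {b : E (2 + 1) → ℝ} {BA : SmoothAlg W}
    (hb : Agrees b BA) (hS : ∀ x ∈ W, yamabeS G u x = 1 + u x ^ 3 * b x)
    (y : sliceOpen (m := 2) W) : b (incl y.1) = surfaceFormula (m := 2) G u y.1 := by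
  have hJ := schJ_eq GA F 4 (by norm_num) (by norm_num)
  have hH := mul_meanAlg (GA := GA) (F := F) (m := 2) (by norm_num)
  -- The denominator `d − 2` of the Schouten tensor is 1.
  have h1 : algebraMap ℝ (SmoothAlg W) (1 / (((2 + 1 : ℕ) : ℝ) - 2)) = 1 := by
    norm_num
  have hY := h.yamabe_three hb hS
  have c3 := h.inner_schoutenTop y
  push_cast at hJ hH
  simp only [h1, one_mul] at c3
  generalize schJ GA F = J at hJ hY c3
  obtain ⟨P, hP⟩ : ∃ P : Fin 2 → Fin 2 → SmoothAlg (sliceOpen (m := 2) W), ∀ a b : Fin 2,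
      sliceHom W (∑ e, frameRiem (fd F) (fw GA F) e a.succ b.succ e
        - scalarTensor J a.succ b.succ) = P a b := ⟨_, fun _ _ => rfl⟩
  simp only [hP] at c3
  have key := h.isRestriction.obstruction_three_of_tensor h.isOrthoFrame.frameRiem_cyclic hJ hY
    h.slice_conn h.induced.isOrthoFrame.isFrameConn hH (k0 := tfFrame GA F) (fun _ _ => rfl) hP
  have ev : ∀ b S H T P : SmoothAlg (sliceOpen (m := 2) W), -3 * b = S + H * T + P →
      -3 * b.1 y = S.1 y + H.1 y * T.1 y + P.1 y := fun b S H T P hb => by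
    have := congrArg (evalAt y) hb
    rwa [map_mul, map_add, map_add, map_mul, map_neg, map_ofNat] at this
  have e1 := ev _ _ _ _ _ key
  have c1 := h.divdivII y
  have c2 := h.meanCurv y
  have c5 := h.normSqII y
  have c6 : b (incl y.1) = _ := hb.slice y
  rw [surfaceFormula, c1, c2, c3, c5, c6]
  linear_combination (-1 / 3 : ℝ) * e1

/-- The obstruction density of a surface in a flat scale. -/
lemma willmore (h : IsAdaptedFrame (m := 2) G u GA F φ v N) {b : E (2 + 1) → ℝ} {BA : SmoothAlg W}
    (hb : Agrees b BA) (hS : ∀ x ∈ W, yamabeS G u x = 1 + u x ^ 3 * b x)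
    (flat : ∀ x ∈ W, ∀ a b c d, ConfHyp.riemann G a b c d x = 0) (y : sliceOpen (m := 2) W) :
    b (incl y.1) = -(1 / 3 : ℝ) * willmoreInvariant (m := 2) G u y.1 := by
  have hfl := h.frameRiem_eq_zero flat
  have hJ := schJ_eq GA F 4 (by norm_num) (by norm_num)
  have hH := mul_meanAlg (GA := GA) (F := F) (m := 2) (by norm_num)
  have hK := schJ_eq (sliceMat (m := 2) GA) (sliceMat F) 2 (by norm_num) (by norm_num)
  have hY := h.yamabe_three hb hS
  push_cast at hJ hH hK
  have hJ0 : schJ GA F = 0 := natCast_mul_cancel (k := 4) (by norm_num) (by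
    push_cast; rw [hJ]; simp [scal, hfl])
  rw [hJ0, zero_mul, add_zero] at hY
  have key := h.isRestriction.obstruction_three_flat hfl hY h.slice_conn
    h.induced.isOrthoFrame.isFrameConn hH hK
  have e1 := congrArg (evalAt y) key
  rw [map_add, map_mul, map_mul (evalAt y) (2 * meanAlg GA F), map_sub, map_pow, map_mul, map_neg,
    map_ofNat, map_ofNat] at e1
  simp only [evalAt_apply] at e1
  have c1 := h.induced.laplacian h.meanCurv y
  have c2 := h.meanCurv y
  have c5 := h.induced.schoutenJ y
  have c6 : b (incl y.1) = _ := hb.slice y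
  rw [willmoreInvariant, c1, c2, c5, c6]
  linear_combination (-1 / 3 : ℝ) * e1

end Surfaces

section Threefolds

variable {W : Opens (E (3 + 1))} {G : E (3 + 1) → Matrix (Fin (3 + 1)) (Fin (3 + 1)) ℝ} {u : E (3 + 1) → ℝ}
  {GA F : Matrix (Fin (3 + 1)) (Fin (3 + 1)) (SmoothAlg W)} {φ v N : SmoothAlg W}

/-- The obstruction density of a hypersurface in a flat four-dimensional scale. -/
lemma threefold (h : IsAdaptedFrame (m := 3) G u GA F φ v N) {b : E (3 + 1) → ℝ} {BA : SmoothAlg W}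
    (hb : Agrees b BA) (hS : ∀ x ∈ W, yamabeS G u x = 1 + u x ^ 4 * b x)
    (flat : ∀ x ∈ W, ∀ a b c d, ConfHyp.riemann G a b c d x = 0) (y : sliceOpen (m := 3) W) :
    b (incl y.1) = threefoldFormula (m := 3) G u y.1 := by
  have hfl := h.frameRiem_eq_zero flat
  have hJ := schJ_eq GA F 6 (by norm_num) (by norm_num)
  have hH := mul_meanAlg (GA := GA) (F := F) (m := 3) (by norm_num)
  have hK := schJ_eq (sliceMat (m := 3) GA) (sliceMat F) 4 (by norm_num) (by norm_num)
  have hY := h.yamabe hb hS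
  push_cast at hJ hH hK
  have hJ0 : schJ GA F = 0 := natCast_mul_cancel (k := 6) (by norm_num) (by
    push_cast; rw [hJ]; simp [scal, hfl])
  rw [hJ0, zero_mul, add_zero] at hY
  have h2 : (2 : SmoothAlg W) * algebraMap ℝ _ (2 / ((3 + 1 : ℕ) : ℝ)) = 1 := by
    have e : algebraMap ℝ (SmoothAlg W) (2 * (2 / ((3 + 1 : ℕ) : ℝ))) = algebraMap ℝ _ 1 :=
      congrArg _ (by norm_num)
    rwa [map_mul, map_ofNat, map_one] at e
  have hY' : 2 * v ^ 2 - φ * (fd F 0 v + v * ∑ i : Fin 3, sff (fw GA F) i i)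
      = 2 + 2 * φ ^ 4 * BA := by
    linear_combination 2 * hY + φ * (fd F 0 v + v * ∑ i : Fin 3, sff (fw GA F) i i) * h2
  have c4 := h.induced.schoutenJ y
  generalize schJ (sliceMat (m := 3) GA) (sliceMat F) = J at hK c4
  have key := h.isRestriction.obstruction_four hfl hY' h.slice_conn
    h.induced.isOrthoFrame.isFrameConn (fun _ _ => rfl) hH hK (k0 := tfFrame GA F)
    (fun _ _ => rfl)
  have e1 := congrArg (evalAt y) key
  simp only [map_add, map_sub, map_mul, map_pow] at e1
  simp only [map_ofNat, evalAt_apply] at e1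
  have c1 := h.normSqDII y
  have c2 := h.inner_lapII y
  have c3 := h.normSqDivII y
  have c5 := h.normSqII y
  have c6 : b (incl y.1) = _ := hb.slice y
  rw [threefoldFormula, c1, c2, c3, c4, c5, c6]
  linear_combination (1 / 12 : ℝ) * e1

end Threefolds

end IsAdaptedFrame

/-! ### Existence of adapted frames -/

section Orthonormalization

open TopologicalSpace

variable {n : ℕ} {W : Opens (E n)}

lemma triple_product_apply {A : Type*} [CommRing A] {k : ℕ} (L M : Matrix (Fin k) (Fin k) A)
    (a b : Fin k) : (L * M * L.transpose) a b = ∑ i, ∑ j, L a i * M i j * L b j := by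
  simp only [Matrix.mul_apply, Matrix.transpose_apply, Finset.sum_mul]
  exact Finset.sum_comm

/-- Pointwise positive definiteness of a matrix of functions. -/
def IsPosDef {k : ℕ} (M : Matrix (Fin k) (Fin k) (SmoothAlg W)) : Prop :=
  ∀ (x : W) (y : Fin k → ℝ), y ≠ 0 → 0 < ∑ i, ∑ j, y i * (M i j).1 x * y j

lemma IsPosDef.tail {k : ℕ} {M : Matrix (Fin (k + 1)) (Fin (k + 1)) (SmoothAlg W)}
    (h : IsPosDef M) : IsPosDef (Matrix.of fun i j : Fin k => M i.succ j.succ) := by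
  intro x y hy
  have h1 := h x (Fin.cons 0 y) fun h0 => hy (by
    ext i; simpa using congrFun h0 i.succ)
  simpa [Fin.sum_univ_succ] using h1

/-- One Gram–Schmidt step in block form. The later vectors are already orthonormal and stay in their
span. The first one loses its projection onto them and is normalized by the square root of the Schur
complement, which is positive and hence has a smooth root. The zero column and the positive corner
are what an adapted frame needs. -/
lemma exists_orthonormalization_succ {k : ℕ} {M : Matrix (Fin (k + 1)) (Fin (k + 1)) (SmoothAlg W)}
    (hM : IsPosDef M) (hs : ∀ i j, M i j = M j i) {L' : Matrix (Fin k) (Fin k) (SmoothAlg W)}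
    (hL : L' * (Matrix.of fun i j : Fin k => M i.succ j.succ) * L'.transpose = 1) :
    ∃ L : Matrix (Fin (k + 1)) (Fin (k + 1)) (SmoothAlg W), L * M * L.transpose = 1 ∧
      (∀ i : Fin k, L i.succ 0 = 0) ∧ ∀ x, 0 < (L 0 0).1 x := by
  set M' : Matrix (Fin k) (Fin k) (SmoothAlg W) := Matrix.of fun i j => M i.succ j.succ with hM'
  set b : Fin k → SmoothAlg W := fun i => M 0 i.succ with hb
  set c : Fin k → SmoothAlg W := Matrix.vecMul b (L'.transpose * L') with hc
  have hcM : ∀ j, ∑ i, c i * M i.succ j.succ = b j := by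
    have h1 : L'.transpose * L' * M' = 1 := by
      rw [Matrix.mul_assoc] at hL ⊢
      have := mul_eq_one_comm.mp hL
      rw [Matrix.mul_assoc] at this
      have h2 := mul_eq_one_comm.mp this
      rwa [Matrix.mul_assoc] at h2
    intro j
    have h2 : Matrix.vecMul c M' = b := by rw [hc, Matrix.vecMul_vecMul, h1, Matrix.vecMul_one]
    exact congrFun h2 j
  set δ : SmoothAlg W := M 0 0 - ∑ i, c i * b i with hδ
  -- The first basis vector minus its projection: orthogonal to the others, with squared length `δ`.
  set y : Fin (k + 1) → SmoothAlg W := Fin.cons 1 fun i => -c i with hy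
  have hy0 : y 0 = 1 := rfl
  have hys : ∀ i : Fin k, y i.succ = -c i := fun _ => rfl
  have hyM : ∀ j, ∑ i, y i * M i j = if j = 0 then δ else 0 := by
    intro j
    rw [Fin.sum_univ_succ]
    refine Fin.cases ?_ (fun j => ?_) j
    · rw [hy0, one_mul, if_pos rfl, hδ, sub_eq_add_neg, ← Finset.sum_neg_distrib]
      congr 1
      refine Finset.sum_congr rfl fun i _ => ?_
      rw [hys, hs i.succ 0]; ring
    · rw [hy0, one_mul, if_neg (Fin.succ_ne_zero j)]
      have : ∑ i : Fin k, y i.succ * M i.succ j.succ = -b j := by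
        rw [← hcM, ← Finset.sum_neg_distrib]
        refine Finset.sum_congr rfl fun i _ => ?_
        rw [hys]; ring
      rw [this]
      exact add_neg_cancel _
  have hpos : ∀ x, 0 < δ.1 x := by
    intro x
    have h1 := hM x (fun i => (y i).1 x) fun h0 => by
      have : (y 0).1 x = 0 := congrFun h0 0
      rw [hy0] at this
      exact one_ne_zero this
    have h2 : ∑ i, ∑ j, y i * M i j * y j = δ := by
      rw [Finset.sum_comm]
      simp only [← Finset.sum_mul, hyM, ite_mul, zero_mul, Finset.sum_ite_eq', Finset.mem_univ,
        if_true, hy0, mul_one]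
    have h3 := congrArg (evalAt x) h2
    simp only [map_sum, map_mul, evalAt_apply] at h3
    rwa [h3] at h1
  obtain ⟨s, hs1, hs2⟩ := exists_smooth_sqrt δ hpos
  have hs0 : ∀ x, 0 < s.1 x := fun x => by rw [hs1]; exact Real.sqrt_pos.mpr (hpos x)
  obtain ⟨t, ht⟩ := exists_smooth_inv s fun x => (hs0 x).ne'
  have ht0 : ∀ x, 0 < t.1 x := fun x => by
    have : t.1 x * s.1 x = 1 := congrArg (evalAt x) ht
    exact pos_of_mul_pos_left (this ▸ one_pos) (hs0 x).le
  refine ⟨Matrix.of (Fin.cons (fun i => t * y i) fun i => Fin.cons 0 (L' i)), ?_, fun i => ?_,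
    fun x => ?_⟩
  · ext1 i j
    rw [triple_product_apply]
    have h0 : ∀ z : Fin (k + 1) → SmoothAlg W, ∑ i, ∑ j, t * y i * M i j * z j = t * δ * z 0 := by
      intro z
      rw [Finset.sum_comm]
      simp only [← Finset.sum_mul, mul_assoc t, ← Finset.mul_sum, hyM, mul_ite, ite_mul, zero_mul,
        mul_zero, Finset.sum_ite_eq', Finset.mem_univ, if_true]
    refine Fin.cases ?_ (fun i => ?_) i <;> refine Fin.cases ?_ (fun j => ?_) j
    · simp only [Matrix.of_apply, Fin.cons_zero, h0]
      rw [hy0, ← hs2, Matrix.one_apply_eq]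
      linear_combination (t * s + 1) * ht
    · simp only [Matrix.of_apply, Fin.cons_zero, Fin.cons_succ, h0, mul_zero]
      rw [Matrix.one_apply_ne (Fin.succ_ne_zero j).symm]
    · rw [Matrix.one_apply_ne (Fin.succ_ne_zero i), Finset.sum_comm]
      simp only [Matrix.of_apply, Fin.cons_zero, Fin.cons_succ]
      refine Eq.trans ?_ ((h0 (Fin.cons 0 (L' i))).trans (by rw [Fin.cons_zero, mul_zero]))
      refine Finset.sum_congr rfl fun a _ => Finset.sum_congr rfl fun b _ => ?_
      rw [hs b a]; ring
    · have h1 := congrFun (congrFun hL i) j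
      rw [triple_product_apply] at h1
      have h2 : (1 : Matrix (Fin (k + 1)) (Fin (k + 1)) (SmoothAlg W)) i.succ j.succ
          = (1 : Matrix (Fin k) (Fin k) (SmoothAlg W)) i j := by
        simp only [Matrix.one_apply, Fin.succ_inj]
      rw [h2, ← h1]
      simp only [Matrix.of_apply, Fin.cons_zero, Fin.cons_succ, Fin.sum_univ_succ, zero_mul,
        mul_zero, Finset.sum_const_zero, zero_add, hM']
  · simp only [Matrix.of_apply, Fin.cons_zero, Fin.cons_succ]
  · simp only [Matrix.of_apply, Fin.cons_zero, hy0, mul_one]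
    exact ht0 x

lemma exists_orthonormalization {k : ℕ} (M : Matrix (Fin k) (Fin k) (SmoothAlg W))
    (hM : IsPosDef M) (hs : ∀ i j, M i j = M j i) :
    ∃ L : Matrix (Fin k) (Fin k) (SmoothAlg W), L * M * L.transpose = 1 := by
  induction k with
  | zero => exact ⟨1, by ext i; exact i.elim0⟩
  | succ k ih =>
    obtain ⟨L', hL'⟩ := ih _ hM.tail fun i j => hs i.succ j.succ
    obtain ⟨L, hL, -⟩ := exists_orthonormalization_succ hM hs hL'
    exact ⟨L, hL⟩

end Orthonormalization

section AdaptedFrameExistence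

open TopologicalSpace IsMetricFrame

variable {m : ℕ} {W : Opens (E (m + 1))}

/-- Frames adapted to a hypersurface exist, given the singular Yamabe equation. -/
theorem exists_isAdaptedFrame {G : E (m + 1) → Matrix (Fin (m + 1)) (Fin (m + 1)) ℝ}
    {u b : E (m + 1) → ℝ} (hG : ∀ i j, ContDiffOn ℝ ∞ (fun x => G x i j) W)
    (hsymm : ∀ x ∈ W, ∀ i j, G x i j = G x j i)
    (hpos : ∀ x ∈ W, ∀ y : Fin (m + 1) → ℝ, y ≠ 0 → 0 < ∑ i, ∑ j, y i * G x i j * y j)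
    (hu : ContDiffOn ℝ ∞ u W) (hu0 : ∀ x ∈ W, pd 0 u x ≠ 0) (hzero : ∀ x ∈ W, x 0 = 0 → u x = 0)
    {k : ℕ} (hk : k ≠ 0) (hS : ∀ x ∈ W, yamabeS G u x = 1 + u x ^ k * b x) :
    ∃ GA F φ v N, IsAdaptedFrame (W := W) G u GA F φ v N := by
  set GA : Matrix (Fin (m + 1)) (Fin (m + 1)) (SmoothAlg W) :=
    Matrix.of fun i j => mkSmooth (fun x => G x i j) (hG i j) with hGA
  set φ : SmoothAlg W := mkSmooth u hu with hφ
  have hφu : Agrees u φ := agrees_mkSmooth u hu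
  set q : SmoothAlg W := pdAlg W 0 φ with hq
  have hq0 : ∀ x, q.1 x ≠ 0 := fun x => (hφu.pd 0 x) ▸ hu0 x x.2
  obtain ⟨q', hq'⟩ := exists_smooth_inv q hq0
  have hGs : ∀ i j, GA i j = GA j i := fun i j =>
    SmoothAlg.ext_apply fun x => hsymm x x.2 i j
  -- The rows are `q ∂₀`, with `q = ∂₀u`, and `∂ᵢ − (∂ᵢu/∂₀u) ∂₀`; the latter are tangent to the
  -- level sets. The factor `q` makes the first row raise `u` at the positive rate `q²`, whatever
  -- the sign of `∂₀u`.
  set C : Matrix (Fin (m + 1)) (Fin (m + 1)) (SmoothAlg W) :=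
    Matrix.of (Fin.cons (fun j => if j = 0 then q else 0) fun i j =>
      if j = 0 then -(q' * pdAlg W i.succ φ) else if j = i.succ then 1 else 0) with hC
  have hC0 : ∀ f : Fin (m + 1) → SmoothAlg W, ∑ j, C 0 j * f j = q * f 0 := by
    intro f
    simp only [hC, Matrix.of_apply, Fin.cons_zero, ite_mul, zero_mul, Finset.sum_ite_eq',
      Finset.mem_univ, if_true]
  have hCs : ∀ (i : Fin m) (f : Fin (m + 1) → SmoothAlg W),
      ∑ j, C i.succ j * f j = f i.succ - q' * pdAlg W i.succ φ * f 0 := by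
    intro i f
    rw [Fin.sum_univ_succ]
    simp only [hC, Matrix.of_apply, Fin.cons_succ, if_pos, if_neg (Fin.succ_ne_zero _),
      Fin.succ_inj, ite_mul, zero_mul, one_mul, Finset.sum_ite_eq', Finset.mem_univ]
    ring
  set M := C * GA * C.transpose with hM
  -- `M` is the Gram matrix of the rows of `C`, which are independent because `q` has no zeros.
  have hMpos : IsPosDef M := by
    intro x y hy
    set z : Fin (m + 1) → ℝ := fun k => ∑ i, y i * (C i k).1 x with hz
    have hzs : ∀ k : Fin m, z k.succ = y k.succ := by
      intro k
      have e0 : (C 0 k.succ).1 x = 0 := by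
        simp only [hC, Matrix.of_apply, Fin.cons_zero, if_neg (Fin.succ_ne_zero k)]; rfl
      have e1 : ∀ i : Fin m, (C i.succ k.succ).1 x = if k = i then 1 else 0 := by
        intro i
        simp only [hC, Matrix.of_apply, Fin.cons_succ, if_neg (Fin.succ_ne_zero k), Fin.succ_inj]
        split_ifs <;> rfl
      simp only [hz, Fin.sum_univ_succ, e0, e1, mul_zero, zero_add, mul_ite, mul_one,
        Finset.sum_ite_eq, Finset.mem_univ, if_true]
    have hz0 : z ≠ 0 := by
      intro h0
      refine hy ?_
      have hs : ∀ k : Fin m, y k.succ = 0 := fun k => by rw [← hzs, h0]; rfl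
      have e0 : (C 0 0).1 x = q.1 x := by
        simp only [hC, Matrix.of_apply, Fin.cons_zero, if_pos]
      have h1 : z 0 = 0 := congrFun h0 0
      simp only [hz, Fin.sum_univ_succ, hs, zero_mul, Finset.sum_const_zero, add_zero, e0,
        mul_eq_zero, hq0 x, or_false] at h1
      ext k
      exact Fin.cases h1 hs k
    have h1 := hpos x x.2 z hz0
    have h2 : ∑ i, ∑ j, y i * (M i j).1 x * y j = ∑ i, ∑ j, z i * G x i j * z j := by
      have e : ∀ i j, (M i j).1 x = ∑ a, ∑ b, (C i a).1 x * G x a b * (C j b).1 x := by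
        intro i j
        have := congrArg (evalAt x) (triple_product_apply C GA i j)
        simp only [map_sum, map_mul, evalAt_apply] at this
        exact this
      calc _ = ∑ i, ∑ j, ∑ a, ∑ b, y i * (C i a).1 x * G x a b * (y j * (C j b).1 x) := by
            simp only [e, Finset.mul_sum, Finset.sum_mul]
            exact Finset.sum_congr rfl fun i _ => Finset.sum_congr rfl fun j _ =>
              Finset.sum_congr rfl fun a _ => Finset.sum_congr rfl fun b _ => by ring
        _ = ∑ a, ∑ b, ∑ i, ∑ j, y i * (C i a).1 x * G x a b * (y j * (C j b).1 x) := by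
            refine (Finset.sum_congr rfl fun i _ => Finset.sum_comm).trans
              (Finset.sum_comm.trans (Finset.sum_congr rfl fun a _ => ?_))
            exact (Finset.sum_congr rfl fun i _ => Finset.sum_comm).trans Finset.sum_comm
        _ = _ := by simp only [hz, Finset.mul_sum, Finset.sum_mul]
                    exact Finset.sum_congr rfl fun i _ => Finset.sum_congr rfl fun j _ =>
                      Finset.sum_comm
    rwa [h2]
  have hMs : ∀ i j, M i j = M j i := by
    intro i j
    rw [hM, triple_product_apply, triple_product_apply, Finset.sum_comm]
    exact Finset.sum_congr rfl fun a _ => Finset.sum_congr rfl fun b _ => by rw [hGs b a]; ring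
  obtain ⟨L', hL'⟩ := exists_orthonormalization _ hMpos.tail fun i j => hMs i.succ j.succ
  obtain ⟨L, hL, hLs, hL0⟩ := exists_orthonormalization_succ hMpos hMs hL'
  -- Only the first row of `C` differentiates `φ`. Since `L` has zeros below the corner, all later
  -- frame members are tangent to the level sets.
  have hD : ∀ a, frameD (pdAlg W) (L * C) a φ = L a 0 * (q * q) := by
    intro a
    have e : frameD (pdAlg W) (L * C) a φ = ∑ j, L a j * ∑ i, C j i * pdAlg W i φ := by
      simp only [frameD_apply, Matrix.mul_apply, Finset.sum_mul, Finset.mul_sum]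
      rw [Finset.sum_comm]
      simp only [mul_assoc]
    rw [e, Fin.sum_univ_succ, hC0]
    simp only [hCs]
    rw [Finset.sum_eq_zero fun i _ => ?_, add_zero]
    linear_combination -(L a i.succ * pdAlg W i.succ φ) * hq'
  set v : SmoothAlg W := L 0 0 * (q * q) with hv
  have hv0 : ∀ x, 0 < v.1 x := fun x =>
    mul_pos (hL0 x) (mul_self_pos.mpr (hq0 x))
  obtain ⟨N, hN⟩ := exists_smooth_inv v fun x => (hv0 x).ne'
  have hmf : IsMetricFrame G GA (L * C) :=
    { agrees := fun i j => agrees_mkSmooth _ (hG i j)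
      symm := by ext1 i j; exact hGs j i
      ortho := by
        rw [Matrix.transpose_mul, ← hL, hM]
        simp only [Matrix.mul_assoc] }
  have htan : ∀ i : Fin m, frameD (pdAlg W) (L * C) i.succ φ = 0 := fun i => by
    rw [hD, hLs, zero_mul]
  refine ⟨GA, L * C, φ, v, N, ⟨hmf, hφu, htan, hD 0, hN, hv0, ?_, ?_⟩⟩
  · exact SmoothAlg.ext_apply fun y => (hφu.slice y).symm.trans (hzero _ y.2 (incl_zero y.1))
  -- Where `u = 0` the Yamabe equation reduces to |du|² = 1, the error term vanishing as `k ≠ 0`;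
  -- positivity selects the root `v = 1`.
  · refine SmoothAlg.ext_apply fun y => ?_
    rw [sliceHom_apply]
    set x : W := ⟨incl y.1, y.2⟩
    have h1 := hmf.gradSq hφu x
    rw [Fin.sum_univ_succ, hD 0] at h1
    simp only [htan, ne_eq, OfNat.ofNat_ne_zero, not_false_eq_true, zero_pow,
      Finset.sum_const_zero, add_zero] at h1
    have h2 := hS x x.2
    have h3 : u x = 0 := hzero _ x.2 (incl_zero y.1)
    rw [yamabeS, h3, mul_zero, zero_mul, sub_zero, zero_pow hk, zero_mul, add_zero, h1] at h2
    have h4 : v.1 x ^ 2 = 1 := h2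
    exact (pow_eq_one_iff_of_nonneg (hv0 x).le two_ne_zero).mp h4

end AdaptedFrameExistence

/-! ### Metrics and densities in coordinates -/

section Charts

open TopologicalSpace Bundle

variable {n : ℕ} {M : Type*} [TopologicalSpace M] [ChartedSpace (E n) M]
  [IsManifold (𝓡 n) ∞ M] {e : OpenPartialHomeomorph M (E n)}

lemma IsChart.contMDiffOn_symm (he : IsChart e) :
    ContMDiffOn (𝓡 n) (𝓡 n) ∞ e.symm e.target :=
  contMDiffOn_symm_of_mem_maximalAtlas he

lemma IsChart.mdifferentiable (he : IsChart e) : e.MDifferentiable (𝓡 n) (𝓡 n) :=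
  ⟨(contMDiffOn_of_mem_maximalAtlas he).mdifferentiableOn (by simp),
    he.contMDiffOn_symm.mdifferentiableOn (by simp)⟩

/-- The coordinate vector fields are smooth. -/
lemma IsChart.contMDiffOn_coordField (he : IsChart e) (i : Fin n) :
    ContMDiffOn (𝓡 n) (𝓡 n).tangent ∞ (fun x : E n => (⟨e.symm x,
      mfderiv (𝓡 n) (𝓡 n) e.symm x (EuclideanSpace.single i (1 : ℝ) : E n)⟩ :
        TangentBundle (𝓡 n) M)) e.target := by
  have h1 := he.contMDiffOn_symm.contMDiffOn_tangentMapWithin (m := ∞) (by simp)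
    e.open_target.uniqueMDiffOn
  have h2 : ContMDiffOn (𝓡 n) (𝓡 n).tangent ∞ (fun x : E n => (⟨x,
      (EuclideanSpace.single i (1 : ℝ) : E n)⟩ : TangentBundle (𝓡 n) (E n))) e.target :=
    contMDiffOn_vectorSpace_iff_contDiffOn.mpr contDiffOn_const
  refine (h1.comp h2 fun x hx => hx).congr fun x hx => ?_
  simp only [Function.comp_apply, tangentMapWithin, mfderivWithin_of_isOpen e.open_target hx]

lemma metricIn_contDiffOn (g : Metric n M) (he : IsChart e) (i j : Fin n) :
    ContDiffOn ℝ ∞ (fun x => metricIn g e x i j) e.target := by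
  rw [← contMDiffOn_iff_contDiffOn]
  intro x hx
  -- The component is viewed as a section of the trivial line bundle, so that smoothness of the
  -- metric tensor applied to two smooth vector fields can be used.
  have h : ContMDiffWithinAt (𝓡 n) ((𝓡 n).prod 𝓘(ℝ)) ∞ (fun x =>
      TotalSpace.mk' ℝ (E := Bundle.Trivial M ℝ) (e.symm x) (metricIn g e x i j)) e.target x := by
    apply ContMDiffWithinAt.clm_bundle_apply₂ (F₁ := E n) (F₂ := E n)
    · exact ContMDiffAt.comp_contMDiffWithinAt x g.contMDiff.contMDiffAt (he.contMDiffOn_symm x hx)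
    · exact he.contMDiffOn_coordField i x hx
    · exact he.contMDiffOn_coordField j x hx
  simp only [contMDiffWithinAt_totalSpace] at h
  exact h.2

lemma metricIn_symm (g : Metric n M) (x : E n) (i j : Fin n) :
    metricIn g e x i j = metricIn g e x j i := g.symm _ _ _

lemma metricIn_pos (g : Metric n M) (he : IsChart e) {x : E n} (hx : x ∈ e.target)
    (y : Fin n → ℝ) (hy : y ≠ 0) : 0 < ∑ i, ∑ j, y i * metricIn g e x i j * y j := by
  set A : E n →L[ℝ] TangentSpace (𝓡 n) (e.symm x) := mfderiv (𝓡 n) (𝓡 n) e.symm x with hA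
  set z : E n := ∑ i, y i • EuclideanSpace.single i (1 : ℝ) with hz
  have hzi : ∀ i, z i = y i := by
    intro i
    rw [hz, WithLp.ofLp_sum, Finset.sum_apply]
    simp
  have hz0 : z ≠ 0 := fun h => hy (by ext i; rw [← hzi, h]; rfl)
  have hAz : A z ≠ 0 := fun h => hz0 (by
    have h1 := congrArg (fun L : E n →L[ℝ] E n => L z) (he.mdifferentiable.comp_symm_deriv hx)
    have h2 : mfderiv (𝓡 n) (𝓡 n) e (e.symm x) (A z) = z := h1
    rw [h, map_zero] at h2
    exact h2.symm)
  have h1 := g.pos _ _ hAz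
  have h2 : g.inner (e.symm x) (A z) (A z) = ∑ i, ∑ j, y i * metricIn g e x i j * y j := by
    simp only [hz, map_sum, map_smul, sum_apply, smul_apply, smul_eq_mul, Finset.mul_sum]
    rw [Finset.sum_comm]
    refine Finset.sum_congr rfl fun i _ => Finset.sum_congr rfl fun j _ => ?_
    change _ = y i * g.inner (e.symm x) (A (EuclideanSpace.single i 1))
      (A (EuclideanSpace.single j 1)) * y j
    ring
  rwa [← h2]

lemma contDiffOn_comp_symm (he : IsChart e) {f : M → ℝ}
    (hf : ContMDiff (𝓡 n) 𝓘(ℝ, ℝ) ∞ f) : ContDiffOn ℝ ∞ (fun z => f (e.symm z)) e.target :=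
  contMDiffOn_iff_contDiffOn.mp (hf.comp_contMDiffOn he.contMDiffOn_symm)

lemma fderiv_comp_symm_ne_zero (he : IsChart e) {f : M → ℝ}
    (hf : ContMDiff (𝓡 n) 𝓘(ℝ, ℝ) ∞ f) {x : E n} (hx : x ∈ e.target)
    (h0 : mfderiv (𝓡 n) 𝓘(ℝ, ℝ) f (e.symm x) ≠ 0) : fderiv ℝ (fun z => f (e.symm z)) x ≠ 0 := by
  intro h
  apply h0
  have h1 := mfderiv_comp x (g := f) (f := e.symm) (hf.mdifferentiableAt (by simp))
    (he.mdifferentiable.mdifferentiableAt_symm hx)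
  have h2 : mfderiv (𝓡 n) 𝓘(ℝ, ℝ) (f ∘ e.symm) x = 0 := by
    rw [mfderiv_eq_fderiv]; exact h
  rw [h2] at h1
  have h3 := he.mdifferentiable.symm_comp_deriv (e.map_target hx)
  rw [e.right_inv hx] at h3
  ext w
  have h4 : mfderiv (𝓡 n) (𝓡 n) e.symm x (mfderiv (𝓡 n) (𝓡 n) e (e.symm x) w) = w :=
    congrArg (fun L => L w) h3
  have h5 := congrArg (fun L : E n →L[ℝ] ℝ => L (mfderiv (𝓡 n) (𝓡 n) e (e.symm x) w)) h1
  change mfderiv (𝓡 n) 𝓘(ℝ, ℝ) f (e.symm x) w = 0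
  rw [← h4]
  exact h5.symm

end Charts

/-! ### Defining densities and adapted frames in slice charts. -/

section SliceCharts

open TopologicalSpace

variable {m : ℕ} {M : Type*} [TopologicalSpace M] [ChartedSpace (E (m + 1)) M]
  [IsManifold (𝓡 (m + 1)) ∞ M] {e : OpenPartialHomeomorph M (E (m + 1))} {S : Set M}
  {c : ConformalStructure (m + 1) M} {σ : Density c 1}

lemma defining_eq_zero (he : IsSliceChart S e) (hσ : IsDefiningDensity σ S) (g : c.metrics)
    {x : E (m + 1)} (hx : x ∈ e.target) (h0 : x 0 = 0) : σ.val g (e.symm x) = 0 := by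
  rw [(hσ g).1, he.2 _ (e.map_target hx), e.right_inv hx, h0]

/-- The function vanishes along the slice, so its tangential partials vanish there. A zero `∂₀`
derivative would then make the whole differential zero. -/
lemma pd_zero_ne_zero (he : IsSliceChart S e) (hσ : IsDefiningDensity σ S) (g : c.metrics)
    {x : E (m + 1)} (hx : x ∈ e.target) (h0 : x 0 = 0) :
    pd 0 (fun z => σ.val g (e.symm z)) x ≠ 0 := by
  intro hp
  have hS : e.symm x ∈ S := ((hσ g).1 _).mp (defining_eq_zero he hσ g hx h0)
  refine fderiv_comp_symm_ne_zero he.1 (σ.smooth g) hx ((hσ g).2 _ hS) ?_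
  set u : E (m + 1) → ℝ := fun z => σ.val g (e.symm z) with hu
  have hd : DifferentiableAt ℝ u x :=
    ((contDiffOn_comp_symm he.1 (σ.smooth g)).contDiffAt
      (e.open_target.mem_nhds hx)).differentiableAt (by simp)
  have hs : ∀ i : Fin m, pd i.succ u x = 0 := by
    intro i
    have hx' := incl_tang h0
    have hev : (fun y => u (incl y)) =ᶠ[nhds (tang x)] fun _ => 0 := by
      have hopen : IsOpen (incl ⁻¹' e.target) := e.open_target.preimage (inclL m).continuous
      filter_upwards [hopen.mem_nhds (by rw [Set.mem_preimage, hx']; exact hx)] with y hy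
      exact defining_eq_zero he hσ g hy (incl_zero y)
    have h1 := pd_congr hev i
    rw [pd_incl (by rw [hx']; exact hd), hx'] at h1
    rw [h1, pd, fderiv_fun_const]
    rfl
  have hall : ∀ i, pd i u x = 0 := fun i => Fin.cases hp hs i
  ext w
  have hw : w = ∑ i, w i • EuclideanSpace.single i (1 : ℝ) := by
    ext i
    rw [WithLp.ofLp_sum, Finset.sum_apply]
    simp
  rw [hw, map_sum]
  simp only [map_smul]
  exact Finset.sum_eq_zero fun i _ => by
    rw [show fderiv ℝ u x (EuclideanSpace.single i (1 : ℝ)) = 0 from hall i, smul_zero]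

/-- An adapted frame near a point of a hypersurface. -/
theorem exists_isAdaptedFrame_slice (he : IsSliceChart S e) (hσ : IsDefiningDensity σ S)
    (g : c.metrics) {b : E (m + 1) → ℝ} {k : ℕ} (hk : k ≠ 0)
    (hS : ∀ x ∈ e.target, yamabeS (metricIn g.1 e) (fun z => σ.val g (e.symm z)) x
      = 1 + σ.val g (e.symm x) ^ k * b x) {U : Set M} (hU : IsOpen U) {p : M}
    (hp : p ∈ e.source) (hpS : p ∈ S) (hpU : p ∈ U) :
    ∃ W : Opens (E (m + 1)), incl (tang (e p)) ∈ W ∧ (∀ x ∈ W, x ∈ e.target ∧ e.symm x ∈ U) ∧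
      ∃ GA F φ v N, IsAdaptedFrame (W := W) (metricIn g.1 e) (fun z => σ.val g (e.symm z))
        GA F φ v N := by
  set u : E (m + 1) → ℝ := fun z => σ.val g (e.symm z) with hu
  have hus : ContDiffOn ℝ ∞ u e.target := contDiffOn_comp_symm he.1 (σ.smooth g)
  have hc : ContinuousOn (pd 0 u) e.target :=
    (pd_contDiffOn (W := ⟨e.target, e.open_target⟩) hus 0).continuousOn
  -- The chart domain is cut down to the preimage of `U` and to the set where `∂₀u ≠ 0`, on which
  -- the adapted frame can be built.
  have hopen : IsOpen ((e.target ∩ e.symm ⁻¹' U) ∩ (e.target ∩ pd 0 u ⁻¹' {0}ᶜ)) :=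
    (e.isOpen_inter_preimage_symm hU).inter
      (hc.isOpen_inter_preimage e.open_target isOpen_compl_singleton)
  have hp0 : e p 0 = 0 := (he.2 p hp).mp hpS
  have ht : e p ∈ e.target := e.map_source hp
  refine ⟨⟨_, hopen⟩, ?_, fun x hx => hx.1, ?_⟩
  · rw [incl_tang hp0]
    refine ⟨⟨ht, ?_⟩, ht, pd_zero_ne_zero he hσ g ht hp0⟩
    rw [Set.mem_preimage, e.left_inv hp]
    exact hpU
  · exact exists_isAdaptedFrame
      (fun i j => (metricIn_contDiffOn g.1 he.1 i j).mono fun x hx => hx.1.1)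
      (fun x _ i j => metricIn_symm g.1 x i j)
      (fun x hx y hy => metricIn_pos g.1 he.1 hx.1.1 y hy) (hus.mono fun x hx => hx.1.1)
      (fun x hx => hx.2.2) (fun x hx h0 => defining_eq_zero he hσ g hx.1.1 h0) hk
      fun x hx => hS x hx.1.1

end SliceCharts

/-! ### The obstruction density at a point of the hypersurface. -/

section Obstruction

open TopologicalSpace

section Surfaces

variable {M : Type*} [TopologicalSpace M] [ChartedSpace (E 3) M] [IsManifold (𝓡 3) ∞ M]
  {c : ConformalStructure 3 M} {S : Set M} {σ : Density c 1} {B : Density c (-((3 : ℕ) : ℤ))}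
  {e : OpenPartialHomeomorph M (E 3)} {p : M}

/-- The obstruction density of a surface in a conformal three-manifold. -/
theorem obstruction_surface (hB : IsASCObstruction S σ B) (g : c.metrics)
    (he : IsSliceChart (m := 2) S e) (hp : p ∈ e.source) (hpS : p ∈ S) :
    B.val g p = surfaceFormula (m := 2) (metricIn g.1 e) (fun z => σ.val g (e.symm z))
      (tang (e p)) := by
  obtain ⟨W, hyW, hW, GA, F, φ, v, N, h⟩ := exists_isAdaptedFrame_slice (m := 2) he hB.1 g
    three_ne_zero (hB.2 g e he.1) isOpen_univ hp hpS (Set.mem_univ p)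
  have hb := agrees_mkSmooth (W := W) _
    ((contDiffOn_comp_symm he.1 (B.smooth g)).mono fun x hx => (hW x hx).1)
  have h1 := h.surface hb (fun x hx => hB.2 g e he.1 x (hW x hx).1) ⟨tang (e p), hyW⟩
  rw [incl_tang (m := 2) ((he.2 p hp).mp hpS), e.left_inv hp] at h1
  exact h1

/-- The obstruction density of a surface in a flat scale. -/
theorem obstruction_willmore (hB : IsASCObstruction S σ B) (g : c.metrics)
    (he : IsSliceChart (m := 2) S e) {U : Set M} (hU : IsOpen U) (hfl : IsFlatOn g.1 U)
    (hp : p ∈ e.source) (hpS : p ∈ S) (hpU : p ∈ U) :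
    B.val g p = -(1 / 3 : ℝ) * willmoreInvariant (m := 2) (metricIn g.1 e)
      (fun z => σ.val g (e.symm z)) (tang (e p)) := by
  obtain ⟨W, hyW, hW, GA, F, φ, v, N, h⟩ := exists_isAdaptedFrame_slice (m := 2) he hB.1 g
    three_ne_zero (hB.2 g e he.1) hU hp hpS hpU
  have hb := agrees_mkSmooth (W := W) _
    ((contDiffOn_comp_symm he.1 (B.smooth g)).mono fun x hx => (hW x hx).1)
  have h1 := h.willmore hb (fun x hx => hB.2 g e he.1 x (hW x hx).1)
    (fun x hx => hfl e he.1 x (hW x hx).1 (hW x hx).2) ⟨tang (e p), hyW⟩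
  rw [incl_tang (m := 2) ((he.2 p hp).mp hpS), e.left_inv hp] at h1
  exact h1

end Surfaces

/-- The obstruction density of a hypersurface in a four-manifold, in a flat scale. -/
theorem obstruction_threefold {M : Type*} [TopologicalSpace M] [ChartedSpace (E 4) M]
    [IsManifold (𝓡 4) ∞ M] {c : ConformalStructure 4 M} {S : Set M} {σ : Density c 1}
    {B : Density c (-((4 : ℕ) : ℤ))} {e : OpenPartialHomeomorph M (E 4)} {p : M}
    (hB : IsASCObstruction S σ B) (g : c.metrics)
    (he : IsSliceChart (m := 3) S e) {U : Set M} (hU : IsOpen U) (hfl : IsFlatOn g.1 U)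
    (hp : p ∈ e.source) (hpS : p ∈ S) (hpU : p ∈ U) :
    B.val g p = threefoldFormula (m := 3) (metricIn g.1 e)
      (fun z => σ.val g (e.symm z)) (tang (e p)) := by
  obtain ⟨W, hyW, hW, GA, F, φ, v, N, h⟩ := exists_isAdaptedFrame_slice (m := 3) he hB.1 g
    four_ne_zero (hB.2 g e he.1) hU hp hpS hpU
  have hb := agrees_mkSmooth (W := W) _
    ((contDiffOn_comp_symm he.1 (B.smooth g)).mono fun x hx => (hW x hx).1)
  have h1 := h.threefold hb (fun x hx => hB.2 g e he.1 x (hW x hx).1)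
    (fun x hx => hfl e he.1 x (hW x hx).1 (hW x hx).2) ⟨tang (e p), hyW⟩
  rw [incl_tang (m := 3) ((he.2 p hp).mp hpS), e.left_inv hp] at h1
  exact h1

end Obstruction

end ConfHyp

end

theorem mainTheorem9 :
    -- surfaces in conformal 3-manifolds
    (∀ (M : Type*) [TopologicalSpace M] [ChartedSpace (ConfHyp.E 3) M] [IsManifold (𝓡 3) ∞ M]
      (c : ConfHyp.ConformalStructure 3 M) (S : Set M) (σ : ConfHyp.Density c 1)
      (B : ConfHyp.Density c (-((3 : ℕ) : ℤ))), ConfHyp.IsASCObstruction S σ B →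
      ∀ (g : c.metrics) (e : OpenPartialHomeomorph M (ConfHyp.E 3)),
        ConfHyp.IsSliceChart (m := 2) S e → ∀ p ∈ e.source, p ∈ S →
          B.val g p = ConfHyp.surfaceFormula (m := 2) (ConfHyp.metricIn g.1 e)
              (fun z => σ.val g (e.symm z)) (ConfHyp.tang (e p)) ∧
          -- in a flat scale this is a multiple of the Willmore invariant
          ∀ U : Set M, IsOpen U → p ∈ U → ConfHyp.IsFlatOn g.1 U →
            B.val g p = -(1 / 3 : ℝ) * ConfHyp.willmoreInvariant (m := 2) (ConfHyp.metricIn g.1 e)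
              (fun z => σ.val g (e.symm z)) (ConfHyp.tang (e p))) ∧
    -- hypersurfaces in conformally flat 4-manifolds, in a (local) flat scale
    (∀ (M : Type*) [TopologicalSpace M] [ChartedSpace (ConfHyp.E 4) M] [IsManifold (𝓡 4) ∞ M]
      (c : ConfHyp.ConformalStructure 4 M) (S : Set M) (σ : ConfHyp.Density c 1)
      (B : ConfHyp.Density c (-((4 : ℕ) : ℤ))), ConfHyp.IsASCObstruction S σ B →
      ∀ (g : c.metrics) (U : Set M), IsOpen U → ConfHyp.IsFlatOn g.1 U →
      ∀ e : OpenPartialHomeomorph M (ConfHyp.E 4),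
        ConfHyp.IsSliceChart (m := 3) S e → ∀ p ∈ e.source, p ∈ S → p ∈ U →
          B.val g p = ConfHyp.threefoldFormula (m := 3) (ConfHyp.metricIn g.1 e)
              (fun z => σ.val g (e.symm z)) (ConfHyp.tang (e p))) := by
  refine ⟨?_, ?_⟩
  · intro M _ _ _ c S σ B hB g e he p hp hpS
    refine ⟨ConfHyp.obstruction_surface hB g he hp hpS, fun U hU hpU hfl => ?_⟩
    exact ConfHyp.obstruction_willmore hB g he hU hfl hp hpS hpU
  · intro M _ _ _ c S σ B hB g U hU hfl e he p hp hpS hpU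
    exact ConfHyp.obstruction_threefold hB g he hU hfl hp hpS hpU
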